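/- **Setting.** Let $n\ge 1$ and let $\mathfrak M$ be a matchbox manifold of leaf dimension $n$: a compact connected metric space with finitely many charts $\varphi_i=(\lambda_i,\pi_i)$, each a homeomorphism of an open set onto $(-2,2)^n\times\mathfrak T_i$, where $\mathfrak T_i$ is a clopen subset of a totally disconnected compact metric space $\mathfrak X$. The flow boxes $U_i=\varphi_i^{-1}((-1,1)^n\times\mathfrak T_i)$ cover $\mathfrak M$, coordinate changes preserve plaques, and coordinate changes and a given leafwise Riemannian metric are smooth along leaves and transversely continuous in the $C^\infty$-topology. Write $\overline U_i=\varphi_i^{-1}([-1,1]^n\times\mathfrak T_i)$, $\mathcal P_i(w)=\varphi_i^{-1}([-1,1]^n\times\{w\})$ (closed plaques), $\mathcal P_i(x)=\mathcal P_i(\pi_i(x))$, $L_x$ for the leaf of $x$, $d_{\mathcal F}$ for the leafwise distance ($\infty$ between different leaves), $D_{\mathcal F}(x,r)$ and $B_{\mathcal F}(x,r)$ for the closed and open leafwise disks. The partial map $h_{j,i}$ sends $w$ to $w'$ if the open plaques with labels $w\in\mathfrak T_i$, $w'\in\mathfrak T_j$ meet. **Regular covering.** $\lambda_{\mathcal F}>0$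 is such that all disks $D_{\mathcal F}(x,s)$, $0<s\le\lambda_{\mathcal F}$, are strongly convex; closed plaques are strongly convex with any two points at distance $<\lambda_{\mathcal F}/2$; $0<\delta<\lambda_{\mathcal F}/4$ and $D_{\mathcal F}(c,\delta/2)\subset\mathcal P_i(w)\subset D_{\mathcal F}(c,\delta)$ for each plaque center $c=\varphi_i^{-1}(0,w)$; the maps $h_{j,i}$ are single valued; every ball $B(z,\epsilon_U)$ of $\mathfrak M$, $\epsilon_U>0$, lies in some $U_i$; and $\epsilon'_U>0$ satisfies $D_{\mathcal F}(y,\epsilon'_U)\subset \{x: d(x,y)\le\epsilon_U/4\}$ for all $y$. **Constants.** Put $C_n=\sum_{k=1}^{n+1}\binom{10^n}{k}$, $\varepsilon_1=1/(1000\,n\,100^nC_n)$, $\varepsilon_2=1/(2000\cdot 2^nC_n)$, $\varepsilon_3=\varepsilon_1/10$. For $\rho_0,\varepsilon$ put $\delta_0=0$, $\delta_1=2$, $\delta_2=50$, $\rho_m(\rho_0,\varepsilon)=\rho_0-\varepsilon\delta_m$ and $\delta_{m+1}=\delta_m+24(1+\delta_m)/\rho_m(\rho_0,\varepsilon)$ for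 $m\ge2$; put $\hat\rho_k=(18-\frac{2k}{3n})\varepsilon_2$ and $\hat\rho'_k=(18-\frac{2k+1}{3n})\varepsilon_2$. Let $\varepsilon_4>0$ be such that for $1\le k\le n+1$ the numbers $\rho_m(\hat\rho_k,10\varepsilon_4)$, $\rho_m(\hat\rho'_k,10\varepsilon_4)$, $0\le m\le n$, are positive and $$\hat\rho_k>\rho_n(\hat\rho_k,10\varepsilon_4)>\hat\rho'_k,\qquad \hat\rho'_k>\rho_n(\hat\rho'_k,10\varepsilon_4)>\hat\rho_{k+1}.$$ Let $\delta^*>0$ be such that for every basis $(f'_j)$ of $\mathbb R^n$ with $1-\delta^*<\|f'_j\|<1+\delta^*$ and $|f'_i\cdot f'_j|<\delta^*$ for $i\ne j$ there is an orthonormal basis $(f_j)$ with $\|f_j-f'_j\|\le\varepsilon_4$. Let $\varepsilon_0>0$ satisfy $\varepsilon_0<\frac1{2000}$, $\varepsilon_0\le 50n(\frac25)^n\varepsilon_1$, $\varepsilon_0<\frac{\varepsilon_2}{2000}$, $\varepsilon_0<\frac{\varepsilon_3}4$, $\varepsilon_0<\frac{\varepsilon_1}2<\varepsilon_1-2\varepsilon_3$,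 $\varepsilon_0<\frac{\varepsilon_3}{2\left(1+35n^{3/2}(4/(15\varepsilon_2))^{n-1}\right)}$, $\varepsilon_0<\frac{\varepsilon_4}{20}$ and $\varepsilon_0<\frac{\delta^*}{100}$. **Scales.** Let $\lambda_0>0$ be such that whenever $0<\lambda\le\min(\lambda_0,\lambda_{\mathcal F}/2)$ and $D_{\mathcal F}(x,\lambda)\subset U_i$, then in the chart $\varphi_i$, for every orthonormal frame $u$ of $T_xL_x$ (regarded as a linear isomorphism $u:\mathbb R^n\to\mathbb R^n$ in the chart), with $\tilde x=\lambda_i(x)$ and all leafwise objects expressed in the coordinates of the plaque of $x$: (a) the metric coefficients at $\tilde x+u(a)$ in the frame $u$ differ from $\delta_{jk}$ by at most $\varepsilon_0/n^2$, and (b) $d_{\mathcal F}(\exp_x(ua),\tilde x+u(a))\le\varepsilon_0\|a\|$, both for $\|a\|\le\lambda$ and $\tilde x+u(a)\in(-1,1)^n$; (c) if $\sigma:[0,1]\to D_{\mathcal F}(x,\lambda)$ is a shortest geodesic and $\tau$ the straight coordinate segment with the same ends, then $d_{\mathcal F}(\sigma(t),\tau(t))\le\varepsilon_0 d_{\mathcal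 F}(\sigma(0),\sigma(1))$; (d) for $0<s\le\lambda$ the Riemannian volume of $D_{\mathcal F}(x,s)$ differs from the Euclidean volume of the disk $D(s)=\{\|a\|\le s\}$ by at most $\varepsilon_0s^n$, and likewise for $\exp_x(u(O))$ and $O$ for every open $O\subset D(s)$. Put $r_{\mathcal F}=\min\{\delta,\lambda_{\mathcal F}/5,\lambda_0,1\}$, and assume $r_{\mathcal F}\le\epsilon'_U$. Let $r_*>0$ be such that: for all $i$, all $w,w'\in\mathfrak T_i$ with $d(w,w')\le r_*$ and all $a,b\in[-1,1]^n$, the leafwise distances between the points with coordinates $a,b$ in $\mathcal P_i(w)$ and in $\mathcal P_i(w')$ differ by at most $\varepsilon_0r_{\mathcal F}$; and whenever $z\in\overline U_i\cap\overline U_j$, $w\in\mathfrak T_i$, $w'\in\mathfrak T_j$, $d(w,\pi_i(z))\le r_*$, $d(w',\pi_j(z))\le r_*$ and $\mathcal P_i(w)\cap\mathcal P_j(w')\ne\emptyset$, then $d_{\mathcal F}(\varphi_i^{-1}(\lambda_i(z),w),\varphi_j^{-1}(\lambda_j(z),w'))\le\varepsilon_0r_{\mathcal F}$. **Reeb neighborhood.**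 Let $\mathcal M_0\ni z_0$ be an $(e_1,\epsilon'_U/4)$-net (separated by $e_1$ and $\epsilon'_U/4$-dense) of the leaf $L_0$ of $z_0$, for some $0<e_1<\epsilon'_U/4$; for $z\in\mathcal M_0$ let $i_z$ be an index with $B(z,\epsilon_U)\subset U_{i_z}$ and put $\mathcal P(z)=\mathcal P_{i_z}(z)$. Let $\mathcal M'_0\subset\mathcal M''_0$ be finite subsets of $\mathcal M_0$ with $z_0\in\mathcal M_0'$, such that $K_0=\bigcup_{z\in\mathcal M_0'}\mathcal P(z)$ is connected. Let $V_0\subset\mathfrak T_{i_{z_0}}$ be a clopen set containing $\pi_{i_{z_0}}(z_0)$ on which, for each $z\in\mathcal M_0''$, the holonomy $h_z$ along a chain of net points from $z_0$ to $z$ with consecutive leafwise distances $<\epsilon'_U$ is defined ($h_{z_0}=\mathrm{id}$), with $d(h_z(v),\pi_{i_z}(z))\le r_*/2$ for $v\in V_0$. Assume that $V_0$ defines an embedded Reeb neighborhood: for $z,z'\in\mathcal M''_0$, if the open plaques of $z$ and $z'$ meet then $h_{i_{z'},i_z}\circ h_z=h_{z'}$ on $V_0$; and if $\mathcal P_{i_z}(h_z(v))$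 meets $\mathcal P_{i_{z'}}(h_{z'}(v'))$ for some $v,v'\in V_0$, then $v=v'$ and $\mathcal P(z)$ meets $\mathcal P(z')$. **Nice transversal.** For $Y\subset\mathfrak M$, distinct points $y_0,\dots,y_n\in Y$ span a leafwise Delaunay simplex $\Delta(y_0,\dots,y_n)$ of $Y$ with center $\omega$ and radius $r>0$ if $\omega\in L_{y_0}$, $d_{\mathcal F}(\omega,y_k)=r$ for all $k$, and $B_{\mathcal F}(\omega,r)\cap Y=\emptyset$. Let $\mathcal X=\mathcal X_1\cup\dots\cup\mathcal X_p$, $\mathcal X_j=\{\varphi_{\theta_j}^{-1}(\lambda_{\theta_j}(\xi_j),h_{z_j}(v)):v\in V_0\}$, $\theta_j=i_{z_j}$, where $z_j\in\mathcal M''_0$, $\xi_j\in K_0$, $d_{\mathcal F}(\xi_j,z_j)<\epsilon'_U/2$, $\xi_1=z_1=z_0$, and for every $j\ge2$ there is a point $\xi'_j$ with $d_{\mathcal F}(\xi'_j,\xi_j)<r_{\mathcal F}/200$ such that, with $\widehat{\mathcal X}=\mathcal X_1\cup\dots\cup\mathcal X_{j-1}$: 1. $B_{\mathcal F}(\xi'_j,r_{\mathcal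 F}/200)\subset K_0$, and each point of this ball is at leafwise distance $>0.12\,r_{\mathcal F}$ from all points of $\widehat{\mathcal X}$ and $\le0.18\,r_{\mathcal F}$ from some point of $\widehat{\mathcal X}$; 2. $\xi_j$ has leafwise distance $>2\varepsilon_1r_{\mathcal F}$ from every point of the circumscribed sphere of every Delaunay $n$-simplex of $\widehat{\mathcal X}$ of radius $\le 0.2\,r_{\mathcal F}$ with vertices in $D_{\mathcal F}(\xi'_j,0.8\,r_{\mathcal F})$; 3. for $1\le k<n$ and distinct $y_m\in\mathcal X_{l_m}\cap D_{\mathcal F}(\xi'_j,0.8\,r_{\mathcal F})$, $0\le m\le k$, $l_0<\dots<l_k<j$, the point $\xi_j$ has leafwise distance $>2\varepsilon_2r_{\mathcal F}$ from every point $\exp_{y_k}(b)$ with $\|b\|\le0.4\,r_{\mathcal F}$ and $b$ in the linear span of the vectors $a_m\in T_{y_k}L_{y_k}$ with $\exp_{y_k}(a_m)=y_m$, $\|a_m\|=d_{\mathcal F}(y_k,y_m)$. Finally, assume that every point of $K_0$ is at leafwise distance $\le0.18\,r_{\mathcal F}$ from some point of $\mathcal X$. **Proposition.** Let $\Delta(y_0,\dots,y_n)$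 be a leafwise Delaunay simplex of $\mathcal X$ with center $\omega(y)$ and radius $r(y)\le0.19\,r_{\mathcal F}$, with $y_k\in\mathcal X_{i_k}$ and the vertices ordered so that $i_n=\max_k i_k$; put $\theta=\theta_{i_n}$. Then $y_0,\dots,y_n,\omega(y)\in\mathcal P_\theta(y_n)$, and for every $q\in\mathcal X_{i_n}$ and every $k$ the set $\mathcal X_{i_k}\cap\mathcal P_\theta(q)$ is a single point. Let $x_n\in\mathcal X_{i_n}$ be arbitrary and let $\{x_0,\dots,x_n\}$ be the transverse translate of the vertices, $x_k=\mathcal X_{i_k}\cap\mathcal P_\theta(x_n)$. Then there are $\omega(x)\in\mathcal P_\theta(x_n)$ and $r(x)>0$ with $$x_k\in\mathcal X\cap L_{x_n},\qquad d_{\mathcal F}(\omega(x),x_k)=r(x)\qquad(0\le k\le n),$$ $$d_{\mathcal F}(\omega(x),\omega'(y))\le\varepsilon_3r_{\mathcal F}/2,\qquad |r(x)-r(y)|<\varepsilon_3r_{\mathcal F}/2+2\varepsilon_0r_{\mathcal F}<\varepsilon_3r_{\mathcal F},$$ where $\omega'(y)=\varphi_\theta^{-1}(\lambda_\theta(\omega(y)),\pi_\theta(x_n))$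 is the translate of the center. -/

import Mathlib

noncomputable section

namespace Matchbox

open Set Filter Topology MeasureTheory
open scoped ENNReal

/-! ### Smooth foliated spaces with totally disconnected transversals -/

/-- Euclidean space `ℝⁿ`. -/
abbrev E (n : ℕ) := EuclideanSpace ℝ (Fin n)

/-- The open cube `(-1,1)ⁿ`. -/
def cube (n : ℕ) : Set (E n) := {v | ∀ k, |v k| < 1}

/-- The closed cube `[-1,1]ⁿ`. -/
def closedCube (n : ℕ) : Set (E n) := {v | ∀ k, |v k| ≤ 1}

/-- The open cube `(-2,2)ⁿ`. -/
def bigCube (n : ℕ) : Set (E n) := {v | ∀ k, |v k| < 2}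

/-- For two charts `e`, `e'`: the points `(v,w)` of `(-1,1)ⁿ × T` whose image under `e⁻¹` has
leafwise coordinate in `(-1,1)ⁿ` for `e'`. -/
def overlap {n : ℕ} {M X : Type*} [TopologicalSpace M] [TopologicalSpace X]
    (e e' : OpenPartialHomeomorph M (E n × X)) (T : Set X) : Set (E n × X) :=
  {q | q.1 ∈ cube n ∧ q.2 ∈ T ∧ e.symm q ∈ e'.source ∧ (e' (e.symm q)).1 ∈ cube n}

/-- The leafwise part of the coordinate change from `e` to `e'` on the plaque with label `w`. -/
def trans {n : ℕ} {M X : Type*} [TopologicalSpace M] [TopologicalSpace X]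
    (e e' : OpenPartialHomeomorph M (E n × X)) (w : X) (v : E n) : E n :=
  (e' (e.symm (v, w))).1

/-- A foliated atlas of leaf dimension `n` on `M` with transverse model `X`, indexed by `ι`,
smooth along the leaves, together with a leafwise Riemannian metric.

The chart `chart i` is a homeomorphism of an open set of `M` onto `(-2,2)ⁿ × T i`; the flow boxes
of the foliated space are the preimages of `(-1,1)ⁿ × T i` and of `[-1,1]ⁿ × T i`.  "Smooth with
continuous dependence on the transverse variable in the `C^∞`-topology" is: smooth in the leafwise
variable, with all leafwise derivatives jointly continuous. -/
structure FoliatedAtlas (n : ℕ) (M X ι : Type*) [TopologicalSpace M] [TopologicalSpace X] where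
  chart : ι → OpenPartialHomeomorph M (E n × X)
  T : ι → Set X
  T_clopen : ∀ i, IsClopen (T i)
  target_eq : ∀ i, (chart i).target = bigCube n ×ˢ T i
  cover : ∀ x : M, ∃ i, x ∈ (chart i).source ∧ (chart i x).1 ∈ cube n
  /-- coordinate changes map plaques into plaques, locally -/
  foliated : ∀ i j, ∀ v ∈ bigCube n, ∀ w ∈ T i, (chart i).symm (v, w) ∈ (chart j).source →
    ∀ᶠ v' in 𝓝 v,
      (chart j ((chart i).symm (v', w))).2 = (chart j ((chart i).symm (v, w))).2
  trans_smooth : ∀ i j w, ContDiffOn ℝ ((⊤ : ℕ∞) : WithTop ℕ∞) (trans (chart i) (chart j) w)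
    {v | (v, w) ∈ overlap (chart i) (chart j) (T i)}
  trans_cont : ∀ i j (m : ℕ), ContinuousOn
    (fun q : E n × X => iteratedFDeriv ℝ m (trans (chart i) (chart j) q.2) q.1)
    (overlap (chart i) (chart j) (T i))
  /-- the metric tensor in the chart `i`, at the point with coordinates `(v,w)` -/
  g : ι → E n × X → E n →L[ℝ] E n →L[ℝ] ℝ
  g_symm : ∀ i, ∀ v ∈ cube n, ∀ w ∈ T i, ∀ a b, g i (v, w) a b = g i (v, w) b a
  g_pos : ∀ i, ∀ v ∈ cube n, ∀ w ∈ T i, ∀ a, a ≠ 0 → 0 < g i (v, w) a a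
  g_smooth : ∀ i, ∀ w ∈ T i, ContDiffOn ℝ ((⊤ : ℕ∞) : WithTop ℕ∞) (fun v => g i (v, w)) (cube n)
  g_cont : ∀ i (m : ℕ), ContinuousOn
    (fun q : E n × X => iteratedFDeriv ℝ m (fun v => g i (v, q.2)) q.1) (cube n ×ˢ T i)
  g_compat : ∀ i j, ∀ q ∈ overlap (chart i) (chart j) (T i), ∀ a b,
    g i q a b = g j (chart j ((chart i).symm q))
      (fderiv ℝ (trans (chart i) (chart j) q.2) q.1 a)
      (fderiv ℝ (trans (chart i) (chart j) q.2) q.1 b)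

namespace FoliatedAtlas

variable {n : ℕ} {M X ι : Type*} [TopologicalSpace M] [TopologicalSpace X]
  (A : FoliatedAtlas n M X ι)

/-- The leafwise coordinate `λ_i`. -/
def lam (i : ι) (x : M) : E n := (A.chart i x).1

/-- The transverse coordinate `π_i`. -/
def pr (i : ι) (x : M) : X := (A.chart i x).2

/-- The point with coordinates `(v,w)` in the chart `i`. -/
def pt (i : ι) (v : E n) (w : X) : M := (A.chart i).symm (v, w)

/-- The open flow box `U_i`. -/
def U (i : ι) : Set M := {x | x ∈ (A.chart i).source ∧ A.lam i x ∈ cube n}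

/-- The closed flow box. -/
def Ubar (i : ι) : Set M := {x | x ∈ (A.chart i).source ∧ A.lam i x ∈ closedCube n}

/-- The closed plaque `P_i(w)`. -/
def plaque (i : ι) (w : X) : Set M := {x | x ∈ A.Ubar i ∧ A.pr i x = w}

/-! ### Leafwise distance -/

/-- `LeafPath x y ℓ`: there is a piecewise `C¹` leafwise path of length `ℓ` from `x` to `y`,
each piece being a `C¹` path in one plaque of one chart. -/
inductive LeafPath : M → M → ℝ → Prop
  | refl (x : M) : LeafPath x x 0
  | step (x : M) (ℓ : ℝ) (i : ι) (w : X) (c : ℝ → E n) :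
      w ∈ A.T i → ContDiff ℝ 1 c → (∀ t ∈ Icc (0 : ℝ) 1, c t ∈ cube n) →
      LeafPath x (A.pt i (c 0) w) ℓ →
      LeafPath x (A.pt i (c 1) w)
        (ℓ + ∫ t in (0 : ℝ)..1, √(A.g i (c t, w) (deriv c t) (deriv c t)))

/-- The leafwise distance (`∞` for points on different leaves). -/
def leafDist (x y : M) : ℝ≥0∞ := ⨅ (ℓ : ℝ) (_ : A.LeafPath x y ℓ), ENNReal.ofReal ℓ

/-- The leaf through `x`. -/
def leaf (x : M) : Set M := {y | A.leafDist x y < ⊤}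

/-- The closed leafwise disk `D_F(x,r)`. -/
def closedDisk (x : M) (r : ℝ) : Set M := {y | A.leafDist x y ≤ ENNReal.ofReal r}

/-! ### Geodesics, convexity, the exponential map -/

/-- `γ` is, on `[0,1]`, a geodesic of a leaf: near each `t ∈ [0,1]` it stays in one plaque of some
chart, and its coordinate expression `c` satisfies the geodesic equation, written as
`g(c'',e) + (D_{c'} g)(c',e) = ½ (D_e g)(c',c')` for all `e`. -/
def IsGeodesic (γ : ℝ → M) : Prop :=
  ∀ t ∈ Icc (0 : ℝ) 1, ∃ i : ι,
    (∀ᶠ s in 𝓝 t, γ s ∈ A.U i ∧ A.pr i (γ s) = A.pr i (γ t)) ∧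
    ContDiffAt ℝ 2 (fun s => A.lam i (γ s)) t ∧
    ∀ e : E n,
      A.g i (A.chart i (γ t)) (deriv (deriv fun s => A.lam i (γ s)) t) e
        + fderiv ℝ (fun v => A.g i (v, A.pr i (γ t))) (A.lam i (γ t))
            (deriv (fun s => A.lam i (γ s)) t) (deriv (fun s => A.lam i (γ s)) t) e
      = 1 / 2 * fderiv ℝ (fun v => A.g i (v, A.pr i (γ t))) (A.lam i (γ t)) e
            (deriv (fun s => A.lam i (γ s)) t) (deriv (fun s => A.lam i (γ s)) t)

/-- `γ|[0,1]` is a shortest geodesic segment from `x` to `y`, with constant speed. -/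
def IsMinGeodesic (γ : ℝ → M) (x y : M) : Prop :=
  A.IsGeodesic γ ∧ γ 0 = x ∧ γ 1 = y ∧
    ∀ t ∈ Icc (0 : ℝ) 1, A.leafDist x (γ t) = ENNReal.ofReal t * A.leafDist x y

/-- Strong convexity: any two points of `S` are joined by a unique shortest geodesic segment of
the leaf, and this segment lies in `S`. -/
def StronglyConvex (S : Set M) : Prop :=
  ∀ y ∈ S, ∀ y' ∈ S,
    (∃ γ, A.IsMinGeodesic γ y y' ∧ ∀ t ∈ Icc (0 : ℝ) 1, γ t ∈ S) ∧
    ∀ γ γ', A.IsMinGeodesic γ y y' → A.IsMinGeodesic γ' y y' → EqOn γ γ' (Icc 0 1)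

/-- `y = exp_x(v)`, for `x ∈ U_i` and a tangent vector `v` at `x` given in the chart `i`. -/
def IsExp (i : ι) (x : M) (v : E n) (y : M) : Prop :=
  x ∈ A.U i ∧ ∃ γ, A.IsGeodesic γ ∧ γ 0 = x ∧ γ 1 = y ∧
    deriv (fun s => A.lam i (γ s)) 0 = v

/-- An orthonormal frame of the tangent space of the leaf at `x ∈ U_i`, given in the chart `i` as
the linear map `a ↦ ∑ a_k u_k`. -/
def IsFrame (i : ι) (x : M) (u : E n →ₗ[ℝ] E n) : Prop :=
  x ∈ A.U i ∧ ∀ a b : E n, A.g i (A.chart i x) (u a) (u b) = inner ℝ a b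

/-- The Riemannian volume, in the chart `i` and the plaque `w`, of a set of leafwise
coordinates. -/
def vol (i : ι) (w : X) (S : Set (E n)) : ℝ≥0∞ :=
  ∫⁻ v in S, ENNReal.ofReal √(Matrix.det (Matrix.of fun j k : Fin n =>
    A.g i (v, w) (EuclideanSpace.single j 1) (EuclideanSpace.single k 1)))

/-- The geodesic coordinates at `x` with frame `u`, on the Euclidean disk of radius `r`, are
`ε`-approximately Euclidean in the chart `i`. -/
structure IsApproxEuclid (i : ι) (x : M) (u : E n →ₗ[ℝ] E n) (r ε : ℝ) : Prop where
  metric : ∀ a : E n, ‖a‖ ≤ r → A.lam i x + u a ∈ cube n → ∀ j k : Fin n,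
    |A.g i (A.lam i x + u a, A.pr i x) (u (EuclideanSpace.single j 1))
        (u (EuclideanSpace.single k 1)) - (if j = k then 1 else 0)| ≤ ε / (n : ℝ) ^ 2
  exp_close : ∀ a : E n, ‖a‖ ≤ r → A.lam i x + u a ∈ cube n → ∀ y, A.IsExp i x (u a) y →
    A.leafDist y (A.pt i (A.lam i x + u a) (A.pr i x)) ≤ ENNReal.ofReal (ε * ‖a‖)
  segments : ∀ (γ : ℝ → M) (y y' : M), A.IsMinGeodesic γ y y' →
    (∀ t ∈ Icc (0 : ℝ) 1, γ t ∈ A.closedDisk x r) → ∀ t ∈ Icc (0 : ℝ) 1,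
    A.leafDist (γ t)
        (A.pt i (A.lam i y + t • (A.lam i y' - A.lam i y)) (A.pr i x))
      ≤ ENNReal.ofReal ε * A.leafDist y y'
  disk_volume : ∀ s : ℝ, 0 < s → s ≤ r →
    volume (Metric.closedBall (0 : E n) s)
        ≤ A.vol i (A.pr i x) (A.lam i '' A.closedDisk x s) + ENNReal.ofReal (ε * s ^ n) ∧
    A.vol i (A.pr i x) (A.lam i '' A.closedDisk x s)
        ≤ volume (Metric.closedBall (0 : E n) s) + ENNReal.ofReal (ε * s ^ n)
  open_volume : ∀ s : ℝ, 0 < s → s ≤ r → ∀ O : Set (E n), IsOpen O →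
    O ⊆ Metric.closedBall 0 s →
    volume O ≤ A.vol i (A.pr i x) {v | ∃ a ∈ O, ∃ y, A.IsExp i x (u a) y ∧ v = A.lam i y}
        + ENNReal.ofReal (ε * s ^ n) ∧
    A.vol i (A.pr i x) {v | ∃ a ∈ O, ∃ y, A.IsExp i x (u a) y ∧ v = A.lam i y}
        ≤ volume O + ENNReal.ofReal (ε * s ^ n)

/-- The generator of holonomy from the chart `i` to the chart `j`, as a relation: `w' = h_{ji}(w)`
if the open plaques with labels `w`, `w'` meet. -/
def Hol (i j : ι) (w w' : X) : Prop :=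
  ∃ x, x ∈ A.U i ∧ x ∈ A.U j ∧ A.pr i x = w ∧ A.pr j x = w'

end FoliatedAtlas

/-! ### The dimension constants -/

/-- `C_n`, the number of nonempty subsets with at most `n+1` elements of a set with `10ⁿ`
elements. -/
def Cn (n : ℕ) : ℝ := ∑ k ∈ Finset.Icc 1 (n + 1), ((10 ^ n).choose k : ℝ)

/-- `ε₁`. -/
def eps1 (n : ℕ) : ℝ := 1 / (Cn n * 1000 * n * 100 ^ n)

/-- `ε₂`. -/
def eps2 (n : ℕ) : ℝ := 1 / (Cn n * 2000 * 2 ^ n)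

/-- `ε₃`. -/
def eps3 (n : ℕ) : ℝ := eps1 n / 10

/-- The coefficients `δ_m` for the initial data `(ρ₀, ε)`, in the form
`δ_{m+1} = δ_m + 24 (1 + δ_m) / (ρ₀ - ε δ_m)` for `m ≥ 2`. -/
def robDelta (ρ₀ ε : ℝ) : ℕ → ℝ
  | 0 => 0
  | 1 => 2
  | 2 => 50
  | (m + 3) => robDelta ρ₀ ε (m + 2)
      + 24 * (1 + robDelta ρ₀ ε (m + 2)) / (ρ₀ - ε * robDelta ρ₀ ε (m + 2))

/-- The robustness constants `ρ_m(ρ₀, ε) = ρ₀ - ε δ_m`. -/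
def rob (ρ₀ ε : ℝ) (m : ℕ) : ℝ := ρ₀ - ε * robDelta ρ₀ ε m

/-- `ρ̂_k`. -/
def rhoHat (n k : ℕ) : ℝ := (18 - 2 * k / (3 * n)) * eps2 n

/-- `ρ̂'_k`. -/
def rhoHat' (n k : ℕ) : ℝ := (18 - (2 * k + 1) / (3 * n)) * eps2 n

/-- `ε₄` is small enough that the robustness constants interlace. -/
structure AdmissibleEps4 (n : ℕ) (ε₄ : ℝ) : Prop where
  pos : 0 < ε₄
  rob_pos : ∀ k, 1 ≤ k → k ≤ n + 1 → ∀ m ≤ n,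
    0 < rob (rhoHat n k) (10 * ε₄) m ∧ 0 < rob (rhoHat' n k) (10 * ε₄) m
  first : ∀ k, 1 ≤ k → k ≤ n + 1 →
    rob (rhoHat n k) (10 * ε₄) n < rhoHat n k ∧ rhoHat' n k < rob (rhoHat n k) (10 * ε₄) n
  second : ∀ k, 1 ≤ k → k ≤ n + 1 →
    rob (rhoHat' n k) (10 * ε₄) n < rhoHat' n k ∧
      rhoHat n (k + 1) < rob (rhoHat' n k) (10 * ε₄) n

/-- `δ` is good for `ε` in dimension `n`: every basis which is orthonormal up to `δ` is
`ε`-close to an orthonormal basis. -/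
def GramSchmidt (n : ℕ) (ε δ : ℝ) : Prop :=
  ∀ f' : Fin n → E n, LinearIndependent ℝ f' →
    (∀ j, 1 - δ < ‖f' j‖ ∧ ‖f' j‖ < 1 + δ) →
    (∀ i j, i ≠ j → |inner ℝ (f' i) (f' j)| < δ) →
    ∃ f : Fin n → E n, Orthonormal ℝ f ∧ ∀ j, ‖f j - f' j‖ ≤ ε

/-- The restrictions on the basic error `ε₀`. -/
structure AdmissibleEps0 (n : ℕ) (ε₄ ε₀ : ℝ) : Prop where
  pos : 0 < ε₀
  c1 : ε₀ < 1 / 2000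
  c2 : ε₀ ≤ 50 * n * (2 / 5) ^ n * eps1 n
  c3 : ε₀ < eps2 n / 2000
  c4 : ε₀ < eps3 n / 4
  c5 : ε₀ < eps1 n / 2 ∧ eps1 n / 2 < eps1 n - 2 * eps3 n
  c6 : ε₀ < eps3 n /
    (2 * (1 + 35 * (n : ℝ) ^ (3 / 2 : ℝ) * (4 / (15 * eps2 n)) ^ (n - 1)))
  c7 : ε₀ < ε₄ / 20
  c8 : ∃ δ > 0, GramSchmidt n ε₄ δ ∧ ε₀ < δ / 100

/-! ### Transverse distortion and the choice of scales -/

section Scales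

variable {n : ℕ} {M X ι : Type*} [MetricSpace M] [MetricSpace X]

/-- `var(i,r)`: the variation of the leafwise metric between plaques of the chart `i` at
transverse distance at most `r`. -/
def metricVar (A : FoliatedAtlas n M X ι) (i : ι) (r : ℝ) : ℝ≥0∞ :=
  ⨆ (w ∈ A.T i) (w' ∈ A.T i) (_ : dist w w' ≤ r) (a ∈ closedCube n) (b ∈ closedCube n),
    max (A.leafDist (A.pt i a w) (A.pt i b w) - A.leafDist (A.pt i a w') (A.pt i b w'))
      (A.leafDist (A.pt i a w') (A.pt i b w') - A.leafDist (A.pt i a w) (A.pt i b w))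

/-- `div(z,r)`: the largest leafwise distance between points, on meeting plaques, of the
standard sections of radius `r` through `z` in two charts. -/
def metricDiv (A : FoliatedAtlas n M X ι) (z : M) (r : ℝ) : ℝ≥0∞ :=
  ⨆ (i : ι) (j : ι) (_ : z ∈ A.Ubar i) (_ : z ∈ A.Ubar j)
    (w ∈ A.T i) (w' ∈ A.T j) (_ : dist w (A.pr i z) ≤ r) (_ : dist w' (A.pr j z) ≤ r)
    (_ : (A.plaque i w ∩ A.plaque j w').Nonempty),
    A.leafDist (A.pt i (A.lam i z) w) (A.pt j (A.lam j z) w')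

/-- All the scales: convexity radius `lamF`, plaque size `delta`, Lebesgue number `epsU`,
leafwise Lebesgue number `epsFU`, error constants `eps0`, `eps4`, the radius `lamEps` below which
leafwise disks are `eps0`-approximately Euclidean, and the transverse scale `rStar`. -/
structure Scales (A : FoliatedAtlas n M X ι) where
  lamF : ℝ
  delta : ℝ
  lamEps : ℝ
  epsU : ℝ
  epsFU : ℝ
  eps0 : ℝ
  eps4 : ℝ
  rStar : ℝ
  lamF_pos : 0 < lamF
  disk_convex : ∀ x : M, ∀ s : ℝ, 0 < s → s ≤ lamF → A.StronglyConvex (A.closedDisk x s)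
  plaque_convex : ∀ i, ∀ w ∈ A.T i, A.StronglyConvex (A.plaque i w)
  plaque_diam : ∀ i, ∀ w ∈ A.T i, ∀ x ∈ A.plaque i w, ∀ y ∈ A.plaque i w,
    A.leafDist x y < ENNReal.ofReal (lamF / 2)
  delta_pos : 0 < delta
  delta_lt : delta < lamF / 4
  plaque_size : ∀ i, ∀ w ∈ A.T i,
    A.closedDisk (A.pt i 0 w) (delta / 2) ⊆ A.plaque i w ∧
      A.plaque i w ⊆ A.closedDisk (A.pt i 0 w) delta
  /-- an open plaque of one chart meets at most one open plaque of another chart -/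
  hol_unique : ∀ i j w w₁ w₂, A.Hol i j w w₁ → A.Hol i j w w₂ → w₁ = w₂
  epsU_pos : 0 < epsU
  lebesgue : ∀ z : M, ∃ i, Metric.ball z epsU ⊆ A.U i
  epsFU_pos : 0 < epsFU
  leaf_lebesgue : ∀ y : M, A.closedDisk y epsFU ⊆ Metric.closedBall y (epsU / 4)
  eps4_adm : AdmissibleEps4 n eps4
  eps0_adm : AdmissibleEps0 n eps4 eps0
  lamEps_pos : 0 < lamEps
  approx : ∀ s : ℝ, 0 < s → s ≤ lamEps → s ≤ lamF / 2 → ∀ (x : M) (i : ι),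
    A.closedDisk x s ⊆ A.U i → ∀ u, A.IsFrame i x u → A.IsApproxEuclid i x u s eps0
  /-- the basic scale `r_F = min(delta, lamF/5, lamEps, 1)` is at most `epsFU` -/
  rF_le : min (min delta (lamF / 5)) (min lamEps 1) ≤ epsFU
  rStar_pos : 0 < rStar
  div_le : ∀ z : M, metricDiv A z rStar
    ≤ ENNReal.ofReal (eps0 * min (min delta (lamF / 5)) (min lamEps 1))
  var_le : ∀ i, metricVar A i rStar
    ≤ ENNReal.ofReal (eps0 * min (min delta (lamF / 5)) (min lamEps 1))

/-- The basic leafwise scale `r_F`. -/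
def Scales.rF {A : FoliatedAtlas n M X ι} (S : Scales A) : ℝ :=
  min (min S.delta (S.lamF / 5)) (min S.lamEps 1)

/-! ### Reeb neighborhoods and nice transversals -/

/-- A Reeb neighborhood in `M` of a compact connected union `K₀` of plaques of the leaf of `z0`:
a Delaunay net `Net` of the leaf, for each net point `z` a chart `idx z`, the finite set `core` of
net points whose plaques make up `K₀`, a finite set `near ⊇ core` of net points, a clopen
transversal `V0` at `z0`, and for each `z ∈ near` the holonomy map `h z` on `V0` along a nice path
from `z0` to `z`. -/
structure ReebNbhd (A : FoliatedAtlas n M X ι) (S : Scales A) where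
  z0 : M
  Net : Set M
  net_sub : Net ⊆ A.leaf z0
  z0_mem : z0 ∈ Net
  net_sep : ∃ e₁ : ℝ, 0 < e₁ ∧ e₁ < S.epsFU / 4 ∧
    ∀ y ∈ Net, ∀ z ∈ Net, y ≠ z → ENNReal.ofReal e₁ ≤ A.leafDist y z
  net_dense : ∀ x ∈ A.leaf z0, ∃ z ∈ Net, A.leafDist x z ≤ ENNReal.ofReal (S.epsFU / 4)
  idx : M → ι
  idx_ball : ∀ z ∈ Net, Metric.ball z S.epsU ⊆ A.U (idx z)
  core : Finset M
  near : Finset M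
  core_sub : core ⊆ near
  near_sub : ∀ z ∈ near, z ∈ Net
  z0_core : z0 ∈ core
  connected : IsConnected (⋃ z ∈ core, A.plaque (idx z) (A.pr (idx z) z))
  V0 : Set X
  V0_clopen : IsClopen V0
  V0_sub : V0 ⊆ A.T (idx z0)
  w0_mem : A.pr (idx z0) z0 ∈ V0
  h : M → X → X
  h_base : ∀ v ∈ V0, h z0 v = v
  /-- `h z` is the holonomy along a chain of net points with consecutive distances `< epsFU` -/
  h_chain : ∀ z ∈ near, ∃ (m : ℕ) (c : ℕ → M) (H : ℕ → X → X),
    c 0 = z0 ∧ c m = z ∧ (∀ k ≤ m, c k ∈ Net) ∧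
    (∀ k < m, A.leafDist (c k) (c (k + 1)) < ENNReal.ofReal S.epsFU) ∧
    (∀ v ∈ V0, H 0 v = v) ∧
    (∀ k < m, ∀ v ∈ V0, A.Hol (idx (c k)) (idx (c (k + 1))) (H k v) (H (k + 1) v)) ∧
    ∀ v ∈ V0, H m v = h z v
  h_small : ∀ z ∈ near, ∀ v ∈ V0, dist (h z v) (A.pr (idx z) z) ≤ S.rStar / 2
  /-- the holonomy of closed paths is trivial on `V0` -/
  coherent : ∀ z ∈ near, ∀ z' ∈ near,
    A.Hol (idx z) (idx z') (A.pr (idx z) z) (A.pr (idx z') z') →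
    ∀ v ∈ V0, A.Hol (idx z) (idx z') (h z v) (h z' v)
  /-- the map from the neighborhood in the foliated microbundle to `M` is injective -/
  embedded : ∀ z ∈ near, ∀ z' ∈ near, ∀ v ∈ V0, ∀ v' ∈ V0,
    (A.plaque (idx z) (h z v) ∩ A.plaque (idx z') (h z' v')).Nonempty →
    v = v' ∧
      (A.plaque (idx z) (A.pr (idx z) z) ∩ A.plaque (idx z') (A.pr (idx z') z')).Nonempty

/-- The compact set `K₀`. -/
def ReebNbhd.K0 {A : FoliatedAtlas n M X ι} {S : Scales A} (R : ReebNbhd A S) : Set M :=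
  ⋃ z ∈ R.core, A.plaque (R.idx z) (A.pr (R.idx z) z)

/-- The standard section through `x` in the chart of the net point `z`, over `h_z(V0)`. -/
def ReebNbhd.section' {A : FoliatedAtlas n M X ι} {S : Scales A} (R : ReebNbhd A S)
    (z x : M) : Set M :=
  (fun v => A.pt (R.idx z) (A.lam (R.idx z) x) (R.h z v)) '' R.V0

/-- The vertices `y` span a Delaunay `n`-simplex of the set `Y`, of radius at most `rmax`, with
circumscribed leafwise sphere of center `ω` and radius `r`. -/
structure IsDelaunaySimplex (A : FoliatedAtlas n M X ι) (Y : Set M) (rmax : ℝ)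
    (y : Fin (n + 1) → M) (ω : M) (r : ℝ) : Prop where
  inj : Function.Injective y
  mem : ∀ k, y k ∈ Y
  pos : 0 < r
  le : r ≤ rmax
  center : ω ∈ A.leaf (y 0)
  sphere : ∀ k, A.leafDist ω (y k) = ENNReal.ofReal r
  empty : ∀ x ∈ Y, ¬ A.leafDist ω x < ENNReal.ofReal r

/-- A nice transversal: the result of the inductive construction, in which sections through
points `ξ j` are added one by one.  The point `ξ j` is chosen at leafwise distance less than
`r_F/200` from a point `ξ' j` whose neighborhood is separated from, but not too far from, the
sections chosen before, and outside of all annuli and slabs defined by these sections.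
Here `r_F = S.rF`, `d₁'' = 0.12 r_F`, `d₂'' = 0.18 r_F`, `d₂ = 0.2 r_F`. -/
structure NiceTransversal (A : FoliatedAtlas n M X ι) (S : Scales A) (R : ReebNbhd A S) where
  p : ℕ
  p_pos : 0 < p
  ξ : Fin p → M
  z : Fin p → M
  ξ' : Fin p → M
  ξ_zero : ξ ⟨0, p_pos⟩ = R.z0
  z_zero : z ⟨0, p_pos⟩ = R.z0
  z_mem : ∀ j, z j ∈ R.near
  ξ_mem : ∀ j, ξ j ∈ R.K0
  ξ_near : ∀ j, A.leafDist (ξ j) (z j) < ENNReal.ofReal (S.epsFU / 2)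
  ξ'_near : ∀ j, j ≠ ⟨0, p_pos⟩ → A.leafDist (ξ' j) (ξ j) < ENNReal.ofReal (S.rF / 200)
  /-- position of `ξ' j` relative to the preceding sections -/
  position : ∀ j, j ≠ ⟨0, p_pos⟩ → ∀ q, A.leafDist (ξ' j) q < ENNReal.ofReal (S.rF / 200) →
    q ∈ R.K0 ∧
    (∀ l < j, ∀ x ∈ R.section' (z l) (ξ l), ENNReal.ofReal (0.12 * S.rF) < A.leafDist x q) ∧
    ∃ l < j, ∃ x ∈ R.section' (z l) (ξ l), A.leafDist x q ≤ ENNReal.ofReal (0.18 * S.rF)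
  /-- `ξ j` avoids the `2ε₁ r_F`-thickenings of the circumscribed spheres of all nearby
  `n`-simplices of the preceding sections -/
  annuli : ∀ j, j ≠ ⟨0, p_pos⟩ → ∀ (y : Fin (n + 1) → M) (ω : M) (r : ℝ),
    IsDelaunaySimplex A (⋃ l ∈ Iio j, R.section' (z l) (ξ l)) (0.2 * S.rF) y ω r →
    (∀ k, A.leafDist (ξ' j) (y k) ≤ ENNReal.ofReal (4 * (0.2 * S.rF))) →
    ∀ s, A.leafDist ω s = ENNReal.ofReal r →
      ENNReal.ofReal (2 * eps1 n * S.rF) < A.leafDist (ξ j) s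
  /-- `ξ j` avoids the `2ε₂ r_F`-thickenings of the geodesic images of all the linear subspaces
  spanned, in geodesic coordinates at the last of them, by nearby points of the preceding
  sections -/
  slabs : ∀ j, j ≠ ⟨0, p_pos⟩ → ∀ k : ℕ, 1 ≤ k → k < n →
    ∀ (l : Fin (k + 1) → Fin p) (y : Fin (k + 1) → M),
    StrictMono l → (∀ m, l m < j) → Function.Injective y →
    (∀ m, y m ∈ R.section' (z (l m)) (ξ (l m))) →
    (∀ m, A.leafDist (ξ' j) (y m) ≤ ENNReal.ofReal (4 * (0.2 * S.rF))) →
    ∀ (i : ι) (u : E n →ₗ[ℝ] E n) (a : Fin (k + 1) → E n),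
    A.IsFrame i (y (Fin.last k)) u →
    (∀ m, A.IsExp i (y (Fin.last k)) (u (a m)) (y m) ∧
      ENNReal.ofReal ‖a m‖ = A.leafDist (y (Fin.last k)) (y m)) →
    ∀ b ∈ Submodule.span ℝ (Set.range a), ‖b‖ ≤ 2 * (0.2 * S.rF) →
    ∀ q, A.IsExp i (y (Fin.last k)) (u b) q →
      ENNReal.ofReal (2 * eps2 n * S.rF) < A.leafDist (ξ j) q
  /-- the construction is complete: the sections are `d₂''`-dense in `K₀` -/
  complete : ∀ q ∈ R.K0, ∃ j, ∃ x ∈ R.section' (z j) (ξ j),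
    A.leafDist x q ≤ ENNReal.ofReal (0.18 * S.rF)

namespace NiceTransversal

variable {A : FoliatedAtlas n M X ι} {S : Scales A} {R : ReebNbhd A S}

/-- The index `θ_j` of the chart used for the `j`-th section. -/
def θ (N : NiceTransversal A S R) (j : Fin N.p) : ι := R.idx (N.z j)

/-- The `j`-th section `𝒳_j`. -/
def piece (N : NiceTransversal A S R) (j : Fin N.p) : Set M := R.section' (N.z j) (N.ξ j)

/-- The transversal `𝒳`, the union of its sections. -/
def carrier (N : NiceTransversal A S R) : Set M := ⋃ j, N.piece j

/-- The plaque through `q` of the chart used for the `j`-th section. -/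
def plaqueAt (N : NiceTransversal A S R) (j : Fin N.p) (q : M) : Set M :=
  A.plaque (N.θ j) (A.pr (N.θ j) q)

end NiceTransversal

end Scales

end Matchbox

end

noncomputable section

namespace Matchbox

open Set Filter Topology MeasureTheory
open scoped ENNReal

/-! ### Brouwer's fixed point theorem -/

section Brouwer

open Polynomial

/-! On the scale `r_F` the sections of the transversal are almost parallel. Moving a point of a
chart and a point of a neighbouring section from one label to another changes their leafwise
distance by at most `2 ε₀ r_F` (`Adj.leafDist_le`). The translate of the center is therefore almost
equidistant from the translated vertices, and it has to be corrected to an exactly equidistant point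
by a move of at most `ε₃ r_F / 2`.

For Euclidean vertices `e m`, a point `a` is equidistant when `⟨a, e m - e 0⟩ = (‖e m‖² - ‖e 0‖²) /
2`. This linear system has a small solution if the right side is small and the simplex is well
conditioned. The leafwise distances are only uniformly close to the Euclidean ones, without control
of derivatives, so the perturbed system is treated as a fixed point problem and solved by Brouwer's
theorem (`exists_equidistant`). Brouwer's theorem is itself proved below, from a volume identity
that is polynomial in the deformation parameter.

The conditioning comes from the slab condition in the choice of the `ξ j`. In approximately
Euclidean coordinates it gives each vertex height at least `1.95 ε₂ r_F` over the affine span of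
slightly displaced earlier vertices (`exists_perturbation_height`). Induction over the vertices
turns heights into the bound `∑ |t m| ≤ (20 g ^ (n - 1) / r_F) ‖∑ t m • e m‖` for `∑ t m = 0`, where
`g = growth n` (`sum_abs_le_of_heights`, `sum_abs_le`). The slab condition speaks of the points `ξ
j` only. Hence the simplex is first moved to the base leaf, and coordinates there parametrize
candidates for the center in the target plaque (`exists_center`).

Since distances are infima over piecewise `C¹` paths, three facts link them with coordinates: short
paths cannot leave a coordinate ball (`exists_of_leafPath_lt`), shortest geodesics have initial
velocity of the expected norm (`exists_isExp_of_isMinGeodesic`), and slow geodesics exist for unit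
time (`IsCoordBall.exists_isExp`). The embedding of the Reeb neighborhood puts all vertices over one
label. -/

lemma exists_interpolation_at_one (D : ℕ) {ε : ℝ} (hε : 0 < ε) :
    ∃ t w : ℕ → ℝ, (∀ i ∈ Finset.range (D + 1), 0 ≤ t i ∧ t i ≤ ε) ∧
      ∀ p : ℝ[X], p.natDegree ≤ D →
        p.eval 1 = ∑ i ∈ Finset.range (D + 1), w i * p.eval (t i) := by
  -- Any `D + 1` distinct nodes in `[0, ε]` determine a polynomial of degree at most `D`, even at
  -- the distant point `1`.
  let t : ℕ → ℝ := fun i => ε * i / (D + 1)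
  have hinj : Set.InjOn t (Finset.range (D + 1)) := by
    intro a _ b _ h
    have hD : (0 : ℝ) < D + 1 := by positivity
    have h' : ε * a / (D + 1) = ε * b / (D + 1) := h
    rw [div_left_inj' hD.ne'] at h'
    exact_mod_cast mul_left_cancel₀ hε.ne' h'
  refine ⟨t, fun i => (Lagrange.basis (Finset.range (D + 1)) t i).eval 1, ?_, ?_⟩
  · intro i hi
    have hi' : (i : ℝ) ≤ D + 1 := by
      have := Finset.mem_range.mp hi
      exact_mod_cast this.le
    refine ⟨by positivity, ?_⟩
    rw [div_le_iff₀ (by positivity)]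
    exact mul_le_mul_of_nonneg_left hi' hε.le
  · intro p hp
    have hdeg : p.degree < (Finset.range (D + 1)).card := by
      rw [Finset.card_range]
      exact lt_of_le_of_lt (degree_le_of_natDegree_le hp) (by exact_mod_cast Nat.lt_succ_self D)
    have h := Lagrange.eq_interpolate hinj hdeg
    conv_lhs => rw [h]
    rw [Lagrange.interpolate_apply, eval_finsetSum]
    refine Finset.sum_congr rfl fun i _ => ?_
    rw [eval_mul, eval_C, mul_comm]

variable {E : Type*} [NormedAddCommGroup E] [InnerProductSpace ℝ E] [FiniteDimensional ℝ E]

/-- This is the integrand in the change of variables for `x ↦ x + t g(x)` with weight `P(‖·‖²)`. The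
squared norm is quadratic in `t` and the determinant has degree at most the dimension, so the degree
is bounded independently of the point. Values at `t = 1` can then be read off from small `t`. -/
lemma exists_polynomial_normSq_mul_det (P : ℝ[X]) (x g : E) (A : E →L[ℝ] E) :
    ∃ p : ℝ[X], p.natDegree ≤ 2 * P.natDegree + Module.finrank ℝ E ∧
      ∀ t : ℝ, p.eval t
        = P.eval (‖x + t • g‖ ^ 2) * (ContinuousLinearMap.id ℝ E + t • A).det := by
  let b := Module.finBasis ℝ E
  let m := LinearMap.toMatrix b b (A : E →ₗ[ℝ] E)
  let q : ℝ[X] := C (‖x‖ ^ 2) + C (2 * inner ℝ x g) * X + C (‖g‖ ^ 2) * X ^ 2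
  let d : ℝ[X] := ((X : ℝ[X]) • m.map C + (1 : Matrix _ _ ℝ).map C).det
  refine ⟨P.comp q * d, ?_, fun t => ?_⟩
  · refine natDegree_mul_le.trans (add_le_add ?_ ?_)
    · refine natDegree_comp_le.trans ?_
      rw [mul_comm]
      refine Nat.mul_le_mul_right _ ?_
      simp only [q]
      compute_degree
    · exact (natDegree_det_X_add_C_le m 1).trans (by simp)
  · rw [eval_mul, eval_comp]
    congr 1
    · congr 1
      simp only [q, eval_add, eval_mul, eval_C, eval_X, eval_pow]
      rw [norm_add_sq_real, inner_smul_right, norm_smul, mul_pow, Real.norm_eq_abs, sq_abs]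
      ring
    · rw [ContinuousLinearMap.det, ← LinearMap.det_toMatrix b]
      have h1 : eval t d = ((evalRingHom t).mapMatrix
          ((X : ℝ[X]) • m.map C + (1 : Matrix _ _ ℝ).map C)).det := by
        rw [← RingHom.map_det]; rfl
      rw [h1]
      congr 1
      have h2 : ((ContinuousLinearMap.id ℝ E + t • A : E →L[ℝ] E) : E →ₗ[ℝ] E)
          = LinearMap.id + t • (A : E →ₗ[ℝ] E) := rfl
      have h3 : LinearMap.toMatrix b b (LinearMap.id + t • (A : E →ₗ[ℝ] E)) = 1 + t • m := by
        rw [map_add, map_smul, LinearMap.toMatrix_id]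
      rw [h2, h3]
      ext i j
      by_cases hij : i = j <;> simp [hij, m] <;> ring

variable [MeasurableSpace E] [BorelSpace E]

/-- A `C¹` perturbation of the identity with compact support has a zero. -/
theorem exists_add_eq_zero_of_contDiff (g : E → E) (hg : ContDiff ℝ 1 g)
    (hsupp : HasCompactSupport g) : ∃ x, x + g x = 0 := by
  by_contra! hne
  obtain ⟨C, hC⟩ := hg.lipschitzWith_of_hasCompactSupport hsupp one_ne_zero
  obtain ⟨R₀, hR₀⟩ := hsupp.isCompact.isBounded.subset_closedBall (0 : E)
  -- A radius of at least `1` ensures that `B` contains a neighbourhood of the origin, where the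
  -- weight `ψ` below is positive.
  set R : ℝ := max R₀ 1 with hRdef
  have hR1 : 1 ≤ R := le_max_right _ _
  set B : Set E := Metric.closedBall 0 R
  have hgB : ∀ x, x ∉ B → g x = 0 := by
    intro x hx
    by_contra h
    exact hx (Metric.closedBall_subset_closedBall (le_max_left _ _)
      (hR₀ (subset_tsupport _ h)))
  have hBc : IsCompact B := isCompact_closedBall 0 R
  have hdiff : Differentiable ℝ g := hg.differentiable one_ne_zero
  have hcd : Continuous (fderiv ℝ g) := hg.continuous_fderiv one_ne_zero
  have hcg : Continuous g := hg.continuous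
  -- the perturbed maps
  let F : ℝ → E → E := fun t x => x + t • g x
  let F' : ℝ → E → E →L[ℝ] E := fun t x => ContinuousLinearMap.id ℝ E + t • fderiv ℝ g x
  have hF' : ∀ t x, HasFDerivAt (F t) (F' t x) x := fun t x =>
    (hasFDerivAt_id x).add ((hdiff x).hasFDerivAt.const_smul t)
  have hdetc : ∀ t, Continuous fun x => (F' t x).det := fun t =>
    ContinuousLinearMap.continuous_det.comp (continuous_const.add (hcd.const_smul t))
  have hFc : ∀ t, Continuous (F t) := fun t => continuous_id.add (hcg.const_smul t)
  -- small perturbations are bijective and orientation preserving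
  obtain ⟨K, hK⟩ : ∃ K : ℝ, ∀ x, ‖fderiv ℝ g x‖ ≤ K :=
    (hsupp.fderiv ℝ).exists_bound_of_continuous hcd
  have hdet1 : ∀ᶠ A in 𝓝 (ContinuousLinearMap.id ℝ E), 0 < A.det := by
    refine ContinuousLinearMap.continuous_det.continuousAt.eventually_const_lt ?_
    simp [ContinuousLinearMap.det]
  obtain ⟨η, hη, hdet⟩ := Metric.eventually_nhds_iff.mp hdet1
  -- `ε * K < η` keeps the Jacobian determinant positive, and `ε * C < 1` makes `t • g` a
  -- contraction for `t ≤ ε`.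
  obtain ⟨ε, hε, hε1, hε2⟩ : ∃ ε : ℝ, 0 < ε ∧ ε * K < η ∧ ε * C < 1 := by
    refine ⟨min (η / (2 * (|K| + 1))) (1 / (2 * (C + 1))), by positivity, ?_, ?_⟩
    · calc min (η / (2 * (|K| + 1))) (1 / (2 * (C + 1))) * K
          ≤ min (η / (2 * (|K| + 1))) (1 / (2 * (C + 1))) * |K| := by
            gcongr; exact le_abs_self K
        _ ≤ η / (2 * (|K| + 1)) * |K| := by gcongr; exact min_le_left _ _
        _ < η := by
            rw [div_mul_eq_mul_div, div_lt_iff₀ (by positivity)]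
            nlinarith [abs_nonneg K]
    · calc min (η / (2 * (|K| + 1))) (1 / (2 * ((C : ℝ) + 1))) * C
          ≤ 1 / (2 * ((C : ℝ) + 1)) * C := by gcongr; exact min_le_right _ _
        _ < 1 := by
            rw [div_mul_eq_mul_div, div_lt_iff₀ (by positivity)]
            nlinarith [C.coe_nonneg]
  have hdetpos : ∀ t, 0 ≤ t → t ≤ ε → ∀ x, 0 < (F' t x).det := by
    intro t ht0 ht x
    apply hdet
    rw [dist_eq_norm, show F' t x - ContinuousLinearMap.id ℝ E = t • fderiv ℝ g x by
      simp [F'], norm_smul, Real.norm_of_nonneg ht0]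
    have := hK x
    have hn := norm_nonneg (fderiv ℝ g x)
    nlinarith
  have hinj : ∀ t, 0 ≤ t → t ≤ ε → Function.Injective (F t) := by
    intro t ht0 ht x y hxy
    by_contra hne'
    have h1 : x - y = t • (g y - g x) := by
      have : x + t • g x = y + t • g y := hxy
      rw [smul_sub, sub_eq_sub_iff_add_eq_add, this, add_comm]
    have h2 : ‖x - y‖ ≤ t * (C * ‖x - y‖) := by
      calc ‖x - y‖ = t * ‖g y - g x‖ := by
            conv_lhs => rw [h1]
            rw [norm_smul, Real.norm_of_nonneg ht0]
        _ ≤ t * (C * ‖x - y‖) := by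
            gcongr
            rw [norm_sub_rev x y, ← dist_eq_norm, ← dist_eq_norm]
            exact hC.dist_le_mul y x
    have h3 : 0 < ‖x - y‖ := norm_pos_iff.mpr (sub_ne_zero.mpr hne')
    have h4 : t * C ≤ ε * C := by gcongr
    nlinarith
  -- Outside `B` the map is the identity, so injectivity prevents points of `B` from leaving it.
  -- Preimages are fixed points of the contraction `x ↦ y - t • g x`.
  have himage : ∀ t, 0 ≤ t → t ≤ ε → F t '' B = B := by
    intro t ht0 ht
    have hout : ∀ x, x ∉ B → F t x = x := fun x hx => by simp [F, hgB x hx]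
    apply Subset.antisymm
    · rintro _ ⟨x, hx, rfl⟩
      by_contra h
      have := hinj t ht0 ht (hout _ h)
      exact h (by rw [this]; exact hx)
    · intro y hy
      have hlip : LipschitzWith (Real.toNNReal t * C) fun x => y - t • g x := by
        refine LipschitzWith.of_dist_le_mul fun a b => ?_
        rw [dist_eq_norm, show y - t • g a - (y - t • g b) = t • (g b - g a) by
          rw [smul_sub]; abel, norm_smul, Real.norm_of_nonneg ht0, NNReal.coe_mul,
          Real.coe_toNNReal t ht0, mul_assoc]
        gcongr
        rw [dist_comm, ← dist_eq_norm]
        exact hC.dist_le_mul b a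
      have hcontr : ContractingWith (Real.toNNReal t * C) fun x => y - t • g x := by
        refine ⟨?_, hlip⟩
        rw [← NNReal.coe_lt_coe, NNReal.coe_mul, Real.coe_toNNReal t ht0, NNReal.coe_one]
        have : t * C ≤ ε * C := by gcongr
        linarith
      have hfix := hcontr.fixedPoint_isFixedPt
      set x := ContractingWith.fixedPoint _ hcontr
      have hx : F t x = y := by
        have h1 : y - t • g x = x := hfix
        show x + t • g x = y
        exact (sub_eq_iff_eq_add.mp h1).symm
      refine ⟨x, ?_, hx⟩
      by_contra h
      rw [hout x h] at hx
      exact h (hx ▸ hy)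
  -- the volume identity, for all polynomial weights
  have hint : ∀ (P : ℝ[X]) (t : ℝ),
      IntegrableOn (fun x => P.eval (‖F t x‖ ^ 2) * (F' t x).det) B := fun P t =>
    ((P.continuous.comp ((hFc t).norm.pow 2)).mul (hdetc t)).continuousOn.integrableOn_compact hBc
  have hsmall : ∀ (P : ℝ[X]) (t : ℝ), 0 ≤ t → t ≤ ε →
      ∫ x in B, P.eval (‖F t x‖ ^ 2) * (F' t x).det = ∫ y in B, P.eval (‖y‖ ^ 2) := by
    intro P t ht0 ht
    have := integral_image_eq_integral_abs_det_fderiv_smul (volume : Measure E)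
      (f := F t) (f' := F' t) hBc.isClosed.measurableSet
      (fun x _ => (hF' t x).hasFDerivWithinAt) (hinj t ht0 ht).injOn (fun y => P.eval (‖y‖ ^ 2))
    rw [himage t ht0 ht] at this
    rw [this]
    congr with x
    rw [abs_of_pos (hdetpos t ht0 ht x), smul_eq_mul, mul_comm]
  -- The left side is a polynomial in `t`, constant on `[0, ε]`. Interpolation at nodes in this
  -- interval extends the identity to `t = 1`, where the map need not be injective.
  have hone : ∀ P : ℝ[X],
      ∫ x in B, P.eval (‖F 1 x‖ ^ 2) * (F' 1 x).det = ∫ y in B, P.eval (‖y‖ ^ 2) := by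
    intro P
    obtain ⟨t, w, ht, hw⟩ :=
      exists_interpolation_at_one (2 * P.natDegree + Module.finrank ℝ E) hε
    have hw1 : ∑ i ∈ Finset.range (2 * P.natDegree + Module.finrank ℝ E + 1), w i = 1 := by
      simpa using (hw 1 (by simp)).symm
    have hpt : ∀ x, P.eval (‖F 1 x‖ ^ 2) * (F' 1 x).det
        = ∑ i ∈ Finset.range (2 * P.natDegree + Module.finrank ℝ E + 1),
          w i * (P.eval (‖F (t i) x‖ ^ 2) * (F' (t i) x).det) := by
      intro x
      obtain ⟨p, hp, hpe⟩ := exists_polynomial_normSq_mul_det P x (g x) (fderiv ℝ g x)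
      have h := hw p hp
      simp only [hpe] at h
      exact h
    simp only [hpt]
    rw [integral_finsetSum _ fun i _ => (hint P (t i)).const_mul (w i)]
    calc ∑ i ∈ Finset.range (2 * P.natDegree + Module.finrank ℝ E + 1),
          ∫ x in B, w i * (P.eval (‖F (t i) x‖ ^ 2) * (F' (t i) x).det)
        = ∑ i ∈ Finset.range (2 * P.natDegree + Module.finrank ℝ E + 1),
          w i * ∫ y in B, P.eval (‖y‖ ^ 2) := by
          refine Finset.sum_congr rfl fun i hi => ?_
          rw [integral_const_mul, hsmall P (t i) (ht i hi).1 (ht i hi).2]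
      _ = _ := by rw [← Finset.sum_mul, hw1, one_mul]
  -- a weight concentrated near the origin
  obtain ⟨δ, hδ, hδF⟩ : ∃ δ : ℝ, 0 < δ ∧ ∀ x ∈ B, δ ≤ ‖F 1 x‖ ^ 2 := by
    obtain ⟨x₀, hx₀, hmin⟩ := hBc.exists_isMinOn ⟨0, by simp [B]; linarith⟩
      ((hFc 1).norm.pow 2).continuousOn
    refine ⟨‖F 1 x₀‖ ^ 2, ?_, fun x hx => hmin hx⟩
    have : F 1 x₀ ≠ 0 := by simpa [F] using hne x₀
    positivity
  obtain ⟨M, hM⟩ : ∃ M : ℝ, ∀ x ∈ B, ‖F 1 x‖ ^ 2 ≤ M ∧ ‖x‖ ^ 2 ≤ M := by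
    obtain ⟨M₁, h₁⟩ := hBc.bddAbove_image ((hFc 1).norm.pow 2).continuousOn
    refine ⟨max M₁ (R ^ 2), fun x hx => ⟨le_max_of_le_left (h₁ ⟨x, hx, rfl⟩),
      le_max_of_le_right ?_⟩⟩
    have : ‖x‖ ≤ R := by simpa [B] using hx
    gcongr
  -- If the map at time `1` omits the origin, this weight vanishes along it, while its integral over
  -- `B` is positive. That contradicts the volume identity once `ψ` is replaced by a polynomial.
  let ψ : ℝ → ℝ := fun s => max 0 (δ - s)
  have hψc : Continuous ψ := continuous_const.max (continuous_const.sub continuous_id)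
  have hψi : IntegrableOn (fun y : E => ψ (‖y‖ ^ 2)) B :=
    (hψc.comp (continuous_norm.pow 2)).continuousOn.integrableOn_compact hBc
  have hpos : 0 < ∫ y in B, ψ (‖y‖ ^ 2) := by
    have hnn : 0 ≤ᵐ[volume.restrict B] fun y : E => ψ (‖y‖ ^ 2) :=
      Eventually.of_forall fun y => le_max_left _ _
    rw [setIntegral_pos_iff_support_of_nonneg_ae hnn hψi]
    have hopen : IsOpen {y : E | ‖y‖ ^ 2 < min δ 1} :=
      isOpen_lt (continuous_norm.pow 2) continuous_const
    refine lt_of_lt_of_le (hopen.measure_pos volume ⟨0, by simp [hδ]⟩) (measure_mono ?_)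
    intro y hy
    have hy' : ‖y‖ ^ 2 < min δ 1 := hy
    constructor
    · have : 0 < δ - ‖y‖ ^ 2 := by linarith [min_le_left δ 1]
      simp only [Function.mem_support, ψ]
      exact ne_of_gt (lt_max_of_lt_right this)
    · simp only [B, Metric.mem_closedBall, dist_zero_right]
      have : ‖y‖ ^ 2 < 1 := by linarith [min_le_right δ 1]
      nlinarith [norm_nonneg y]
  obtain ⟨V, hV⟩ : ∃ V : ℝ, V = (∫ x in B, |(F' 1 x).det|) + (volume B).toReal := ⟨_, rfl⟩
  have hV0 : 0 ≤ V := by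
    rw [hV]
    exact add_nonneg (integral_nonneg fun x => abs_nonneg _) ENNReal.toReal_nonneg
  -- The approximation error enters the two integrals with total factor `V`. The tolerance makes
  -- this contribution less than `∫ ψ`.
  obtain ⟨P, hP⟩ := exists_polynomial_near_of_continuousOn 0 M ψ hψc.continuousOn
    ((∫ y in B, ψ (‖y‖ ^ 2)) / (2 * (V + 1))) (by positivity)
  set e := (∫ y in B, ψ (‖y‖ ^ 2)) / (2 * (V + 1)) with he
  have habs : IntegrableOn (fun x => |(F' 1 x).det|) B :=
    (hdetc 1).abs.continuousOn.integrableOn_compact hBc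
  have h1 : |∫ x in B, P.eval (‖F 1 x‖ ^ 2) * (F' 1 x).det| ≤ e * ∫ x in B, |(F' 1 x).det| := by
    rw [← integral_const_mul]
    refine (abs_integral_le_integral_abs).trans
      (setIntegral_mono_on (hint P 1).abs (habs.const_mul e) hBc.isClosed.measurableSet ?_)
    intro x hx
    rw [abs_mul]
    gcongr
    have h := hP (‖F 1 x‖ ^ 2) ⟨by positivity, (hM x hx).1⟩
    have h0 : ψ (‖F 1 x‖ ^ 2) = 0 := max_eq_left (by linarith [hδF x hx])
    rw [h0, sub_zero] at h
    exact h.le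
  have h2 : (∫ y in B, ψ (‖y‖ ^ 2)) - e * (volume B).toReal ≤ ∫ y in B, P.eval (‖y‖ ^ 2) := by
    have hfin : volume B ≠ ⊤ := hBc.measure_lt_top.ne
    have hc : ∫ _ in B, e = e * (volume B).toReal := by
      rw [setIntegral_const, smul_eq_mul, mul_comm]; rfl
    rw [← hc, ← integral_sub hψi (integrableOn_const hfin)]
    refine setIntegral_mono_on (hψi.sub (integrableOn_const hfin))
      ((P.continuous.comp (continuous_norm.pow 2)).continuousOn.integrableOn_compact hBc)
      hBc.isClosed.measurableSet fun y hy => ?_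
    have h := hP (‖y‖ ^ 2) ⟨by positivity, (hM y hy).2⟩
    linarith [(abs_lt.mp h).1]
  rw [← hone P] at h2
  have h3 := (le_abs_self _).trans h1
  have h4 : e * V = e * (∫ x in B, |(F' 1 x).det|) + e * (volume B).toReal := by rw [hV, mul_add]
  have h5 : e * (2 * (V + 1)) = ∫ y in B, ψ (‖y‖ ^ 2) := by
    rw [he]; field_simp
  have he0 : 0 < e := by rw [he]; positivity
  nlinarith

/-- A bounded continuous self-map of a Euclidean space has a fixed point. -/
theorem exists_fixedPoint_of_bounded (q : E → E) (hq : Continuous q) (ρ : ℝ)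
    (hb : ∀ x, ‖q x‖ ≤ ρ) : ∃ x, q x = x := by
  by_contra! hne
  have hρ : 0 ≤ ρ := (norm_nonneg _).trans (hb 0)
  obtain ⟨δ, hδ, hδq⟩ : ∃ δ : ℝ, 0 < δ ∧
      ∀ x ∈ Metric.closedBall (0 : E) (ρ + 2), δ ≤ ‖x - q x‖ := by
    obtain ⟨x₀, -, hmin⟩ := (isCompact_closedBall (0 : E) (ρ + 2)).exists_isMinOn
      ⟨0, by simp; linarith⟩ (continuous_id.sub hq).norm.continuousOn
    refine ⟨‖x₀ - q x₀‖, norm_pos_iff.mpr (sub_ne_zero.mpr (hne x₀).symm), fun x hx => hmin hx⟩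
  -- The cutoff gives the compact support required above. It equals `1` on the ball of radius `ρ +
  -- 1`, where any approximate fixed point within distance `1` must lie.
  let χ : E → ℝ := fun x => max 0 (min 1 (ρ + 2 - ‖x‖))
  have hχc : Continuous χ := by fun_prop
  have hχ1 : ∀ x, ‖x‖ ≤ ρ + 1 → χ x = 1 := fun x hx => by
    simp only [χ]; rw [min_eq_left (by linarith)]; norm_num
  have hχ0 : ∀ x, ρ + 2 ≤ ‖x‖ → χ x = 0 := fun x hx =>
    max_eq_left (min_le_of_right_le (by linarith))
  have hχle : ∀ x, |χ x| ≤ 1 := fun x => by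
    rw [abs_of_nonneg (le_max_left _ _)]
    exact max_le zero_le_one (min_le_left _ _)
  have hfc : Continuous fun x => -(χ x • q x) := (hχc.smul hq).neg
  -- A zero of `x + g x` moves less than `δ` under `q`, against the choice of `δ`. The approximation
  -- does not enlarge the support.
  obtain ⟨g, hg, happ, hsupp⟩ := hfc.exists_contDiff_approx (ε := fun _ => min δ 1) 1
    continuous_const (fun _ => by positivity)
  have hcs : HasCompactSupport g := by
    refine HasCompactSupport.intro (isCompact_closedBall (0 : E) (ρ + 2)) fun x hx => ?_
    by_contra h
    have h' := hsupp h
    refine h' ?_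
    have : ρ + 2 ≤ ‖x‖ := by
      simp only [Metric.mem_closedBall, dist_zero_right, not_le] at hx; exact hx.le
    simp [hχ0 x this]
  obtain ⟨x, hx⟩ := exists_add_eq_zero_of_contDiff g (by exact_mod_cast hg) hcs
  have hd := happ x
  rw [dist_eq_norm, eq_neg_of_add_eq_zero_right hx, neg_sub_neg, norm_sub_rev] at hd
  have hχq : ‖χ x • q x‖ ≤ ρ := by
    rw [norm_smul, Real.norm_eq_abs]
    nlinarith [hχle x, hb x, norm_nonneg (q x), abs_nonneg (χ x)]
  have hxn : ‖x‖ ≤ ρ + 1 := by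
    have := norm_sub_norm_le x (χ x • q x)
    linarith [min_le_right δ 1]
  rw [hχ1 x hxn, one_smul] at hd
  have := hδq x (by simp; linarith)
  linarith [min_le_left δ 1]

/-- Brouwer's fixed point theorem for a ball. -/
theorem exists_fixedPoint_of_closedBall (q : E → E) (ρ : ℝ) (hρ : 0 ≤ ρ)
    (hq : ContinuousOn q (Metric.closedBall 0 ρ))
    (hb : ∀ x ∈ Metric.closedBall (0 : E) ρ, ‖q x‖ ≤ ρ) :
    ∃ x ∈ Metric.closedBall (0 : E) ρ, q x = x := by
  -- The radial retraction onto the ball reduces the statement to a bounded self-map of the whole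
  -- space.
  let c : E → E := fun x => (ρ / max ρ ‖x‖) • x
  rcases hρ.eq_or_lt with rfl | hρ'
  · have h0 : (0 : E) ∈ Metric.closedBall (0 : E) 0 := by simp
    exact ⟨0, h0, norm_le_zero_iff.mp (hb 0 h0)⟩
  have hc : Continuous c := by
    refine Continuous.smul (continuous_const.div (continuous_const.max continuous_norm)
      fun x => (lt_max_of_lt_left hρ').ne') continuous_id
  have hcm : ∀ x, c x ∈ Metric.closedBall (0 : E) ρ := fun x => by
    have hm : 0 < max ρ ‖x‖ := lt_max_of_lt_left hρ'
    simp only [c, Metric.mem_closedBall, dist_zero_right, norm_smul, Real.norm_eq_abs]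
    rw [abs_of_pos (div_pos hρ' hm), div_mul_eq_mul_div, div_le_iff₀ hm]
    gcongr
    exact le_max_right _ _
  obtain ⟨x, hx⟩ := exists_fixedPoint_of_bounded (fun x => q (c x))
    (hq.comp_continuous hc hcm) ρ fun x => hb _ (hcm x)
  have hxn : ‖x‖ ≤ ρ := by rw [← hx]; exact hb _ (hcm x)
  have hcx : c x = x := by
    simp only [c]; rw [max_eq_left hxn, div_self hρ'.ne', one_smul]
  exact ⟨x, by simpa using hxn, by simpa [hcx] using hx⟩

end Brouwer

/-! ### Cubes and charts -/

lemma cube_subset_closedCube (n : ℕ) : cube n ⊆ closedCube n := fun _ h k => (h k).le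

lemma closedCube_subset_bigCube (n : ℕ) : closedCube n ⊆ bigCube n := fun _ h k =>
  (h k).trans_lt one_lt_two

lemma cube_subset_bigCube (n : ℕ) : cube n ⊆ bigCube n :=
  (cube_subset_closedCube n).trans (closedCube_subset_bigCube n)

lemma continuous_coord {n : ℕ} (k : Fin n) : Continuous fun v : E n => v k := by fun_prop

lemma isOpen_cube (n : ℕ) : IsOpen (cube n) := by
  simp only [cube, ofPred_forall]
  exact isOpen_iInter_of_finite fun k => isOpen_lt (continuous_coord k).abs continuous_const

lemma isClosed_closedCube (n : ℕ) : IsClosed (closedCube n) := by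
  simp only [closedCube, ofPred_forall]
  exact isClosed_iInter fun k => isClosed_le (continuous_coord k).abs continuous_const

lemma isCompact_closedCube (n : ℕ) : IsCompact (closedCube n) := by
  refine Metric.isCompact_of_isClosed_isBounded (isClosed_closedCube n) ?_
  refine (Metric.isBounded_closedBall (x := (0 : E n)) (r := √n)).subset fun v hv => ?_
  rw [mem_closedBall_zero_iff, EuclideanSpace.norm_eq]
  refine Real.sqrt_le_sqrt ?_
  calc ∑ k, ‖v k‖ ^ 2 ≤ ∑ _k : Fin n, (1 : ℝ) := Finset.sum_le_sum fun k _ => by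
        have := hv k
        rw [Real.norm_eq_abs]
        nlinarith [abs_nonneg (v k)]
    _ = n := by simp

lemma convex_cube (n : ℕ) : Convex ℝ (cube n) := by
  intro a ha b hb s t hs ht hst k
  have h1 := abs_lt.mp (ha k)
  have h2 := abs_lt.mp (hb k)
  simp only [PiLp.add_apply, PiLp.smul_apply, smul_eq_mul]
  rw [abs_lt]
  constructor
  · rcases hs.eq_or_lt with rfl | hs'
    · have : t = 1 := by linarith
      subst this; linarith
    · nlinarith
  · rcases hs.eq_or_lt with rfl | hs'
    · have : t = 1 := by linarith
      subst this; linarith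
    · nlinarith

namespace FoliatedAtlas

section Basic

variable {n : ℕ} {M X ι : Type*} [TopologicalSpace M] [TopologicalSpace X]
  (A : FoliatedAtlas n M X ι) {i j : ι} {v : E n} {w : X} {x y z : M}

variable {A}

lemma mem_target (hv : v ∈ bigCube n) (hw : w ∈ A.T i) : (v, w) ∈ (A.chart i).target := by
  rw [A.target_eq]; exact ⟨hv, hw⟩

lemma pt_mem_source (hv : v ∈ bigCube n) (hw : w ∈ A.T i) : A.pt i v w ∈ (A.chart i).source :=
  (A.chart i).map_target (mem_target hv hw)

lemma chart_pt (hv : v ∈ bigCube n) (hw : w ∈ A.T i) : A.chart i (A.pt i v w) = (v, w) :=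
  (A.chart i).right_inv (mem_target hv hw)

lemma lam_pt (hv : v ∈ bigCube n) (hw : w ∈ A.T i) : A.lam i (A.pt i v w) = v :=
  congrArg Prod.fst (chart_pt hv hw)

lemma pr_pt (hv : v ∈ bigCube n) (hw : w ∈ A.T i) : A.pr i (A.pt i v w) = w :=
  congrArg Prod.snd (chart_pt hv hw)

lemma pt_lam_pr (hx : x ∈ (A.chart i).source) : A.pt i (A.lam i x) (A.pr i x) = x :=
  (A.chart i).left_inv hx

lemma pr_mem (hx : x ∈ (A.chart i).source) : A.pr i x ∈ A.T i := by
  have := (A.chart i).map_source hx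
  rw [A.target_eq] at this
  exact this.2

lemma pt_mem_U (hv : v ∈ cube n) (hw : w ∈ A.T i) : A.pt i v w ∈ A.U i :=
  ⟨pt_mem_source (cube_subset_bigCube n hv) hw, by
    rw [lam_pt (cube_subset_bigCube n hv) hw]; exact hv⟩

lemma lam_pt' (hv : v ∈ cube n) (hw : w ∈ A.T i) : A.lam i (A.pt i v w) = v :=
  lam_pt (cube_subset_bigCube n hv) hw

lemma pr_pt' (hv : v ∈ cube n) (hw : w ∈ A.T i) : A.pr i (A.pt i v w) = w :=
  pr_pt (cube_subset_bigCube n hv) hw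

lemma mem_cube_of_pt_mem_U (hv : v ∈ bigCube n) (hw : w ∈ A.T i) (h : A.pt i v w ∈ A.U i) :
    v ∈ cube n := by
  have := h.2
  rwa [lam_pt hv hw] at this

lemma U_subset_Ubar : A.U i ⊆ A.Ubar i := fun _ h => ⟨h.1, cube_subset_closedCube n h.2⟩

lemma isOpen_U : IsOpen (A.U i) := by
  have h : A.U i = (A.chart i).source ∩ A.chart i ⁻¹' (cube n ×ˢ univ) := by
    ext x; simp [U, lam]
  rw [h]
  exact (A.chart i).isOpen_inter_preimage ((isOpen_cube n).prod isOpen_univ)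

lemma continuousAt_lam (hx : x ∈ (A.chart i).source) : ContinuousAt (A.lam i) x :=
  ((A.chart i).continuousAt hx).fst

lemma continuousAt_pt (hv : v ∈ bigCube n) (hw : w ∈ A.T i) :
    ContinuousAt (fun v => A.pt i v w) v := by
  have h1 : ContinuousAt (A.chart i).symm (v, w) :=
    (A.chart i).continuousAt_symm (mem_target hv hw)
  exact ContinuousAt.comp (f := fun v => (v, w)) h1 (by fun_prop)

lemma isClosed_image_pt [T2Space M] {K : Set (E n)} (hK : IsCompact K) (hKc : K ⊆ bigCube n)
    (hw : w ∈ A.T i) : IsClosed ((fun v => A.pt i v w) '' K) :=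
  (hK.image_of_continuousOn fun _ hv =>
    (continuousAt_pt (hKc hv) hw).continuousWithinAt).isClosed

lemma plaque_eq_image (hw : w ∈ A.T i) :
    A.plaque i w = (fun v => A.pt i v w) '' closedCube n := by
  ext x
  constructor
  · rintro ⟨⟨hs, hl⟩, rfl⟩
    exact ⟨A.lam i x, hl, pt_lam_pr hs⟩
  · rintro ⟨v, hv, rfl⟩
    have hv' := closedCube_subset_bigCube n hv
    exact ⟨⟨pt_mem_source hv' hw, by rw [lam_pt hv' hw]; exact hv⟩, pr_pt hv' hw⟩

lemma isClosed_plaque [T2Space M] (hw : w ∈ A.T i) : IsClosed (A.plaque i w) := by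
  rw [plaque_eq_image hw]
  exact isClosed_image_pt (isCompact_closedCube n) (closedCube_subset_bigCube n) hw

lemma eventually_mem_U_pr_eq (hv : v ∈ bigCube n) (hw : w ∈ A.T i) (h : A.pt i v w ∈ A.U j) :
    ∀ᶠ v' in 𝓝 v, A.pt i v' w ∈ A.U j ∧ A.pr j (A.pt i v' w) = A.pr j (A.pt i v w) :=
  ((continuousAt_pt hv hw).eventually_mem (isOpen_U.mem_nhds h)).and
    (A.foliated i j v hv w hw h.1)

lemma continuousOn_g (hw : w ∈ A.T i) : ContinuousOn (fun v => A.g i (v, w)) (cube n) :=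
  (A.g_smooth i w hw).continuousOn

lemma g_nonneg (hv : v ∈ cube n) (hw : w ∈ A.T i) (a : E n) : 0 ≤ A.g i (v, w) a a := by
  by_cases ha : a = 0
  · simp [ha]
  · exact (A.g_pos i v hv w hw a ha).le

lemma trans_nhds (hv : v ∈ cube n) (hw : w ∈ A.T i) (h : A.pt i v w ∈ A.U j) :
    {v' | (v', w) ∈ overlap (A.chart i) (A.chart j) (A.T i)} ∈ 𝓝 v := by
  filter_upwards [(isOpen_cube n).mem_nhds hv,
    eventually_mem_U_pr_eq (cube_subset_bigCube n hv) hw h] with v' h1 h2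
  exact ⟨h1, hw, h2.1.1, h2.1.2⟩

lemma contDiffAt_trans (hv : v ∈ cube n) (hw : w ∈ A.T i) (h : A.pt i v w ∈ A.U j) :
    ContDiffAt ℝ ((⊤ : ℕ∞) : WithTop ℕ∞) (fun v => A.lam j (A.pt i v w)) v :=
  (A.trans_smooth i j w).contDiffAt (trans_nhds hv hw h)

/-- The velocity of a leafwise curve in another chart, and its length. -/
lemma hasDerivAt_lam_pt {c : ℝ → E n} {c' : E n} {t : ℝ} (hc : HasDerivAt c c' t)
    (hv : c t ∈ cube n) (hw : w ∈ A.T i) (h : A.pt i (c t) w ∈ A.U j) :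
    ∃ b, HasDerivAt (fun τ => A.lam j (A.pt i (c τ) w)) b t ∧
      A.g j (A.chart j (A.pt i (c t) w)) b b = A.g i (c t, w) c' c' := by
  have h1 : HasFDerivAt (fun v => A.lam j (A.pt i v w))
      (fderiv ℝ (trans (A.chart i) (A.chart j) w) (c t)) (c t) :=
    ((contDiffAt_trans hv hw h).differentiableAt (by simp)).hasFDerivAt
  exact ⟨_, h1.comp_hasDerivAt t hc, (A.g_compat i j (c t, w) ⟨hv, hw, h.1, h.2⟩ c' c').symm⟩

lemma continuousOn_pt_curve {c : ℝ → E n} (hw : w ∈ A.T i) (hc : ContDiff ℝ 1 c)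
    (hm : ∀ t ∈ Icc (0 : ℝ) 1, c t ∈ cube n) :
    ContinuousOn (fun t => A.pt i (c t) w) (Icc 0 1) := fun t ht =>
  (ContinuousAt.comp (f := c) (continuousAt_pt (cube_subset_bigCube n (hm t ht)) hw)
    hc.continuous.continuousAt).continuousWithinAt

/-! ### Lengths of leafwise paths -/

/-- The leafwise speed of a curve given in the plaque `w` of the chart `i`. -/
def speed (A : FoliatedAtlas n M X ι) (i : ι) (w : X) (c : ℝ → E n) (t : ℝ) : ℝ :=
  √(A.g i (c t, w) (deriv c t) (deriv c t))

lemma speed_nonneg {c : ℝ → E n} {t : ℝ} : 0 ≤ A.speed i w c t := Real.sqrt_nonneg _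

lemma continuousOn_speed {c : ℝ → E n} (hw : w ∈ A.T i) (hc : ContDiff ℝ 1 c)
    (hm : ∀ t ∈ Icc (0 : ℝ) 1, c t ∈ cube n) : ContinuousOn (A.speed i w c) (Icc 0 1) := by
  have h1 : ContinuousOn (fun t => A.g i (c t, w)) (Icc 0 1) :=
    (continuousOn_g hw).comp hc.continuous.continuousOn hm
  have h2 : ContinuousOn (deriv c) (Icc 0 1) := (hc.continuous_deriv le_rfl).continuousOn
  exact ((h1.clm_apply h2).clm_apply h2).sqrt

/-- Stopping the last piece at time `s` amounts to running it at `s` times its speed. This makes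
continuity arguments along a leafwise path possible. -/
lemma LeafPath.partial {c : ℝ → E n} {ℓ s : ℝ} (h : A.LeafPath x (A.pt i (c 0) w) ℓ)
    (hw : w ∈ A.T i) (hc : ContDiff ℝ 1 c) (hm : ∀ t ∈ Icc (0 : ℝ) 1, c t ∈ cube n)
    (hs : s ∈ Icc (0 : ℝ) 1) :
    A.LeafPath x (A.pt i (c s) w) (ℓ + ∫ t in (0 : ℝ)..s, A.speed i w c t) := by
  have hc' : ContDiff ℝ 1 fun t => c (s * t) := hc.comp (contDiff_const.mul contDiff_id)
  have hm' : ∀ t ∈ Icc (0 : ℝ) 1, c (s * t) ∈ cube n := fun t ht =>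
    hm _ ⟨mul_nonneg hs.1 ht.1, mul_le_one₀ hs.2 ht.1 ht.2⟩
  have := LeafPath.step x ℓ i w (fun t => c (s * t)) hw hc' hm' (by simpa using h)
  simp only [mul_one] at this
  convert this using 2
  have hd : ∀ t, deriv (fun t => c (s * t)) t = s • deriv c (s * t) := fun t => by
    have h1 : HasDerivAt c (deriv c (s * t)) (s * t) :=
      (hc.differentiable one_ne_zero _).hasDerivAt
    have h2 : HasDerivAt (fun t => s * t) s t := by
      simpa using (hasDerivAt_id t).const_mul s
    exact (h1.scomp t h2).deriv
  have he : ∀ t, √(A.g i (c (s * t), w) (deriv (fun t => c (s * t)) t)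
      (deriv (fun t => c (s * t)) t)) = s * A.speed i w c (s * t) := fun t => by
    rw [hd t]
    simp only [map_smul, FunLike.coe_smul, Pi.smul_apply, smul_eq_mul, speed]
    rw [← mul_assoc, Real.sqrt_mul (mul_self_nonneg s), Real.sqrt_mul_self hs.1]
  simp only [he]
  rw [intervalIntegral.integral_const_mul]
  have := intervalIntegral.smul_integral_comp_mul_left (a := 0) (b := 1) (A.speed i w c) s
  simp only [mul_zero, mul_one, smul_eq_mul] at this
  exact this.symm

lemma LeafPath.nonneg {ℓ : ℝ} (h : A.LeafPath x y ℓ) : 0 ≤ ℓ := by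
  induction h with
  | refl => exact le_rfl
  | step ℓ i w c _ _ _ _ ih =>
    exact add_nonneg ih (intervalIntegral.integral_nonneg zero_le_one
      fun t _ => Real.sqrt_nonneg _)

lemma LeafPath.append {ℓ ℓ' : ℝ} (h : A.LeafPath x y ℓ) (h' : A.LeafPath y z ℓ') :
    A.LeafPath x z (ℓ + ℓ') := by
  induction h' with
  | refl => simpa using h
  | step ℓ' i w c hw hc hm _ ih =>
    rw [← add_assoc]
    exact LeafPath.step x _ i w c hw hc hm ih

lemma LeafPath.reverse {ℓ : ℝ} (h : A.LeafPath x y ℓ) : A.LeafPath y x ℓ := by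
  induction h with
  | refl => exact LeafPath.refl _
  | step ℓ i w c hw hc hm _ ih =>
    have hc' : ContDiff ℝ 1 fun t => c (1 - t) := hc.comp (contDiff_const.sub contDiff_id)
    have hm' : ∀ t ∈ Icc (0 : ℝ) 1, c (1 - t) ∈ cube n := fun t ht =>
      hm _ ⟨by linarith [ht.2], by linarith [ht.1]⟩
    have h1 := LeafPath.step (A.pt i (c 1) w) 0 i w (fun t => c (1 - t)) hw hc' hm'
      (by simpa using LeafPath.refl _)
    have hd : ∀ t, deriv (fun t => c (1 - t)) t = -deriv c (1 - t) := fun t =>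
      deriv_comp_const_sub c 1 t
    simp only [hd, map_neg, FunLike.coe_neg, Pi.neg_apply, neg_neg, sub_self, zero_add] at h1
    rw [intervalIntegral.integral_comp_sub_left
      (fun t => √(A.g i (c t, w) (deriv c t) (deriv c t))) 1] at h1
    simp only [sub_self, sub_zero] at h1
    rw [add_comm]
    exact h1.append ih

lemma leafDist_le_of_leafPath {ℓ : ℝ} (h : A.LeafPath x y ℓ) :
    A.leafDist x y ≤ ENNReal.ofReal ℓ := iInf₂_le ℓ h

lemma exists_leafPath_of_leafDist_lt {r : ℝ≥0∞} (h : A.leafDist x y < r) :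
    ∃ ℓ, A.LeafPath x y ℓ ∧ ENNReal.ofReal ℓ < r := by
  simp only [leafDist, iInf_lt_iff] at h
  obtain ⟨ℓ, hℓ, h⟩ := h
  exact ⟨ℓ, hℓ, h⟩

@[simp] lemma leafDist_self (x : M) : A.leafDist x x = 0 := by
  have := leafDist_le_of_leafPath (LeafPath.refl (A := A) x)
  simpa using this

lemma leafDist_comm (x y : M) : A.leafDist x y = A.leafDist y x :=
  le_antisymm (le_iInf₂ fun _ h => leafDist_le_of_leafPath h.reverse)
    (le_iInf₂ fun _ h => leafDist_le_of_leafPath h.reverse)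

lemma leafDist_triangle (x y z : M) : A.leafDist x z ≤ A.leafDist x y + A.leafDist y z := by
  refine ENNReal.le_of_forall_pos_le_add fun ε hε hlt => ?_
  obtain ⟨h1, h2⟩ := ENNReal.add_lt_top.mp hlt
  have hε' : (ε / 2 : ℝ≥0∞) ≠ 0 := by simpa using hε.ne'
  obtain ⟨ℓ₁, p₁, hp₁⟩ := exists_leafPath_of_leafDist_lt (ENNReal.lt_add_right h1.ne hε')
  obtain ⟨ℓ₂, p₂, hp₂⟩ := exists_leafPath_of_leafDist_lt (ENNReal.lt_add_right h2.ne hε')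
  refine (leafDist_le_of_leafPath (p₁.append p₂)).trans ?_
  rw [ENNReal.ofReal_add p₁.nonneg p₂.nonneg]
  refine (add_le_add hp₁.le hp₂.le).trans (le_of_eq ?_)
  rw [add_add_add_comm, ENNReal.add_halves]

/-! ### Comparison with Euclidean lengths -/

lemma leafDist_segment_le {p q : E n} {K : ℝ} (hw : w ∈ A.T i) (hp : p ∈ cube n)
    (hq : q ∈ cube n)
    (hK : ∀ t ∈ Icc (0 : ℝ) 1, √(A.g i (p + t • (q - p), w) (q - p) (q - p)) ≤ K) :
    A.leafDist (A.pt i p w) (A.pt i q w) ≤ ENNReal.ofReal K := by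
  let c : ℝ → E n := fun t => p + t • (q - p)
  have hc : ContDiff ℝ 1 c := contDiff_const.add (contDiff_id.smul contDiff_const)
  have hm : ∀ t ∈ Icc (0 : ℝ) 1, c t ∈ cube n := fun t ht =>
    (convex_cube n).add_smul_sub_mem hp hq ht
  have hd : ∀ t, deriv c t = q - p := fun t => by
    have : HasDerivAt c ((1 : ℝ) • (q - p)) t := ((hasDerivAt_id t).smul_const _).const_add _
    simpa using this.deriv
  have h := LeafPath.step (A.pt i p w) 0 i w c hw hc hm
    (by simpa [c] using LeafPath.refl _)
  have hc1 : c 1 = q := by simp [c]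
  rw [hc1] at h
  refine (leafDist_le_of_leafPath h).trans (ENNReal.ofReal_le_ofReal ?_)
  rw [zero_add]
  have hcont : ContinuousOn (A.speed i w c) (Icc 0 1) := continuousOn_speed hw hc hm
  calc ∫ t in (0 : ℝ)..1, √(A.g i (c t, w) (deriv c t) (deriv c t))
      ≤ ∫ _t in (0 : ℝ)..1, K := by
        refine intervalIntegral.integral_mono_on zero_le_one ?_ intervalIntegrable_const ?_
        · exact ContinuousOn.intervalIntegrable (by rwa [uIcc_of_le zero_le_one])
        · intro t ht
          rw [hd t]
          exact hK t ht
    _ = K := by simp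

/-- The metric is bounded near `p`, so short coordinate segments have small length. -/
lemma tendsto_leafDist_pt_cube {p : E n} (hp : p ∈ cube n) (hw : w ∈ A.T i) :
    Tendsto (fun q => A.leafDist (A.pt i p w) (A.pt i q w)) (𝓝 p) (𝓝 0) := by
  obtain ⟨C, hC⟩ : ∃ C : ℝ, ∀ᶠ v in 𝓝 p, ‖A.g i (v, w)‖ ≤ C := by
    have h : ContinuousAt (fun v => A.g i (v, w)) p :=
      (continuousOn_g hw).continuousAt ((isOpen_cube n).mem_nhds hp)
    refine ⟨‖A.g i (p, w)‖ + 1, ?_⟩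
    have h' : ContinuousAt (fun v => ‖A.g i (v, w)‖) p :=
      ContinuousAt.comp (g := fun T : E n →L[ℝ] E n →L[ℝ] ℝ => ‖T‖)
        (continuous_norm (E := E n →L[ℝ] E n →L[ℝ] ℝ)).continuousAt h
    filter_upwards [h'.eventually_lt_const (lt_add_one _)] with v hv using hv.le
  obtain ⟨ρ, hρ, hball⟩ := Metric.eventually_nhds_iff.mp
    (hC.and ((isOpen_cube n).eventually_mem hp))
  have hle : ∀ᶠ q in 𝓝 p, A.leafDist (A.pt i p w) (A.pt i q w)
      ≤ ENNReal.ofReal (√|C| * ‖q - p‖) := by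
    filter_upwards [Metric.ball_mem_nhds p hρ] with q hq
    refine leafDist_segment_le hw hp (hball hq).2 fun t ht => ?_
    have hmem : dist (p + t • (q - p)) p < ρ := by
      rw [dist_eq_norm, add_sub_cancel_left, norm_smul, Real.norm_of_nonneg ht.1]
      rw [Metric.mem_ball, dist_eq_norm] at hq
      nlinarith [ht.2, norm_nonneg (q - p), ht.1]
    rw [← Real.sqrt_sq (norm_nonneg (q - p)), ← Real.sqrt_mul (abs_nonneg C)]
    refine Real.sqrt_le_sqrt ?_
    calc A.g i (p + t • (q - p), w) (q - p) (q - p)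
        ≤ ‖A.g i (p + t • (q - p), w)‖ * ‖q - p‖ * ‖q - p‖ :=
          (Real.le_norm_self _).trans (ContinuousLinearMap.le_opNorm₂ _ _ _)
      _ ≤ |C| * ‖q - p‖ ^ 2 := by
          rw [mul_assoc, ← sq]
          gcongr
          exact (hball hmem).1.trans (le_abs_self C)
  refine tendsto_of_tendsto_of_tendsto_of_le_of_le' tendsto_const_nhds ?_
    (Eventually.of_forall fun _ => bot_le) hle
  have : Tendsto (fun q : E n => √|C| * ‖q - p‖) (𝓝 p) (𝓝 0) := by
    have h : Continuous fun q : E n => √|C| * ‖q - p‖ := by fun_prop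
    simpa using h.tendsto p
  simpa using ENNReal.tendsto_ofReal this

/-- The leafwise distance is continuous in leafwise coordinates. -/
lemma tendsto_leafDist_pt {p : E n} (hp : p ∈ bigCube n) (hw : w ∈ A.T i) :
    Tendsto (fun q => A.leafDist (A.pt i p w) (A.pt i q w)) (𝓝 p) (𝓝 0) := by
  -- The metric tensor in chart `i` is controlled only over the open unit cube. Elsewhere in the big
  -- cube a chart whose open flow box contains the point has to be used.
  obtain ⟨j, hj⟩ : ∃ j, A.pt i p w ∈ A.U j := A.cover (A.pt i p w)
  have h1 := tendsto_leafDist_pt_cube (A := A) (i := j) hj.2 (pr_mem hj.1)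
  have h2 : ContinuousAt (fun q => A.lam j (A.pt i q w)) p :=
    ContinuousAt.comp (f := fun q => A.pt i q w) (continuousAt_lam hj.1) (continuousAt_pt hp hw)
  have h3 := h1.comp h2.tendsto
  refine h3.congr' ?_
  filter_upwards [eventually_mem_U_pr_eq (j := j) hp hw hj] with q hq
  simp only [Function.comp_apply, pt_lam_pr hj.1]
  congr 1
  rw [← hq.2, pt_lam_pr hq.1.1]

end Basic

/-! ### Confinement of short leafwise paths. -/

section Containment

variable {n : ℕ} {M X ι : Type*} [TopologicalSpace M] [T2Space M] [TopologicalSpace X]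
  {A : FoliatedAtlas n M X ι} {i j : ι} {w : X} {x y : M}

/-- A leafwise disk which does not reach the boundary of a plaque lies in this plaque. -/
lemma mem_U_of_leafDist_lt {r : ℝ≥0∞} (hx : x ∈ A.U i)
    (h : ∀ y ∈ A.plaque i (A.pr i x), A.leafDist x y < r → y ∈ A.U i)
    (hy : A.leafDist x y < r) : y ∈ A.U i ∧ A.pr i y = A.pr i x := by
  obtain ⟨ℓ, p, hℓ⟩ := exists_leafPath_of_leafDist_lt hy
  clear hy
  induction p with
  | refl => exact ⟨hx, rfl⟩
  | step ℓ₀ j w c hw hc hm hp ih =>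
    have hcs : ContinuousOn (A.speed j w c) (Icc 0 1) := continuousOn_speed hw hc hm
    have hmono : ∀ t ∈ Icc (0 : ℝ) 1, A.leafDist x (A.pt j (c t) w) < r := by
      intro t ht
      refine lt_of_le_of_lt ((leafDist_le_of_leafPath (hp.partial hw hc hm ht)).trans
        (ENNReal.ofReal_le_ofReal ?_)) hℓ
      gcongr
      refine intervalIntegral.integral_mono_interval le_rfl ht.1 ht.2
        (Eventually.of_forall fun _ => speed_nonneg) ?_
      exact ContinuousOn.intervalIntegrable (by rwa [uIcc_of_le zero_le_one])
    have h0 := ih (lt_of_le_of_lt (ENNReal.ofReal_le_ofReal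
      (le_add_of_nonneg_right (intervalIntegral.integral_nonneg zero_le_one
        fun t _ => Real.sqrt_nonneg _))) hℓ)
    let s : Set ℝ := {t | A.pt j (c t) w ∈ A.plaque i (A.pr i x)}
    -- The closed plaque is closed in `M`. A point of it at distance less than `r` lies in the open
    -- flow box, so the path stays in the plaque a little longer: the set of good times is closed
    -- and extends to the right.
    have hs : Icc (0 : ℝ) 1 ⊆ s := by
      refine IsClosed.Icc_subset_of_forall_mem_nhdsWithin ?_ ?_ ?_
      · rw [inter_comm]
        exact (continuousOn_pt_curve hw hc hm).preimage_isClosed_of_isClosed isClosed_Icc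
          (isClosed_plaque (pr_mem hx.1))
      · exact ⟨U_subset_Ubar h0.1, h0.2⟩
      · rintro t ⟨hts, ht⟩
        have ht' : t ∈ Icc (0 : ℝ) 1 := ⟨ht.1, ht.2.le⟩
        have hU := h _ hts (hmono t ht')
        have hev := eventually_mem_U_pr_eq (cube_subset_bigCube n (hm t ht')) hw hU
        have hev' := hc.continuous.continuousAt.eventually hev
        refine mem_nhdsWithin_of_mem_nhds ?_
        filter_upwards [hev'] with τ hτ
        exact ⟨U_subset_Ubar hτ.1, hτ.2.trans hts.2⟩
    have h1 : A.pt j (c 1) w ∈ A.plaque i (A.pr i x) := hs ⟨zero_le_one, le_rfl⟩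
    exact ⟨h _ h1 (hmono 1 ⟨zero_le_one, le_rfl⟩), h1.2⟩

/-- A short leafwise path starting at the center of a coordinate ball on which the metric is
bounded below stays in this ball. -/
lemma exists_of_leafPath_lt {p : E n} {u : E n ≃L[ℝ] E n} {κ ρ ℓ : ℝ} (hw : w ∈ A.T i)
    (hκ : 0 < κ) (hball : ∀ b, ‖b‖ < ρ → p + u b ∈ cube n)
    (hg : ∀ b, ‖b‖ < ρ → ∀ a, κ * ‖a‖ ≤ √(A.g i (p + u b, w) (u a) (u a)))
    (hp : A.LeafPath (A.pt i p w) y ℓ) (hℓ : ℓ < κ * ρ) :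
    ∃ b, κ * ‖b‖ ≤ ℓ ∧ y = A.pt i (p + u b) w := by
  generalize hx : A.pt i p w = x at hp
  induction hp with
  | refl => exact ⟨0, by simp, by simp [hx]⟩
  | step ℓ₀ j w' c hw' hc hm hp ih =>
    have hcs : ContinuousOn (A.speed j w' c) (Icc 0 1) := continuousOn_speed hw' hc hm
    have hint : ∀ t ∈ Icc (0 : ℝ) 1, IntervalIntegrable (A.speed j w' c) volume 0 t := fun t ht =>
      ContinuousOn.intervalIntegrable
        (hcs.mono (by rw [uIcc_of_le ht.1]; exact Icc_subset_Icc le_rfl ht.2))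
    let L : ℝ → ℝ := fun t => ℓ₀ + ∫ τ in (0 : ℝ)..t, A.speed j w' c τ
    have hLle : ∀ t ∈ Icc (0 : ℝ) 1, L t ≤ L 1 := by
      intro t ht
      simp only [L]
      gcongr
      exact intervalIntegral.integral_mono_interval le_rfl ht.1 ht.2
        (Eventually.of_forall fun _ => speed_nonneg) (hint 1 ⟨zero_le_one, le_rfl⟩)
    have hL1 : L 1 < κ * ρ := hℓ
    have hL0 : L 0 = ℓ₀ := by simp [L]
    obtain ⟨b₀, hb₀, hyb₀⟩ := ih (by
      have := hLle 0 ⟨le_rfl, zero_le_one⟩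
      linarith)
    have hLc : ContinuousOn L (Icc 0 1) := by
      refine continuousOn_const.add ?_
      have := intervalIntegral.continuousOn_primitive_interval (a := (0 : ℝ)) (b := 1)
        (f := A.speed j w' c) (μ := volume) (by
          rw [uIcc_of_le zero_le_one]; exact hcs.integrableOn_compact isCompact_Icc)
      rwa [uIcc_of_le zero_le_one] at this
    have hLd : ∀ t ∈ Ico (0 : ℝ) 1, HasDerivWithinAt L (A.speed j w' c t) (Ici t) t := by
      intro t ht
      have hmeas : StronglyMeasurableAtFilter (A.speed j w' c) (𝓝[>] t) volume := by
        refine ⟨Ioc t 1, Ioc_mem_nhdsGT ht.2, ?_⟩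
        exact ((hcs.mono (Ioc_subset_Icc_self.trans
          (Icc_subset_Icc_left ht.1))).aestronglyMeasurable measurableSet_Ioc)
      have hcw : ContinuousWithinAt (A.speed j w' c) (Ioi t) t := by
        refine (hcs t ⟨ht.1, ht.2.le⟩).mono_of_mem_nhdsWithin ?_
        exact mem_of_superset (Ioo_mem_nhdsGT ht.2)
          fun τ hτ => ⟨ht.1.trans hτ.1.le, hτ.2.le⟩
      exact (intervalIntegral.integral_hasDerivWithinAt_right (hint t ⟨ht.1, ht.2.le⟩)
        (s := Ici t) (t := Ioi t) hmeas hcw).const_add _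
    let β : ℝ → E n := fun t => u.symm (A.lam i (A.pt j (c t) w') - p)
    -- The path can reach at most this Euclidean radius. As it is below `ρ`, the closed ball of
    -- radius `r` has a compact coordinate image inside the open cube, which yields a closed
    -- condition.
    let r := L 1 / κ
    have hrρ : r < ρ := by rw [div_lt_iff₀ hκ]; linarith
    let K : Set (E n) := (fun b => p + u b) '' Metric.closedBall 0 r
    have hKc : IsCompact K := (isCompact_closedBall 0 r).image (by fun_prop)
    have hKsub : K ⊆ cube n := by
      rintro _ ⟨b, hb, rfl⟩
      exact hball b (lt_of_le_of_lt (by simpa using hb) hrρ)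
    have hKcl := isClosed_image_pt (A := A) (i := i) hKc
      (hKsub.trans (cube_subset_bigCube n)) hw
    -- Membership in the compact image and the length bound are carried along together: the first
    -- gives meaning to the coordinates `β t`, the second keeps them away from the boundary.
    let s : Set ℝ := {t | A.pt j (c t) w' ∈ (fun v => A.pt i v w) '' K ∧ κ * ‖β t‖ ≤ L t}
    have hmemK : ∀ {t}, A.pt j (c t) w' ∈ (fun v => A.pt i v w) '' K →
        A.pt j (c t) w' ∈ A.U i ∧ A.pr i (A.pt j (c t) w') = w ∧
          A.pt j (c t) w' = A.pt i (p + u (β t)) w := by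
      rintro t ⟨v, hv, hvt⟩
      have hvt' : A.pt i v w = A.pt j (c t) w' := hvt
      refine ⟨by rw [← hvt']; exact pt_mem_U (hKsub hv) hw,
        by rw [← hvt']; exact pr_pt' (hKsub hv) hw, ?_⟩
      simp only [β, ContinuousLinearEquiv.apply_symm_apply]
      rw [← hvt', lam_pt' (hKsub hv) hw]
      simp
    have hcf := continuousOn_pt_curve (A := A) hw' hc hm
    have hβat : ∀ t ∈ Icc (0 : ℝ) 1, A.pt j (c t) w' ∈ A.U i → ContinuousAt β t := by
      intro t ht hU
      have h1 : ContinuousAt (fun τ => A.pt j (c τ) w') t :=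
        ContinuousAt.comp (f := c) (continuousAt_pt (cube_subset_bigCube n (hm t ht)) hw')
          hc.continuous.continuousAt
      have h2 : ContinuousAt (fun τ => A.lam i (A.pt j (c τ) w')) t :=
        ContinuousAt.comp (f := fun τ => A.pt j (c τ) w') (continuousAt_lam hU.1) h1
      exact u.symm.continuous.continuousAt.comp (h2.sub continuousAt_const)
    have hs : Icc (0 : ℝ) 1 ⊆ s := by
      refine IsClosed.Icc_subset_of_forall_mem_nhdsWithin ?_ ?_ ?_
      · have h1 : IsClosed (Icc (0 : ℝ) 1 ∩ {t | A.pt j (c t) w' ∈ (fun v => A.pt i v w) '' K}) :=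
          hcf.preimage_isClosed_of_isClosed isClosed_Icc hKcl
        have h2 : ContinuousOn (fun t => L t - κ * ‖β t‖)
            (Icc (0 : ℝ) 1 ∩ {t | A.pt j (c t) w' ∈ (fun v => A.pt i v w) '' K}) :=
          (hLc.mono inter_subset_left).sub (continuousOn_const.mul (ContinuousOn.norm
            fun t ht => (hβat t ht.1 (hmemK ht.2).1).continuousWithinAt))
        have h3 := h2.preimage_isClosed_of_isClosed h1 (isClosed_Ici (a := (0 : ℝ)))
        convert h3 using 1
        ext t
        simp only [s, mem_inter_iff, mem_ofPred_eq, mem_preimage, mem_Ici, sub_nonneg]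
        tauto
      · have hb0r : ‖b₀‖ ≤ r := by
          rw [le_div_iff₀ hκ, mul_comm]
          have := hLle 0 ⟨le_rfl, zero_le_one⟩
          linarith
        have hb0c : p + u b₀ ∈ cube n := hball b₀ (hb0r.trans_lt hrρ)
        refine ⟨?_, ?_⟩
        · rw [hyb₀]
          exact ⟨_, ⟨b₀, by simpa using hb0r, rfl⟩, rfl⟩
        · simp only [β]
          rw [hyb₀, lam_pt' hb0c hw, add_sub_cancel_left, ContinuousLinearEquiv.symm_apply_apply,
            hL0]
          exact hb₀
      · rintro t ⟨⟨hts, htβ⟩, ht⟩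
        have ht' : t ∈ Icc (0 : ℝ) 1 := ⟨ht.1, ht.2.le⟩
        obtain ⟨hU, hpr, -⟩ := hmemK hts
        have hev := eventually_mem_U_pr_eq (cube_subset_bigCube n (hm t ht')) hw' hU
        have hev' := hc.continuous.continuousAt.eventually hev
        have hβt : ‖β t‖ < ρ := by
          have : κ * ‖β t‖ < κ * ρ := by linarith [hLle t ht']
          exact lt_of_mul_lt_mul_left this hκ.le
        have hevβ := (hβat t ht' hU).norm.eventually_lt_const hβt
        obtain ⟨σ, hσ, hσ'⟩ := Metric.eventually_nhds_iff.mp (hev'.and hevβ)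
        have htσ : t < min 1 (t + σ) := lt_min ht.2 (by linarith)
        refine mem_of_superset (Ioo_mem_nhdsGT htσ) ?_
        intro τ hτ
        have hτ1 : τ < 1 := hτ.2.trans_le (min_le_left _ _)
        have hsub : ∀ τ' ∈ Icc t τ, τ' ∈ Icc (0 : ℝ) 1 ∧
            A.pt j (c τ') w' ∈ A.U i ∧ A.pr i (A.pt j (c τ') w') = w ∧ ‖β τ'‖ < ρ := by
          intro τ' hτ'
          have : dist τ' t < σ := by
            rw [Real.dist_eq, abs_of_nonneg (by linarith [hτ'.1])]
            linarith [hτ'.2, hτ.2.trans_le (min_le_right 1 (t + σ))]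
          obtain ⟨⟨h1, h2⟩, h3⟩ := hσ' this
          exact ⟨⟨ht.1.trans hτ'.1, hτ'.2.trans hτ1.le⟩, h1, h2.trans hpr, h3⟩
        have hpβ : ∀ τ', A.pt j (c τ') w' ∈ A.U i → p + u (β τ') = A.lam i (A.pt j (c τ') w') :=
          fun τ' _ => by simp [β]
        have hder : ∀ τ' ∈ Icc t τ, ∃ b, HasDerivAt β b τ' ∧ κ * ‖b‖ ≤ A.speed j w' c τ' := by
          intro τ' hτ'
          obtain ⟨h1, h2, h3, h4⟩ := hsub τ' hτ'
          obtain ⟨b, hb, hgb⟩ := hasDerivAt_lam_pt (j := i)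
            ((hc.differentiable one_ne_zero τ').hasDerivAt) (hm τ' h1) hw' h2
          refine ⟨u.symm b, ?_, ?_⟩
          · exact u.symm.hasFDerivAt.comp_hasDerivAt τ' (hb.sub_const p)
          · have := hg _ h4 (u.symm b)
            rw [hpβ τ' h2, ContinuousLinearEquiv.apply_symm_apply] at this
            have he : A.chart i (A.pt j (c τ') w') = (A.lam i (A.pt j (c τ') w'), w) :=
              Prod.ext rfl h3
            rw [speed, ← hgb, he]
            exact this
        choose! β' hβ' hβ'le using hder
        -- The metric lower bound compares `‖β'‖` with the leafwise speed divided by `κ`, that is,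
        -- with the derivative of `L / κ`.
        have hfin : ∀ τ' ∈ Icc t τ, ‖β τ'‖ ≤ L τ' / κ := by
          refine image_norm_le_of_norm_deriv_right_le_deriv_boundary'
            (f' := β') (B' := fun τ' => A.speed j w' c τ' / κ)
            (fun τ' hτ' => (hβ' τ' hτ').continuousAt.continuousWithinAt)
            (fun τ' hτ' => (hβ' τ' ⟨hτ'.1, hτ'.2.le⟩).hasDerivWithinAt) ?_ ?_ ?_ ?_
          · rw [le_div_iff₀ hκ, mul_comm]; exact htβ
          · exact (hLc.mono fun τ' hτ' => (hsub τ' hτ').1).div_const κ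
          · intro τ' hτ'
            exact (hLd τ' ⟨ht.1.trans hτ'.1, hτ'.2.trans hτ1⟩).div_const κ
          · intro τ' hτ'
            rw [le_div_iff₀ hκ, mul_comm]
            exact hβ'le τ' ⟨hτ'.1, hτ'.2.le⟩
        have hτm : τ ∈ Icc t τ := ⟨hτ.1.le, le_rfl⟩
        obtain ⟨h1, h2, h3, h4⟩ := hsub τ hτm
        have hfτ := hfin τ hτm
        refine ⟨⟨p + u (β τ), ⟨β τ, ?_, rfl⟩, ?_⟩, ?_⟩
        · rw [mem_closedBall_zero_iff]
          refine hfτ.trans ?_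
          have := hLle τ h1
          simp only [r]
          gcongr
        · show A.pt i (p + u (β τ)) w = _
          rw [hpβ τ h2, ← h3, pt_lam_pr h2.1]
        · rw [le_div_iff₀ hκ] at hfτ
          linarith
    obtain ⟨h1, h2⟩ := hs ⟨zero_le_one, le_rfl⟩
    exact ⟨β 1, h2, (hmemK h1).2.2⟩

end Containment

end FoliatedAtlas

namespace FoliatedAtlas

/-! ### Coordinate balls with almost Euclidean metric, and initial velocities of geodesics. -/

section CoordBall

variable {n : ℕ} {M X ι : Type*} [TopologicalSpace M] [TopologicalSpace X]
  {A : FoliatedAtlas n M X ι} {i j : ι} {w : X} {x y : M} {p : E n} {u : E n ≃L[ℝ] E n}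
  {ρ κ K : ℝ}

/-- On the coordinate ball `p + u(B(0,ρ))` of the plaque `w` of the chart `i`, the leafwise
metric lies between `κ²` and `K²` times the Euclidean metric. -/
structure IsCoordBall (A : FoliatedAtlas n M X ι) (i : ι) (w : X) (p : E n)
    (u : E n ≃L[ℝ] E n) (ρ κ K : ℝ) : Prop where
  label : w ∈ A.T i
  mem : ∀ b, ‖b‖ < ρ → p + u b ∈ cube n
  lower : ∀ b, ‖b‖ < ρ → ∀ a, κ * ‖a‖ ≤ √(A.g i (p + u b, w) (u a) (u a))
  upper : ∀ b, ‖b‖ < ρ → ∀ a, √(A.g i (p + u b, w) (u a) (u a)) ≤ K * ‖a‖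

lemma IsCoordBall.leafDist_le (h : A.IsCoordBall i w p u ρ κ K) {a b : E n} (ha : ‖a‖ < ρ)
    (hb : ‖b‖ < ρ) :
    A.leafDist (A.pt i (p + u a) w) (A.pt i (p + u b) w) ≤ ENNReal.ofReal (K * ‖a - b‖) := by
  refine leafDist_segment_le h.label (h.mem a ha) (h.mem b hb) fun t ht => ?_
  have h1 : p + u b - (p + u a) = u (b - a) := by rw [map_sub]; abel
  have h2 : p + u a + t • u (b - a) = p + u (a + t • (b - a)) := by
    rw [map_add, map_smul]; abel
  rw [h1, h2, norm_sub_rev]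
  refine h.upper _ ?_ _
  have := (convex_ball (0 : E n) ρ).add_smul_sub_mem (x := a) (y := b)
    (by simpa using ha) (by simpa using hb) ht
  simpa using this

/-- The ball of radius `r` about `a` lies inside the given ball, so the confinement of short paths
applies with `p + u a` as center. -/
lemma IsCoordBall.exists_of_leafDist_lt [T2Space M] (h : A.IsCoordBall i w p u ρ κ K) (hκ : 0 < κ)
    {a : E n} {r : ℝ} (hr : r ≤ ρ - ‖a‖)
    (hy : A.leafDist (A.pt i (p + u a) w) y < ENNReal.ofReal (κ * r)) :
    ∃ b, ‖b - a‖ < r ∧ y = A.pt i (p + u b) w := by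
  obtain ⟨ℓ, hp, hℓ⟩ := exists_leafPath_of_leafDist_lt hy
  have hℓ' : ℓ < κ * r := (ENNReal.ofReal_lt_ofReal_iff_of_nonneg hp.nonneg).mp hℓ
  have hnorm : ∀ b, ‖b‖ < r → ‖a + b‖ < ρ := fun b hb => by
    have := norm_add_le a b
    linarith
  have hsum : ∀ b, p + u a + u b = p + u (a + b) := fun b => by rw [map_add, add_assoc]
  obtain ⟨b, hb, rfl⟩ := exists_of_leafPath_lt (u := u) (κ := κ) (ρ := r) h.label hκ
    (fun b hb => by rw [hsum]; exact h.mem _ (hnorm b hb))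
    (fun b hb c => by rw [hsum]; exact h.lower _ (hnorm b hb) c) hp hℓ'
  refine ⟨a + b, ?_, by rw [hsum]⟩
  rw [add_sub_cancel_left]
  exact lt_of_mul_lt_mul_left (hb.trans_lt hℓ') hκ.le

/-- Were the distance smaller, the second point would also have coordinates within `r` of `a`, and
coordinates are unique. The truncation `r ≤ ρ - ‖a‖` accounts for paths that leave the ball. -/
lemma IsCoordBall.le_leafDist [T2Space M] (h : A.IsCoordBall i w p u ρ κ K) (hκ : 0 < κ)
    {a b : E n} (hb : ‖b‖ < ρ) {r : ℝ} (hr : r ≤ ρ - ‖a‖) (hr' : r ≤ ‖a - b‖) :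
    ENNReal.ofReal (κ * r) ≤ A.leafDist (A.pt i (p + u a) w) (A.pt i (p + u b) w) := by
  by_contra! hlt
  obtain ⟨b', hb', hpt⟩ := h.exists_of_leafDist_lt hκ hr hlt
  have hb'ρ : ‖b'‖ < ρ := by
    have := norm_add_le (b' - a) a
    rw [sub_add_cancel] at this
    linarith
  have h1 := congrArg (A.lam i) hpt
  rw [lam_pt' (h.mem _ hb) h.label, lam_pt' (h.mem _ hb'ρ) h.label, add_right_inj,
    u.injective.eq_iff] at h1
  rw [← h1, norm_sub_rev] at hb'
  linarith

lemma exists_frame (hx : x ∈ A.U i) :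
    ∃ u : E n ≃L[ℝ] E n, A.IsFrame i x (u : E n →ₗ[ℝ] E n) := by
  have hw := pr_mem (A := A) hx.1
  let B : LinearMap.BilinForm ℝ (E n) :=
    LinearMap.mk₂ ℝ (fun a b => A.g i (A.chart i x) a b) (by simp) (by simp) (by simp) (by simp)
  have hB : ∀ a b, B a b = A.g i (A.chart i x) a b := fun _ _ => rfl
  have hchart : A.chart i x = (A.lam i x, A.pr i x) := rfl
  have hsymm : LinearMap.IsSymm B := ⟨fun a b => by
    rw [RingHom.id_apply, hB, hB, hchart]
    exact A.g_symm i _ hx.2 _ hw _ _⟩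
  have : Invertible (2 : ℝ) := invertibleOfNonzero two_ne_zero
  obtain ⟨v, hv⟩ := LinearMap.BilinForm.exists_orthogonal_basis hsymm
  have hfr : Module.finrank ℝ (E n) = n := by simp
  let v' := v.reindex (finCongr hfr)
  have hpos : ∀ k, 0 < B (v' k) (v' k) := fun k => by
    rw [hB, hchart]
    exact A.g_pos i _ hx.2 _ hw _ (v'.ne_zero k)
  have horth : ∀ k l, k ≠ l → B (v' k) (v' l) = 0 := fun k l hkl => by
    simp only [v', Module.Basis.reindex_apply]
    exact hv (fun h => hkl ((finCongr hfr).symm.injective h))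
  let c : Fin n → ℝ := fun k => (√(B (v' k) (v' k)))⁻¹
  have hc : ∀ k, c k ≠ 0 := fun k => inv_ne_zero (Real.sqrt_pos.mpr (hpos k)).ne'
  let b' := v'.unitsSMul fun k => Units.mk0 (c k) (hc k)
  have hb' : ∀ k, b' k = c k • v' k := fun k => by
    simp [b', Module.Basis.unitsSMul_apply, Units.smul_def]
  have hon : ∀ k l, B (b' k) (b' l) = if k = l then 1 else 0 := fun k l => by
    rw [hb', hb']
    simp only [map_smul, LinearMap.smul_apply, smul_eq_mul]
    split_ifs with hkl
    · subst hkl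
      simp only [c]
      have h1 := Real.sq_sqrt (hpos k).le
      have h2 := (Real.sqrt_pos.mpr (hpos k)).ne'
      field_simp
      exact h1.symm
    · rw [horth k l hkl]; simp
  let e := (EuclideanSpace.basisFun (Fin n) ℝ).toBasis
  let u := (e.equiv b' (Equiv.refl _)).toContinuousLinearEquiv
  have hu : ∀ a : E n, u a = ∑ k, a k • b' k := fun a => by
    have : a = ∑ k, a k • e k := by
      conv_lhs => rw [← e.sum_repr a]
      rfl
    conv_lhs => rw [this]
    simp [u]
  refine ⟨u, hx, fun a b => ?_⟩
  show A.g i (A.chart i x) (u a) (u b) = _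
  rw [← hB, hu, hu]
  simp only [map_sum, map_smul, LinearMap.sum_apply, LinearMap.smul_apply, smul_eq_mul, hon]
  simp [PiLp.inner_apply, mul_comm]

/-- Near a point, the leafwise metric is arbitrarily close to the Euclidean metric given by a
frame. -/
lemma exists_isCoordBall (hx : x ∈ A.U i) (hu : A.IsFrame i x (u : E n →ₗ[ℝ] E n)) {ε : ℝ}
    (hε : 0 < ε) (hε1 : ε < 1) :
    ∃ ρ > 0, A.IsCoordBall i (A.pr i x) (A.lam i x) u ρ (1 - ε) (1 + ε) := by
  have hw := pr_mem (A := A) hx.1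
  have hg : ContinuousAt (fun v => A.g i (v, A.pr i x)) (A.lam i x) :=
    (continuousOn_g hw).continuousAt ((isOpen_cube n).mem_nhds hx.2)
  -- Dividing by `(‖u‖ + 1) ^ 2` turns closeness in operator norm in the chart into relative error
  -- `ε` in the frame.
  have hη : 0 < ε / ((‖(u : E n →L[ℝ] E n)‖ + 1) ^ 2) := by positivity
  have hgball := Metric.ball_mem_nhds (A.g i (A.lam i x, A.pr i x)) hη
  have hev := (hg.eventually_mem hgball).and
    ((isOpen_cube n).eventually_mem hx.2)
  have hcu : Tendsto (fun b => A.lam i x + u b) (𝓝 0) (𝓝 (A.lam i x)) := by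
    have h : Continuous fun b => A.lam i x + u b := by fun_prop
    simpa using h.tendsto 0
  have hev' := hcu.eventually hev
  obtain ⟨ρ, hρ, hball⟩ := Metric.eventually_nhds_iff.mp hev'
  have key : ∀ b, ‖b‖ < ρ → ∀ a,
      |A.g i (A.lam i x + u b, A.pr i x) (u a) (u a) - ‖a‖ ^ 2| ≤ ε * ‖a‖ ^ 2 := by
    intro b hb a
    have h1 : ‖A.g i (A.lam i x + u b, A.pr i x) - A.g i (A.lam i x, A.pr i x)‖
        < ε / ((‖(u : E n →L[ℝ] E n)‖ + 1) ^ 2) :=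
      (dist_eq_norm (E := E n →L[ℝ] E n →L[ℝ] ℝ) _ _).symm.trans_lt
        (hball (y := b) (by simpa using hb)).1
    have h2 : ‖a‖ ^ 2 = A.g i (A.lam i x, A.pr i x) (u a) (u a) := by
      rw [← real_inner_self_eq_norm_sq]
      exact (hu.2 a a).symm
    have h3 : ‖u a‖ ≤ (‖(u : E n →L[ℝ] E n)‖ + 1) * ‖a‖ :=
      ((u : E n →L[ℝ] E n).le_opNorm a).trans (by gcongr; linarith)
    rw [h2, ← h2, h2]
    calc |A.g i (A.lam i x + u b, A.pr i x) (u a) (u a)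
          - A.g i (A.lam i x, A.pr i x) (u a) (u a)|
        = ‖(A.g i (A.lam i x + u b, A.pr i x) - A.g i (A.lam i x, A.pr i x)) (u a) (u a)‖ := by
          rw [Real.norm_eq_abs]; rfl
      _ ≤ ‖A.g i (A.lam i x + u b, A.pr i x) - A.g i (A.lam i x, A.pr i x)‖ * ‖u a‖ * ‖u a‖ :=
          ContinuousLinearMap.le_opNorm₂ _ _ _
      _ ≤ ε / ((‖(u : E n →L[ℝ] E n)‖ + 1) ^ 2) * ((‖(u : E n →L[ℝ] E n)‖ + 1) * ‖a‖)
            * ((‖(u : E n →L[ℝ] E n)‖ + 1) * ‖a‖) := by gcongr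
      _ = ε * ‖a‖ ^ 2 := by
          have : (‖(u : E n →L[ℝ] E n)‖ + 1) ≠ 0 := by positivity
          field_simp
      _ = ε * A.g i (A.lam i x, A.pr i x) (u a) (u a) := by rw [h2]
  refine ⟨ρ, hρ, hw, fun b hb => (hball (by simpa using hb)).2, fun b hb a => ?_,
    fun b hb a => ?_⟩
  · have := abs_le.mp (key b hb a)
    refine Real.le_sqrt_of_sq_le ?_
    rw [mul_pow]
    nlinarith [sq_nonneg ‖a‖, mul_nonneg hε.le (sq_nonneg ‖a‖),
      mul_nonneg (mul_nonneg hε.le (sub_nonneg.mpr hε1.le)) (sq_nonneg ‖a‖)]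
  · have := abs_le.mp (key b hb a)
    rw [← Real.sqrt_sq (by positivity : 0 ≤ (1 + ε) * ‖a‖)]
    refine Real.sqrt_le_sqrt ?_
    rw [mul_pow]
    nlinarith [sq_nonneg ‖a‖, mul_nonneg hε.le (sq_nonneg ‖a‖),
      mul_nonneg (mul_nonneg hε.le hε.le) (sq_nonneg ‖a‖)]

/-- There are `n ^ 2` matrix entries, each with error at most `ε / n ^ 2`, and each coordinate of
`a` is at most `‖a‖`. -/
lemma IsApproxEuclid.abs_metric_sub_le {s ε : ℝ} (hε : 0 ≤ ε)
    (happ : A.IsApproxEuclid i x (u : E n →ₗ[ℝ] E n) s ε) {b : E n} (hb : ‖b‖ ≤ s)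
    (hm : A.lam i x + u b ∈ cube n) (a : E n) :
    |A.g i (A.lam i x + u b, A.pr i x) (u a) (u a) - ‖a‖ ^ 2| ≤ ε * ‖a‖ ^ 2 := by
  have hmet := happ.metric b hb hm
  have hsum : a = ∑ k, a k • EuclideanSpace.single k (1 : ℝ) := by
    have := (EuclideanSpace.basisFun (Fin n) ℝ).sum_repr a
    simpa using this.symm
  set G := A.g i (A.lam i x + u b, A.pr i x) with hG
  have h1 : G (u a) (u a) = ∑ k, ∑ l, a k * a l *
      G (u (EuclideanSpace.single k 1)) (u (EuclideanSpace.single l 1)) := by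
    conv_lhs => rw [hsum]
    simp only [map_sum, map_smul, sum_apply, FunLike.coe_smul, Pi.smul_apply,
      smul_eq_mul, Finset.mul_sum]
    rw [Finset.sum_comm]
    refine Finset.sum_congr rfl fun k _ => Finset.sum_congr rfl fun l _ => ?_
    ring
  have h2 : ‖a‖ ^ 2 = ∑ k, ∑ l, a k * a l * (if k = l then (1 : ℝ) else 0) := by
    rw [EuclideanSpace.norm_sq_eq]
    simp [sq]
  rw [h1, h2, ← Finset.sum_sub_distrib, ← h2]
  simp only [← Finset.sum_sub_distrib, ← mul_sub]
  have hcoord : ∀ k, |a k| ≤ ‖a‖ := fun k => by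
    simpa using PiLp.norm_apply_le a k
  rcases Nat.eq_zero_or_pos n with rfl | hn
  · simp; positivity
  calc |∑ k, ∑ l, a k * a l * (G (u (EuclideanSpace.single k 1)) (u (EuclideanSpace.single l 1))
          - if k = l then (1 : ℝ) else 0)|
      ≤ ∑ k, ∑ l, |a k * a l * (G (u (EuclideanSpace.single k 1))
          (u (EuclideanSpace.single l 1)) - if k = l then (1 : ℝ) else 0)| :=
        (Finset.abs_sum_le_sum_abs _ _).trans
          (Finset.sum_le_sum fun k _ => Finset.abs_sum_le_sum_abs _ _)
    _ ≤ ∑ _k : Fin n, ∑ _l : Fin n, ‖a‖ * ‖a‖ * (ε / (n : ℝ) ^ 2) := by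
        refine Finset.sum_le_sum fun k _ => Finset.sum_le_sum fun l _ => ?_
        rw [abs_mul, abs_mul]
        gcongr
        · exact hcoord k
        · exact hcoord l
        · exact hmet k l
    _ = ε * ‖a‖ ^ 2 := by
        have : (n : ℝ) ≠ 0 := by positivity
        simp
        field_simp

/-- In approximately Euclidean geodesic coordinates on a disk, the metric is close to the
Euclidean one on a coordinate ball which lies in the open plaque. -/
lemma IsApproxEuclid.isCoordBall {s ε : ℝ} (hx : x ∈ A.U i) (hε : 0 ≤ ε) (hε1 : ε ≤ 1)
    (happ : A.IsApproxEuclid i x (u : E n →ₗ[ℝ] E n) s ε) (hs : A.closedDisk x s ⊆ A.U i) :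
    A.IsCoordBall i (A.pr i x) (A.lam i x) u (s / (1 + ε)) (1 - ε) (1 + ε) := by
  have hw := pr_mem (A := A) hx.1
  have hlt : ∀ {b : E n}, ‖b‖ < s / (1 + ε) → ‖b‖ ≤ s := fun {b} hb => by
    rw [lt_div_iff₀ (by linarith)] at hb
    nlinarith [norm_nonneg b]
  have hup : ∀ b, ‖b‖ ≤ s → A.lam i x + u b ∈ cube n → ∀ a,
      √(A.g i (A.lam i x + u b, A.pr i x) (u a) (u a)) ≤ (1 + ε) * ‖a‖ := by
    intro b hb hm a
    have := abs_le.mp (happ.abs_metric_sub_le hε hb hm a)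
    rw [← Real.sqrt_sq (by positivity : 0 ≤ (1 + ε) * ‖a‖)]
    refine Real.sqrt_le_sqrt ?_
    rw [mul_pow]
    nlinarith [sq_nonneg ‖a‖, mul_nonneg hε (sq_nonneg ‖a‖),
      mul_nonneg (mul_nonneg hε hε) (sq_nonneg ‖a‖)]
  -- The metric estimate presupposes that the point lies in the cube. Following the ray to `b`, its
  -- length up to any time spent in the cube is at most `(1 + ε) * ‖b‖ < s`, so the ray stays in the
  -- disk and thus in `U i`; it cannot reach the boundary of the cube.
  have hmem : ∀ b, ‖b‖ < s / (1 + ε) → A.lam i x + u b ∈ cube n := by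
    intro b hb
    have hbs : ‖b‖ ≤ s := hlt hb
    rw [lt_div_iff₀ (by linarith)] at hb
    set q : ℝ → E n := fun t => A.lam i x + u (t • b) with hq
    have hqc : Continuous q := by fun_prop
    have hq0 : q 0 = A.lam i x := by simp [hq]
    let S : Set ℝ := {t | q t ∈ closedCube n}
    -- a point of the ray up to which the ray stays in the closed cube lies in the open cube
    have hstep : ∀ t ∈ Icc (0 : ℝ) 1, q t ∈ closedCube n → q t ∈ cube n := by
      intro t ht hqt
      rcases ht.1.eq_or_lt with rfl | ht0
      · rw [hq0]; exact hx.2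
      have hin : ∀ τ ∈ Ico 0 t, q τ ∈ cube n := by
        intro τ hτ k
        have e1 : q τ = (1 - τ / t) • q 0 + (τ / t) • q t := by
          simp only [hq, map_smul, zero_smul, add_zero, smul_add, smul_smul]
          rw [div_mul_cancel₀ _ ht0.ne', sub_smul, one_smul]
          abel
        have h0 := abs_lt.mp (show |(q 0) k| < 1 by rw [hq0]; exact hx.2 k)
        have h1 := abs_le.mp (hqt k)
        have hd : τ / t < 1 := (div_lt_one ht0).mpr hτ.2
        have hd0 : 0 ≤ τ / t := div_nonneg hτ.1 ht0.le
        rw [e1]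
        simp only [PiLp.add_apply, PiLp.smul_apply, smul_eq_mul]
        rw [abs_lt]
        constructor <;> nlinarith
      have hdist : ∀ τ ∈ Ico 0 t, A.leafDist x (A.pt i (q τ) (A.pr i x))
          ≤ ENNReal.ofReal ((1 + ε) * ‖b‖) := by
        intro τ hτ
        have hτ1 : τ ≤ 1 := hτ.2.le.trans ht.2
        have h := leafDist_segment_le (A := A) (K := (1 + ε) * ‖b‖) hw hx.2 (hin τ hτ) (by
          intro σ hσ
          have e1 : q τ - A.lam i x = u (τ • b) := by simp [hq]
          have e2 : A.lam i x + σ • u (τ • b) = A.lam i x + u ((σ * τ) • b) := by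
            rw [← map_smul, smul_smul]
          have e3 : σ * τ ∈ Ico 0 t := ⟨mul_nonneg hσ.1 hτ.1,
            (mul_le_of_le_one_left hτ.1 hσ.2).trans_lt hτ.2⟩
          rw [e1, e2]
          refine (hup _ ?_ (hin _ e3) _).trans ?_
          · rw [norm_smul, Real.norm_of_nonneg e3.1]
            have : σ * τ ≤ 1 := e3.2.le.trans ht.2
            nlinarith [norm_nonneg b]
          · rw [norm_smul, Real.norm_of_nonneg hτ.1]
            have : τ * ‖b‖ ≤ ‖b‖ := mul_le_of_le_one_left (norm_nonneg b) hτ1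
            gcongr)
        rwa [pt_lam_pr hx.1] at h
      have hbig := closedCube_subset_bigCube n hqt
      -- The endpoint could a priori lie on the boundary of the cube, where there is no metric
      -- bound; its distance is obtained as a limit, since the leafwise distance is continuous over
      -- the big cube.
      have hlim : Tendsto (fun τ => ENNReal.ofReal ((1 + ε) * ‖b‖)
          + A.leafDist (A.pt i (q t) (A.pr i x)) (A.pt i (q τ) (A.pr i x))) (𝓝[<] t)
          (𝓝 (ENNReal.ofReal ((1 + ε) * ‖b‖) + 0)) :=
        tendsto_const_nhds.add (((tendsto_leafDist_pt hbig hw).comp hqc.continuousAt).mono_left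
          nhdsWithin_le_nhds)
      have hle : A.leafDist x (A.pt i (q t) (A.pr i x)) ≤ ENNReal.ofReal ((1 + ε) * ‖b‖) + 0 := by
        refine ge_of_tendsto hlim ?_
        filter_upwards [Ioo_mem_nhdsLT ht0] with τ hτ
        refine (leafDist_triangle _ (A.pt i (q τ) (A.pr i x)) _).trans ?_
        rw [leafDist_comm (A.pt i (q τ) (A.pr i x))]
        gcongr
        exact hdist τ ⟨hτ.1.le, hτ.2⟩
      rw [add_zero] at hle
      refine mem_cube_of_pt_mem_U hbig hw (hs (hle.trans (ENNReal.ofReal_le_ofReal ?_)))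
      linarith
    have hS : Icc (0 : ℝ) 1 ⊆ S := by
      refine IsClosed.Icc_subset_of_forall_mem_nhdsWithin ?_ ?_ ?_
      · exact ((isClosed_closedCube n).preimage hqc).inter isClosed_Icc
      · show q 0 ∈ closedCube n
        rw [hq0]; exact cube_subset_closedCube n hx.2
      · rintro t ⟨hts, ht⟩
        have := hstep t ⟨ht.1, ht.2.le⟩ hts
        refine mem_nhdsWithin_of_mem_nhds ?_
        filter_upwards [hqc.continuousAt.eventually_mem ((isOpen_cube n).mem_nhds this)] with τ hτ
        exact cube_subset_closedCube n hτ
    have h1 := hstep 1 ⟨zero_le_one, le_rfl⟩ (hS ⟨zero_le_one, le_rfl⟩)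
    simpa [hq] using h1
  refine ⟨hw, hmem, fun b hb a => ?_, fun b hb a => hup b (hlt hb) (hmem b hb) a⟩
  have := abs_le.mp (happ.abs_metric_sub_le hε (hlt hb) (hmem b hb) a)
  refine Real.le_sqrt_of_sq_le ?_
  rw [mul_pow]
  nlinarith [sq_nonneg ‖a‖, mul_nonneg hε (sq_nonneg ‖a‖),
    mul_nonneg (mul_nonneg hε (sub_nonneg.mpr hε1)) (sq_nonneg ‖a‖)]

/-- The initial velocity of a shortest geodesic segment: its norm is the distance of the end
points. -/
lemma exists_isExp_of_isMinGeodesic [T2Space M] {γ : ℝ → M} {D : ℝ} (hx : x ∈ A.U i)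
    (hu : A.IsFrame i x (u : E n →ₗ[ℝ] E n)) (hγ : A.IsMinGeodesic γ x y) (hD : 0 ≤ D)
    (hxy : A.leafDist x y = ENNReal.ofReal D) :
    ∃ a, A.IsExp i x (u a) y ∧ ‖a‖ = D := by
  obtain ⟨hgeo, h0, h1, hdist⟩ := hγ
  -- The geodesic is given in some chart `j` near time `0`; its velocity is transported to the chart
  -- `i`.
  obtain ⟨j, hev, hC2, -⟩ := hgeo 0 ⟨le_rfl, zero_le_one⟩
  have hx' : γ 0 ∈ A.U i := by rw [h0]; exact hx
  have h0U := hev.self_of_nhds.1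
  have hw' := pr_mem (A := A) h0U.1
  have hpt : ∀ᶠ s in 𝓝 (0 : ℝ), γ s = A.pt j (A.lam j (γ s)) (A.pr j (γ 0)) := by
    filter_upwards [hev] with s hs
    rw [← hs.2, pt_lam_pr hs.1.1]
  have hcd : HasDerivAt (fun s => A.lam j (γ s)) (deriv (fun s => A.lam j (γ s)) 0) 0 :=
    (hC2.differentiableAt two_ne_zero).hasDerivAt
  have hUi : A.pt j (A.lam j (γ 0)) (A.pr j (γ 0)) ∈ A.U i := by
    rw [pt_lam_pr h0U.1]; exact hx'
  obtain ⟨b, hb, -⟩ := hasDerivAt_lam_pt hcd h0U.2 hw' hUi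
  have hb' : HasDerivAt (fun s => A.lam i (γ s)) b 0 := by
    refine hb.congr_of_eventuallyEq ?_
    filter_upwards [hpt] with s hs
    exact congrArg (A.lam i) hs
  have hin : ∀ᶠ s in 𝓝 (0 : ℝ), γ s ∈ A.U i ∧ A.pr i (γ s) = A.pr i x := by
    have h2 := hcd.continuousAt.eventually
      (eventually_mem_U_pr_eq (cube_subset_bigCube n h0U.2) hw' hUi)
    filter_upwards [hpt, h2] with s hs h2s
    rw [← hs, pt_lam_pr h0U.1, h0] at h2s
    exact h2s
  refine ⟨u.symm b, ⟨hx, γ, hgeo, h0, h1, by simpa using hb'.deriv⟩, ?_⟩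
  set β : ℝ → E n := fun t => u.symm (A.lam i (γ t) - A.lam i x) with hβ
  have hβ0 : β 0 = 0 := by simp [hβ, h0]
  have hβd : HasDerivAt β (u.symm b) 0 :=
    u.symm.hasFDerivAt.comp_hasDerivAt 0 (hb'.sub_const _)
  have hslope : Tendsto (fun t : ℝ => ‖t⁻¹ • β t‖) (𝓝[>] 0) (𝓝 ‖u.symm b‖) := by
    have := (hasDerivAt_iff_tendsto_slope_zero.mp hβd).norm
    simp only [zero_add, hβ0, sub_zero] at this
    exact this.mono_left (nhdsWithin_mono _ fun t ht => ne_of_gt ht)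
  -- For small `t` the distance from `x` to `γ t` is `t * D`, and in a small coordinate ball it is
  -- `‖β t‖` up to a factor `1 ± ε`. Dividing by `t`, and later letting `ε` tend to `0`, identifies
  -- the norm of the velocity.
  have hbounds : ∀ ε, 0 < ε → ε < 1 →
      (1 - ε) * ‖u.symm b‖ ≤ D ∧ D ≤ (1 + ε) * ‖u.symm b‖ := by
    intro ε hε hε1
    obtain ⟨ρ, hρ, hcb⟩ := exists_isCoordBall hx hu hε hε1
    have hsmall : ∀ᶠ t in 𝓝 (0 : ℝ), ‖β t‖ < ρ :=
      hβd.continuousAt.norm.eventually_lt_const (by simpa [hβ0] using hρ)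
    have hboth : ∀ᶠ t in 𝓝[>] (0 : ℝ),
        (1 - ε) * ‖t⁻¹ • β t‖ ≤ D ∧ D ≤ (1 + ε) * ‖t⁻¹ • β t‖ := by
      filter_upwards [nhdsWithin_le_nhds hsmall, nhdsWithin_le_nhds hin,
        Ioo_mem_nhdsGT zero_lt_one] with t hts htin ht
      have hpt1 : γ t = A.pt i (A.lam i x + u (β t)) (A.pr i x) := by
        simp only [hβ, ContinuousLinearEquiv.apply_symm_apply, add_sub_cancel]
        rw [← htin.2, pt_lam_pr htin.1.1]
      have hpt0 : x = A.pt i (A.lam i x + u 0) (A.pr i x) := by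
        rw [map_zero, add_zero, pt_lam_pr hx.1]
      have hd : A.leafDist x (γ t) = ENNReal.ofReal (t * D) := by
        rw [hdist t ⟨ht.1.le, ht.2.le⟩, hxy, ← ENNReal.ofReal_mul ht.1.le]
      have hup := hcb.leafDist_le (a := 0) (b := β t) (by simpa using hρ) hts
      have hlo := hcb.le_leafDist (by linarith) (a := 0) (b := β t) hts (r := ‖β t‖)
        (by simpa using hts.le) (by simp)
      rw [← hpt0, ← hpt1, hd] at hup hlo
      rw [zero_sub, norm_neg] at hup
      have hup' := (ENNReal.ofReal_le_ofReal_iff (by positivity)).mp hup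
      have hlo' := (ENNReal.ofReal_le_ofReal_iff (mul_nonneg ht.1.le hD)).mp hlo
      rw [norm_smul, norm_inv, Real.norm_of_nonneg ht.1.le]
      constructor
      · rw [mul_left_comm, inv_mul_le_iff₀ ht.1]; exact hlo'
      · rw [mul_left_comm, le_inv_mul_iff₀ ht.1]; exact hup'
    exact ⟨le_of_tendsto (hslope.const_mul _) (hboth.mono fun _ h => h.1),
      ge_of_tendsto (hslope.const_mul _) (hboth.mono fun _ h => h.2)⟩
  have hlim1 : Tendsto (fun ε : ℝ => (1 - ε) * ‖u.symm b‖) (𝓝[>] 0) (𝓝 ‖u.symm b‖) := by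
    have h : Continuous fun ε : ℝ => (1 - ε) * ‖u.symm b‖ := by fun_prop
    simpa using (h.tendsto 0).mono_left nhdsWithin_le_nhds
  have hlim2 : Tendsto (fun ε : ℝ => (1 + ε) * ‖u.symm b‖) (𝓝[>] 0) (𝓝 ‖u.symm b‖) := by
    have h : Continuous fun ε : ℝ => (1 + ε) * ‖u.symm b‖ := by fun_prop
    simpa using (h.tendsto 0).mono_left nhdsWithin_le_nhds
  refine le_antisymm (le_of_tendsto hlim1 ?_) (ge_of_tendsto hlim2 ?_)
  · filter_upwards [Ioo_mem_nhdsGT zero_lt_one] with ε hε using (hbounds ε hε.1 hε.2).1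
  · filter_upwards [Ioo_mem_nhdsGT zero_lt_one] with ε hε using (hbounds ε hε.1 hε.2).2

end CoordBall

end FoliatedAtlas

set_option maxSynthPendingDepth 3

/-! ### Geodesics with prescribed initial velocity -/

section ODE

variable {V : Type*} [NormedAddCommGroup V] [NormedSpace ℝ V]

/-- A bounded Lipschitz vector field has integral curves on every bounded time interval. -/
lemma exists_integralCurve_of_bounded [CompleteSpace V] {H : V → V} {C : NNReal}
    (hH : LipschitzWith C H) {B : NNReal}
    (hB : ∀ z, ‖H z‖ ≤ B) (z₀ : V) :
    ∃ z : ℝ → V, z 0 = z₀ ∧ ∀ t ∈ Ioo (-1 : ℝ) 2, HasDerivAt z (H (z t)) t := by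
  -- The interval `[-1, 2]` contains `[0, 1]` in its interior, so derivatives there are two-sided. A
  -- field bounded by `B` moves the initial point by at most `2 * B`, since the farther end is at
  -- distance `2`.
  have h0 : (0 : ℝ) ∈ Icc (-1 : ℝ) 2 := ⟨by norm_num, by norm_num⟩
  have hpl : IsPicardLindelof (fun _ => H) (tmin := -1) (tmax := 2) ⟨0, h0⟩ z₀ (2 * B) 0 B C := by
    refine ⟨fun t _ => hH.lipschitzOnWith, fun x _ => continuousOn_const, fun t _ x _ => hB x, ?_⟩
    norm_num
    rw [mul_comm]
  obtain ⟨z, hz, hz'⟩ := hpl.exists_eq_forall_mem_Icc_hasDerivWithinAt₀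
  refine ⟨z, hz, fun t ht => ?_⟩
  exact (hz' t (Ioo_subset_Icc_self ht)).hasDerivAt (Icc_mem_nhds ht.1 ht.2)

lemma contDiffOn_two_of_integralCurve {H : V → V} (hH : ContDiff ℝ 1 H) {z : ℝ → V} {I : Set ℝ}
    (hI : IsOpen I) (hz : ∀ t ∈ I, HasDerivAt z (H (z t)) t) : ContDiffOn ℝ 2 z I := by
  have hd : DifferentiableOn ℝ z I := fun t ht => (hz t ht).differentiableAt.differentiableWithinAt
  have he : EqOn (deriv z) (fun t => H (z t)) I := fun t ht => (hz t ht).deriv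
  have h1 : ContDiffOn ℝ (0 + 1) z I :=
    (contDiffOn_succ_iff_deriv_of_isOpen hI).mpr ⟨hd, by simp, contDiffOn_zero.mpr
      ((hH.continuous.comp_continuousOn hd.continuousOn).congr he)⟩
  rw [zero_add] at h1
  have h2 : ContDiffOn ℝ (1 + 1) z I :=
    (contDiffOn_succ_iff_deriv_of_isOpen hI).mpr ⟨hd, by simp, (hH.comp_contDiffOn h1).congr he⟩
  rwa [one_add_one_eq_two] at h2

/-- A smooth cutoff function for a compact subset of an open set. -/
lemma exists_contDiff_cutoff [FiniteDimensional ℝ V] {K U : Set V} (hK : IsCompact K)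
    (hU : IsOpen U) (hKU : K ⊆ U) :
    ∃ χ : V → ℝ, ContDiff ℝ 1 χ ∧ HasCompactSupport χ ∧ tsupport χ ⊆ U ∧ ∀ z ∈ K, χ z = 1 := by
  obtain ⟨K', hK', h1, h2⟩ := exists_compact_between hK hU hKU
  obtain ⟨f, hf1, hf0, -⟩ := exists_contMDiffMap_one_nhds_of_subset_interior (n := 1)
    (modelWithCornersSelf ℝ V) hK.isClosed h1
  have hts : tsupport f ⊆ K' := by
    refine closure_minimal (fun z hz => ?_) hK'.isClosed
    by_contra h
    exact hz (hf0 z h)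
  exact ⟨f, f.contMDiff.contDiff, HasCompactSupport.of_support_subset_isCompact hK'
    (subset_closure.trans hts), hts.trans h2, fun z hz => hf1.self_of_nhdsSet z hz⟩

end ODE

namespace FoliatedAtlas

section GeodesicODE

variable {n : ℕ} {M X ι : Type*} [TopologicalSpace M] [TopologicalSpace X]
  {A : FoliatedAtlas n M X ι} {i : ι} {w : X} {x y : M} {p : E n} {u : E n ≃L[ℝ] E n}
  {ρ κ K : ℝ}

lemma isInvertible_g {v : E n} (hv : v ∈ cube n) (hw : w ∈ A.T i) :
    (A.g i (v, w)).IsInvertible := by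
  have hinj : Function.Injective (A.g i (v, w)) := by
    refine (injective_iff_map_eq_zero (A.g i (v, w))).mpr fun a ha => ?_
    by_contra h
    have := A.g_pos i v hv w hw a h
    simp [ha] at this
  have hfr : Module.finrank ℝ (E n) = Module.finrank ℝ (E n →L[ℝ] ℝ) := by
    rw [← (LinearMap.toContinuousLinearMap (𝕜 := ℝ) (E := E n) (F' := ℝ)).finrank_eq]
    exact (Subspace.dual_finrank_eq (K := ℝ) (V := E n)).symm
  exact ⟨(LinearEquiv.ofInjectiveOfFinrankEq (A.g i (v, w) : E n →ₗ[ℝ] E n →L[ℝ] ℝ) hinj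
    hfr).toContinuousLinearEquiv, by ext; rfl⟩

/-- The acceleration of a geodesic with position `z.1` and velocity `z.2` in the plaque `w` of
the chart `i`. -/
def geodesicAccel (A : FoliatedAtlas n M X ι) (i : ι) (w : X) (z : E n × E n) : E n :=
  (A.g i (z.1, w)).inverse
    ((1 / 2 : ℝ) • ((fderiv ℝ (fun v => A.g i (v, w)) z.1).flip z.2).flip z.2
      - fderiv ℝ (fun v => A.g i (v, w)) z.1 z.2 z.2)

lemma g_geodesicAccel {z : E n × E n} (hz : z.1 ∈ cube n) (hw : w ∈ A.T i) (e : E n) :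
    A.g i (z.1, w) (A.geodesicAccel i w z) e
      = 1 / 2 * fderiv ℝ (fun v => A.g i (v, w)) z.1 e z.2 z.2
        - fderiv ℝ (fun v => A.g i (v, w)) z.1 z.2 z.2 e := by
  obtain ⟨f, hf⟩ := isInvertible_g (A := A) hz hw
  rw [geodesicAccel, ← hf, ContinuousLinearMap.inverse_equiv]
  simp

lemma contDiffOn_geodesicAccel (hw : w ∈ A.T i) :
    ContDiffOn ℝ 1 (A.geodesicAccel i w) (cube n ×ˢ univ) := by
  intro z hz
  have hg : ContDiffAt ℝ ((⊤ : ℕ∞) : WithTop ℕ∞) (fun v => A.g i (v, w)) z.1 :=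
    (A.g_smooth i w hw).contDiffAt ((isOpen_cube n).mem_nhds hz.1)
  have hg1 : ContDiffAt ℝ 1 (fun z : E n × E n => A.g i (z.1, w)) z :=
    (hg.of_le (by exact_mod_cast le_top)).comp z contDiffAt_fst
  have hD : ContDiffAt ℝ 1
      (fun z : E n × E n => fderiv ℝ (fun v => A.g i (v, w)) z.1) z :=
    (hg.fderiv_right (m := 1)
      (WithTop.coe_le_coe.mpr (le_top : (2 : ℕ∞) ≤ ⊤))).comp z contDiffAt_fst
  have h2 : ContDiffAt ℝ 1 (fun z : E n × E n => z.2) z := contDiffAt_snd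
  have hinv : ContDiffAt ℝ 1 (fun z : E n × E n => (A.g i (z.1, w)).inverse) z :=
    ContDiffAt.comp (g := ContinuousLinearMap.inverse) z
      (isInvertible_g (A := A) hz.1 hw).contDiffAt_map_inverse hg1
  have hfl : ContDiffAt ℝ 1
      (fun z : E n × E n => (fderiv ℝ (fun v => A.g i (v, w)) z.1).flip) z :=
    ((ContinuousLinearMap.flipₗᵢ ℝ (E n) (E n) (E n →L[ℝ] ℝ)).contDiff.contDiffAt).comp z hD
  have hfl2 : ContDiffAt ℝ 1
      (fun z : E n × E n => ((fderiv ℝ (fun v => A.g i (v, w)) z.1).flip z.2).flip) z :=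
    ((ContinuousLinearMap.flipₗᵢ ℝ (E n) (E n) ℝ).contDiff.contDiffAt).comp z (hfl.clm_apply h2)
  exact (hinv.clm_apply (((hfl2.clm_apply h2).const_smul (1 / 2 : ℝ)).sub
    ((hD.clm_apply h2).clm_apply h2))).contDiffWithinAt

set_option maxHeartbeats 2000000 in
/-- Geodesics starting in a coordinate ball exist for unit time if their speed is too small for
them to leave the ball. -/
theorem IsCoordBall.exists_isExp (h : A.IsCoordBall i w p u ρ κ K) (hκ : 0 < κ) {a₀ v₀ : E n}
    (hr : ‖a₀‖ + √(A.g i (p + u a₀, w) v₀ v₀) / κ < ρ) :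
    ∃ y, A.IsExp i (A.pt i (p + u a₀) w) v₀ y := by
  have hw := h.label
  obtain ⟨σ, hσ⟩ : ∃ σ, σ = √(A.g i (p + u a₀, w) v₀ v₀) := ⟨_, rfl⟩
  rw [← hσ] at hr
  have hσ0 : 0 ≤ σ := hσ ▸ Real.sqrt_nonneg _
  set τ := σ / κ with hτ
  have hτ0 : 0 ≤ τ := div_nonneg hσ0 hκ.le
  -- The geodesic will stay within `‖a₀‖ + τ < r`. The gap between `r` and `ρ` leaves room for a
  -- compact set on which the field is not cut off.
  obtain ⟨r, hr1, hr2⟩ := exists_between hr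
  have ha₀ : p + u a₀ ∈ cube n := h.mem _ (by linarith)
  have hσ2 : A.g i (p + u a₀, w) v₀ v₀ = σ ^ 2 := by rw [hσ, Real.sq_sqrt (g_nonneg ha₀ hw _)]
  -- the cut off geodesic field
  let Kc : Set (E n × E n) := (fun z : E n × E n => (p + u z.1, u z.2)) ''
    (Metric.closedBall 0 r ×ˢ Metric.closedBall 0 (τ + 1))
  have hKc : IsCompact Kc :=
    ((isCompact_closedBall 0 r).prod (isCompact_closedBall 0 (τ + 1))).image (by fun_prop)
  have hUo : IsOpen (cube n ×ˢ (univ : Set (E n))) := (isOpen_cube n).prod isOpen_univ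
  have hKU : Kc ⊆ cube n ×ˢ univ := by
    rintro _ ⟨z, hz, rfl⟩
    exact ⟨h.mem _ (lt_of_le_of_lt (by simpa using hz.1) hr2), mem_univ _⟩
  obtain ⟨χ, hχ, hχc, hχU, hχ1⟩ := exists_contDiff_cutoff hKc hUo hKU
  let F : E n × E n → E n × E n := fun z => (z.2, A.geodesicAccel i w z)
  have hF : ContDiffOn ℝ 1 F (cube n ×ˢ univ) :=
    contDiffOn_snd.prodMk (contDiffOn_geodesicAccel hw)
  let H : E n × E n → E n × E n := fun z => χ z • F z
  have hH : ContDiff ℝ 1 H := by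
    rw [contDiff_iff_contDiffAt]
    intro z
    by_cases hz : z ∈ cube n ×ˢ (univ : Set (E n))
    · exact hχ.contDiffAt.smul (hF.contDiffAt (hUo.mem_nhds hz))
    · have hz' : z ∉ tsupport χ := fun hzt => hz (hχU hzt)
      have h0 : H =ᶠ[𝓝 z] fun _ => 0 := by
        filter_upwards [(isClosed_tsupport χ).isOpen_compl.mem_nhds hz'] with z' hz''
        simp [H, image_eq_zero_of_notMem_tsupport hz'']
      exact contDiffAt_const.congr_of_eventuallyEq h0
  have hHc : HasCompactSupport H := hχc.smul_right
  obtain ⟨C, hC⟩ := hH.lipschitzWith_of_hasCompactSupport hHc one_ne_zero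
  obtain ⟨B, hB⟩ := hHc.exists_bound_of_continuous hH.continuous
  obtain ⟨z, hz0, hz⟩ := exists_integralCurve_of_bounded hC (B := B.toNNReal)
    (fun z => (hB z).trans (Real.le_coe_toNNReal B)) (p + u a₀, v₀)
  have hIcc : Icc (0 : ℝ) 1 ⊆ Ioo (-1) 2 := fun t ht => ⟨by linarith [ht.1], by linarith [ht.2]⟩
  have hz2 : ContDiffOn ℝ 2 z (Ioo (-1) 2) := contDiffOn_two_of_integralCurve hH isOpen_Ioo hz
  let a : ℝ → E n := fun t => u.symm ((z t).1 - p)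
  let b : ℝ → E n := fun t => u.symm (z t).2
  have hca : ∀ t, p + u (a t) = (z t).1 := fun t => by simp [a]
  have hvb : ∀ t, u (b t) = (z t).2 := fun t => by simp [b]
  have hzc : ContinuousOn z (Ioo (-1) 2) := hz2.continuousOn
  have hac : ContinuousOn a (Ioo (-1) 2) :=
    u.symm.continuous.comp_continuousOn (hzc.fst.sub continuousOn_const)
  have hbc : ContinuousOn b (Ioo (-1) 2) := u.symm.continuous.comp_continuousOn hzc.snd
  let good : ℝ → Prop := fun t => t ∈ Ioo (-1 : ℝ) 2 ∧ ‖a t‖ < r ∧ ‖b t‖ < τ + 1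
  have hgoodcube : ∀ {t}, good t → (z t).1 ∈ cube n := fun {t} ht => by
    rw [← hca]; exact h.mem _ (ht.2.1.trans hr2)
  have hgoodev : ∀ {t}, good t → ∀ᶠ s in 𝓝 t, good s := fun {t} ht => by
    have hI : Ioo (-1 : ℝ) 2 ∈ 𝓝 t := isOpen_Ioo.mem_nhds ht.1
    exact (eventually_mem_set.mpr hI).and
      (((hac.continuousAt hI).norm.eventually_lt_const ht.2.1).and
        ((hbc.continuousAt hI).norm.eventually_lt_const ht.2.2))
  have hderiv : ∀ {t}, good t → HasDerivAt z (F (z t)) t := fun {t} ht => by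
    have hzK : z t ∈ Kc := ⟨(a t, b t), ⟨by simpa using ht.2.1.le, by simpa using ht.2.2.le⟩,
      Prod.ext (hca t) (hvb t)⟩
    have h1 := hz t ht.1
    simp only [H, hχ1 _ hzK, one_smul] at h1
    exact h1
  have hd1 : ∀ {t}, good t → HasDerivAt (fun t => (z t).1) (z t).2 t := fun {t} ht =>
    (hasFDerivAt_fst (𝕜 := ℝ) (p := z t)).comp_hasDerivAt t (hderiv ht)
  have hd2 : ∀ {t}, good t → HasDerivAt (fun t => (z t).2) (A.geodesicAccel i w (z t)) t :=
    fun {t} ht => (hasFDerivAt_snd (𝕜 := ℝ) (p := z t)).comp_hasDerivAt t (hderiv ht)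
  have hda : ∀ {t}, good t → HasDerivAt a (b t) t := fun {t} ht =>
    u.symm.hasFDerivAt.comp_hasDerivAt t ((hd1 ht).sub_const p)
  -- conservation of speed
  let e : ℝ → ℝ := fun t => A.g i ((z t).1, w) (z t).2 (z t).2
  have hde : ∀ {t}, good t → HasDerivAt e 0 t := fun {t} ht => by
    have hm := hgoodcube ht
    have hg : HasFDerivAt (fun v => A.g i (v, w)) (fderiv ℝ (fun v => A.g i (v, w)) (z t).1)
        (z t).1 :=
      (((A.g_smooth i w hw).contDiffAt ((isOpen_cube n).mem_nhds hm)).differentiableAt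
        (by simp)).hasFDerivAt
    have h1 : HasDerivAt (fun t => A.g i ((z t).1, w))
        (fderiv ℝ (fun v => A.g i (v, w)) (z t).1 (z t).2) t :=
      HasFDerivAt.comp_hasDerivAt (l := fun v => A.g i (v, w)) (f := fun t => (z t).1) t hg
        (hd1 ht)
    have h2 := (h1.clm_apply (hd2 ht)).clm_apply (hd2 ht)
    refine h2.congr_deriv ?_
    change fderiv ℝ (fun v => A.g i (v, w)) (z t).1 (z t).2 (z t).2 (z t).2
      + A.g i ((z t).1, w) (A.geodesicAccel i w (z t)) (z t).2
      + A.g i ((z t).1, w) (z t).2 (A.geodesicAccel i w (z t)) = 0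
    -- By the geodesic equation tested on the velocity, each acceleration term contributes minus one
    -- half of the first term.
    rw [A.g_symm i _ hm w hw (z t).2, g_geodesicAccel hm hw]
    ring
  have hb_le : ∀ {t}, ‖a t‖ < r → e t = σ ^ 2 → ‖b t‖ ≤ τ := fun {t} ht het => by
    have h1 := h.lower (a t) (ht.trans hr2) (b t)
    rw [hca, hvb] at h1
    have h2 : √(A.g i ((z t).1, w) (z t).2 (z t).2) = σ := by
      rw [show A.g i ((z t).1, w) (z t).2 (z t).2 = σ ^ 2 from het, Real.sqrt_sq hσ0]
    rw [h2] at h1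
    rw [hτ, le_div_iff₀ hκ, mul_comm]
    exact h1
  have ha_lt : ∀ {t}, t ∈ Icc (0 : ℝ) 1 → ‖a t - a₀‖ ≤ τ * t → ‖a t‖ < r := fun {t} ht hat => by
    have h1 := norm_add_le (a t - a₀) a₀
    rw [sub_add_cancel] at h1
    have h2 : τ * t ≤ τ := mul_le_of_le_one_right hτ0 ht.2
    linarith
  -- Constant energy bounds the Euclidean speed by `τ`, hence the displacement by `τ * t`. This
  -- keeps the solution strictly inside the compact set, so both properties persist and the cutoff
  -- is never felt.
  let S : Set ℝ := {t | ‖a t - a₀‖ ≤ τ * t ∧ e t = σ ^ 2}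
  have hgoodS : ∀ {t}, t ∈ S → t ∈ Icc (0 : ℝ) 1 → good t := fun {t} hts ht =>
    ⟨hIcc ht, ha_lt ht hts.1, (hb_le (ha_lt ht hts.1) hts.2).trans_lt (lt_add_one τ)⟩
  have hS : Icc (0 : ℝ) 1 ⊆ S := by
    refine IsClosed.Icc_subset_of_forall_mem_nhdsWithin ?_ ?_ ?_
    · have h1 : IsClosed (Icc (0 : ℝ) 1 ∩ {t | ‖a t - a₀‖ - τ * t ∈ Iic (0 : ℝ)}) :=
        ContinuousOn.preimage_isClosed_of_isClosed
          (((hac.mono hIcc).sub continuousOn_const).norm.sub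
            (continuousOn_const.mul continuousOn_id)) isClosed_Icc isClosed_Iic
      have h2 : ContinuousOn e (Icc (0 : ℝ) 1 ∩ {t | ‖a t - a₀‖ - τ * t ∈ Iic (0 : ℝ)}) := by
        have hmaps : MapsTo (fun t => (z t).1)
            (Icc (0 : ℝ) 1 ∩ {t | ‖a t - a₀‖ - τ * t ∈ Iic (0 : ℝ)}) (cube n) := fun t ht => by
          show (z t).1 ∈ cube n
          rw [← hca]
          exact h.mem _ ((ha_lt ht.1 (sub_nonpos.mp ht.2)).trans hr2)
        have hzc' := hzc.mono (inter_subset_left.trans hIcc :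
          Icc (0 : ℝ) 1 ∩ {t | ‖a t - a₀‖ - τ * t ∈ Iic (0 : ℝ)} ⊆ Ioo (-1) 2)
        exact (((continuousOn_g hw).comp hzc'.fst hmaps).clm_apply hzc'.snd).clm_apply hzc'.snd
      have h3 := h2.preimage_isClosed_of_isClosed h1 (isClosed_singleton (x := σ ^ 2))
      convert h3 using 1
      ext t
      simp only [S, mem_inter_iff, mem_ofPred_eq, mem_preimage, mem_Iic, sub_nonpos,
        mem_singleton_iff]
      tauto
    · refine ⟨?_, ?_⟩
      · simp [a, hz0]
      · simp only [e, hz0]; exact hσ2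
    · rintro t ⟨hts, ht⟩
      have ht' : t ∈ Icc (0 : ℝ) 1 := ⟨ht.1, ht.2.le⟩
      obtain ⟨δ, hδ, hδ'⟩ := Metric.eventually_nhds_iff.mp (hgoodev (hgoodS hts ht'))
      have htδ : t < min 1 (t + δ) := lt_min ht.2 (by linarith)
      refine mem_of_superset (Ioo_mem_nhdsGT htδ) fun s hs => ?_
      have hs1 : s < 1 := hs.2.trans_le (min_le_left _ _)
      have hgood : ∀ s' ∈ Icc t s, good s' := fun s' hs' => by
        apply hδ'
        rw [Real.dist_eq, abs_of_nonneg (by linarith [hs'.1])]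
        linarith [hs'.2, hs.2.trans_le (min_le_right 1 (t + δ))]
      have he : ∀ s' ∈ Icc t s, e s' = σ ^ 2 := fun s' hs' => by
        rw [← hts.2]
        exact constant_of_has_deriv_right_zero
          (fun s'' hs'' => (hde (hgood s'' hs'')).continuousAt.continuousWithinAt)
          (fun s'' hs'' => (hde (hgood s'' ⟨hs''.1, hs''.2.le⟩)).hasDerivWithinAt) s' hs'
      have hmv := norm_image_sub_le_of_norm_deriv_le_segment' (C := τ)
        (fun s' hs' => (hda (hgood s' hs')).hasDerivWithinAt)
        (fun s' hs' => hb_le (hgood s' ⟨hs'.1, hs'.2.le⟩).2.1 (he s' ⟨hs'.1, hs'.2.le⟩))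
        s ⟨hs.1.le, le_rfl⟩
      refine ⟨?_, he s ⟨hs.1.le, le_rfl⟩⟩
      calc ‖a s - a₀‖ ≤ ‖a s - a t‖ + ‖a t - a₀‖ := norm_sub_le_norm_sub_add_norm_sub _ _ _
        _ ≤ τ * (s - t) + τ * t := add_le_add hmv hts.1
        _ = τ * s := by ring
  have hgood : ∀ t ∈ Icc (0 : ℝ) 1, good t := fun t ht => hgoodS (hS ht) ht
  -- the geodesic
  let γ : ℝ → M := fun t => A.pt i (z t).1 w
  have hlam : ∀ t ∈ Icc (0 : ℝ) 1, (fun s => A.lam i (γ s)) =ᶠ[𝓝 t] fun s => (z s).1 :=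
    fun t ht => (hgoodev (hgood t ht)).mono fun s hs => lam_pt' (hgoodcube hs) hw
  have hγ0 : γ 0 = A.pt i (p + u a₀) w := by simp only [γ, hz0]
  have h01 : (0 : ℝ) ∈ Icc (0 : ℝ) 1 := ⟨le_rfl, zero_le_one⟩
  refine ⟨γ 1, pt_mem_U ha₀ hw, γ, fun t ht => ⟨i, ?_, ?_, fun e => ?_⟩, hγ0, rfl, ?_⟩
  · filter_upwards [hgoodev (hgood t ht)] with s hs
    refine ⟨pt_mem_U (hgoodcube hs) hw, ?_⟩
    rw [pr_pt' (hgoodcube hs) hw, pr_pt' (hgoodcube (hgood t ht)) hw]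
  · refine ContDiffAt.congr_of_eventuallyEq ?_ (hlam t ht)
    exact (hz2.contDiffAt (isOpen_Ioo.mem_nhds (hIcc ht))).fst
  · have hm := hgoodcube (hgood t ht)
    have e1 : A.chart i (γ t) = ((z t).1, w) := chart_pt (cube_subset_bigCube n hm) hw
    have e2 : A.pr i (γ t) = w := pr_pt' hm hw
    have e3 : A.lam i (γ t) = (z t).1 := lam_pt' hm hw
    have e4 : deriv (fun s => A.lam i (γ s)) t = (z t).2 := by
      rw [(hlam t ht).deriv_eq, (hd1 (hgood t ht)).deriv]
    have e5 : deriv (deriv fun s => A.lam i (γ s)) t = A.geodesicAccel i w (z t) := by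
      have h1 : (deriv fun s => A.lam i (γ s)) =ᶠ[𝓝 t] fun s => (z s).2 := by
        filter_upwards [(hlam t ht).deriv, hgoodev (hgood t ht)] with s hs1 hs2
        rw [hs1, (hd1 hs2).deriv]
      rw [h1.deriv_eq, (hd2 (hgood t ht)).deriv]
    rw [e1, e2, e3, e4, e5, g_geodesicAccel hm hw]
    ring
  · rw [(hlam 0 h01).deriv_eq, (hd1 (hgood 0 h01)).deriv, hz0]

end GeodesicODE

end FoliatedAtlas

/-! ### Estimates for the constants -/

lemma ten_le_Cn {n : ℕ} (hn : 1 ≤ n) : 10 ≤ Cn n := by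
  have h1 : ((10 ^ n).choose 1 : ℝ) ≤ Cn n :=
    Finset.single_le_sum (f := fun k => ((10 ^ n).choose k : ℝ)) (fun k _ => by positivity)
      (Finset.mem_Icc.mpr ⟨le_rfl, by omega⟩)
  have h2 : (10 : ℝ) ≤ 10 ^ n := le_self_pow₀ (by norm_num) (by omega)
  rw [Nat.choose_one_right] at h1
  push_cast at h1
  linarith

lemma eps2_pos {n : ℕ} (hn : 1 ≤ n) : 0 < eps2 n := by
  have := ten_le_Cn hn
  unfold eps2
  positivity

lemma eps2_le {n : ℕ} (hn : 1 ≤ n) : eps2 n ≤ 1 / 40000 := by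
  have h1 := ten_le_Cn hn
  have h2 : (2 : ℝ) ≤ 2 ^ n := le_self_pow₀ (by norm_num) (by omega)
  unfold eps2
  refine one_div_le_one_div_of_le (by norm_num) ?_
  nlinarith

lemma eps3_le {n : ℕ} (hn : 1 ≤ n) : eps3 n ≤ 1 / 10000000 := by
  have h1 := ten_le_Cn hn
  have h2 : (100 : ℝ) ≤ 100 ^ n := le_self_pow₀ (by norm_num) (by omega)
  have h3 : (1 : ℝ) ≤ n := by exact_mod_cast hn
  have h4 : eps1 n ≤ 1 / 1000000 := by
    unfold eps1
    refine one_div_le_one_div_of_le (by norm_num) ?_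
    calc (1000000 : ℝ) = 10 * 1000 * 1 * 100 := by norm_num
      _ ≤ Cn n * 1000 * n * 100 ^ n := by gcongr
  unfold eps3
  linarith

/-- The condition number of the vertices of a simplex whose heights are at least about `2ε₂`. -/
def growth (n : ℕ) : ℝ := 4 / (15 * eps2 n)

lemma growth_mul_eps2 {n : ℕ} (hn : 1 ≤ n) : growth n * eps2 n = 4 / 15 := by
  have := (eps2_pos hn).ne'
  unfold growth
  field_simp

lemma le_growth {n : ℕ} (hn : 1 ≤ n) : 10000 ≤ growth n := by
  have h0 := eps2_pos hn
  have := eps2_le hn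
  unfold growth
  rw [le_div_iff₀ (by positivity)]
  linarith

/-- The factor `n ^ (3 / 2)` in the condition on `ε₀` is at least `1` and can be dropped. The rest
bounds the displacement of the center, about `20 g ^ (n - 1) ε₀ r_F`, plus one transverse error. -/
lemma AdmissibleEps0.mul_growth_lt {n : ℕ} (hn : 1 ≤ n) {ε₄ ε₀ : ℝ} (h : AdmissibleEps0 n ε₄ ε₀) :
    ε₀ * (1 + 35 * growth n ^ (n - 1)) < eps3 n / 2 := by
  have hg : 0 < growth n ^ (n - 1) := pow_pos (by linarith [le_growth hn]) _
  have hn' : (1 : ℝ) ≤ (n : ℝ) ^ (3 / 2 : ℝ) :=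
    Real.one_le_rpow (by exact_mod_cast hn) (by norm_num)
  have h6 := h.c6
  rw [lt_div_iff₀ (by
    have : 0 < (4 / (15 * eps2 n)) ^ (n - 1) := hg
    positivity)] at h6
  have h7 : ε₀ * (1 + 35 * growth n ^ (n - 1))
      ≤ ε₀ * (1 + 35 * (n : ℝ) ^ (3 / 2 : ℝ) * growth n ^ (n - 1)) := by
    have := h.pos
    gcongr
    linarith
  have h8 : growth n = 4 / (15 * eps2 n) := rfl
  rw [← h8] at h6
  linarith

/-! ### Well-conditioned simplices -/

section Simplex

variable {V : Type*} [NormedAddCommGroup V] [NormedSpace ℝ V]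

/-- If each vertex `e k` has, up to an error `η` in the position of the previous vertices, height
at least `1.95 ε` over the affine span of the previous vertices, then barycentric coordinates are
controlled by norms. -/
theorem sum_abs_le_of_heights (e : ℕ → V) (n : ℕ) {ε g η : ℝ} (hg : 10000 ≤ g)
    (hgε : g * ε = 4 / 15) (hη0 : 0 ≤ η) (hη : 20 * g ^ (n - 1) * η ≤ 1 / 1000)
    (h01 : 1 / 10 ≤ ‖e 1 - e 0‖) (hL : ∀ k, 1 ≤ k → k < n → ‖e (k + 1) - e k‖ ≤ 2 / 5)
    (hheight : ∀ k, 2 ≤ k → k ≤ n → ∃ e' : ℕ → V, (∀ m < k, ‖e' m - e m‖ ≤ η) ∧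
      ∀ s : ℕ → ℝ, ∑ m ∈ Finset.range k, s m = 1 →
        1.95 * ε ≤ ‖e k - ∑ m ∈ Finset.range k, s m • e' m‖) :
    ∀ k, 1 ≤ k → k ≤ n → ∀ t : ℕ → ℝ, ∑ m ∈ Finset.range (k + 1), t m = 0 →
      ∑ m ∈ Finset.range (k + 1), |t m|
        ≤ 20 * g ^ (k - 1) * ‖∑ m ∈ Finset.range (k + 1), t m • e m‖ := by
  intro k hk
  induction k, hk using Nat.le_induction with
  | base =>
    intro _ t ht
    simp only [Finset.sum_range_succ, Finset.sum_range_zero, zero_add] at ht ⊢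
    -- The sum is `2 * |t 1|` and the edge has length at least `1 / 10`; this is the origin of the
    -- factor `20`.
    have h0 : t 0 = -t 1 := by linarith
    rw [h0, neg_smul, neg_add_eq_sub, ← smul_sub, norm_smul, abs_neg, Real.norm_eq_abs]
    simp only [Nat.sub_self, pow_zero, mul_one]
    nlinarith [abs_nonneg (t 1)]
  | succ k hk ih =>
    intro hkn t ht
    have hg0 : 0 < g := by linarith
    set z := ∑ m ∈ Finset.range (k + 1 + 1), t m • e m with hz
    set c := |t (k + 1)| with hc
    have hc0 : 0 ≤ c := abs_nonneg _
    set a := ∑ m ∈ Finset.range (k + 1), |t m| with ha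
    set T := 20 * g ^ (k - 1) with hT
    have hT20 : 20 ≤ T := by
      have : 1 ≤ g ^ (k - 1) := one_le_pow₀ (by linarith)
      linarith
    -- eliminate the last vertex in favour of the previous one
    let t' : ℕ → ℝ := fun m => t m + if m = k then t (k + 1) else 0
    have hmem : k ∈ Finset.range (k + 1) := Finset.mem_range.mpr (Nat.lt_succ_self k)
    have ht' : ∑ m ∈ Finset.range (k + 1), t' m = 0 := by
      rw [Finset.sum_add_distrib, Finset.sum_ite_eq' _ k, if_pos hmem, ← Finset.sum_range_succ, ht]
    have hz' : ∑ m ∈ Finset.range (k + 1), t' m • e m = z - t (k + 1) • (e (k + 1) - e k) := by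
      simp only [t', add_smul, ite_smul, zero_smul]
      rw [Finset.sum_add_distrib, Finset.sum_ite_eq' _ k, if_pos hmem, hz,
        Finset.sum_range_succ _ (k + 1), smul_sub]
      abel
    have h1 : a ≤ T * (‖z‖ + 2 / 5 * c) + c := by
      have h2 := ih (by omega) t' ht'
      rw [hz'] at h2
      have h3 : a ≤ ∑ m ∈ Finset.range (k + 1), |t' m| + c := by
        have h4 : ∀ m ∈ Finset.range (k + 1), |t m| ≤ |t' m| + if m = k then c else 0 := by
          intro m _
          simp only [t']
          split_ifs with hmk
          · have := abs_sub (t m + t (k + 1)) (t (k + 1))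
            rwa [add_sub_cancel_right] at this
          · simp
        refine (Finset.sum_le_sum h4).trans (le_of_eq ?_)
        rw [Finset.sum_add_distrib, Finset.sum_ite_eq' _ k, if_pos hmem]
      have h5 : ‖z - t (k + 1) • (e (k + 1) - e k)‖ ≤ ‖z‖ + 2 / 5 * c := by
        refine (norm_sub_le _ _).trans ?_
        rw [norm_smul, Real.norm_eq_abs, mul_comm (2 / 5 : ℝ)]
        gcongr
        exact hL k hk (by omega)
      have h6 : T * ‖z - t (k + 1) • (e (k + 1) - e k)‖ ≤ T * (‖z‖ + 2 / 5 * c) := by gcongr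
      linarith
    -- the height estimate
    have h2 : c * (1.95 * ε) ≤ ‖z‖ + η * a := by
      obtain ⟨e', he', hh⟩ := hheight (k + 1) (by omega) hkn
      by_cases hck : t (k + 1) = 0
      · rw [hc, hck, abs_zero, zero_mul]
        have : 0 ≤ a := Finset.sum_nonneg fun _ _ => abs_nonneg _
        positivity
      · have h3 := hh (fun m => -(t m / t (k + 1))) (by
          rw [Finset.sum_neg_distrib, ← Finset.sum_div]
          rw [Finset.sum_range_succ] at ht
          rw [eq_neg_of_add_eq_zero_left ht, neg_div, div_self hck, neg_neg])
        have h4 : t (k + 1) • (e (k + 1) - ∑ m ∈ Finset.range (k + 1), -(t m / t (k + 1)) • e' m)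
            = z + ∑ m ∈ Finset.range (k + 1), t m • (e' m - e m) := by
          simp only [neg_smul, Finset.sum_neg_distrib, sub_neg_eq_add, smul_add, Finset.smul_sum,
            smul_smul, mul_div_cancel₀ _ hck, smul_sub, Finset.sum_sub_distrib]
          rw [hz, Finset.sum_range_succ _ (k + 1)]
          abel
        calc c * (1.95 * ε) ≤ c * ‖e (k + 1) - ∑ m ∈ Finset.range (k + 1),
                -(t m / t (k + 1)) • e' m‖ := by gcongr
          _ = ‖z + ∑ m ∈ Finset.range (k + 1), t m • (e' m - e m)‖ := by
              rw [← h4, norm_smul, Real.norm_eq_abs]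
          _ ≤ ‖z‖ + ∑ m ∈ Finset.range (k + 1), |t m| * η := by
              refine (norm_add_le _ _).trans ?_
              gcongr
              refine (norm_sum_le _ _).trans (Finset.sum_le_sum fun m hm => ?_)
              rw [norm_smul, Real.norm_eq_abs]
              gcongr
              exact he' m (Finset.mem_range.mp hm)
          _ = ‖z‖ + η * a := by rw [← Finset.sum_mul, mul_comm]
    have hηT : η * T * g ≤ 1 / 1000 := by
      refine le_trans ?_ hη
      have h3 : T * g = 20 * g ^ k := by
        rw [hT, mul_assoc, ← pow_succ, Nat.sub_add_cancel hk]
      rw [mul_assoc, h3, mul_comm]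
      gcongr
      · linarith
      · omega
    have hz0 : 0 ≤ ‖z‖ := norm_nonneg z
    have hηT0 : 0 ≤ η * T := mul_nonneg hη0 (by linarith)
    have hηT' : η * T ≤ 1 / 10000000 := by nlinarith
    have hη20 : η * 20 ≤ η * T := by gcongr
    -- multiply the height estimate by `g`
    have h3 : c ≤ 1.95 * g * ‖z‖ := by
      have h4 : η * a ≤ η * T * ‖z‖ + (2 / 5 * (η * T) + η) * c := by
        have := mul_le_mul_of_nonneg_left h1 hη0
        nlinarith
      have h5 : (η * T * ‖z‖) ≤ 1 / 10000000 * ‖z‖ := by gcongr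
      have h6 : (2 / 5 * (η * T) + η) * g ≤ 1 / 2000 := by nlinarith
      -- `1.95 * 4 / 15 = 0.52`, and `1 / 0.52 < 1.95` leaves enough to absorb the terms in `η`.
      have h7 : g * (c * (1.95 * ε)) = 0.52 * c := by
        rw [show g * (c * (1.95 * ε)) = 1.95 * c * (g * ε) by ring, hgε]; ring
      have h8 : g * (c * (1.95 * ε)) ≤ g * (‖z‖ + 1 / 10000000 * ‖z‖) + 1 / 2000 * c := by
        have h9 : g * (c * (1.95 * ε))
            ≤ g * (‖z‖ + 1 / 10000000 * ‖z‖ + (2 / 5 * (η * T) + η) * c) :=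
          mul_le_mul_of_nonneg_left (by linarith) hg0.le
        have h10 : (2 / 5 * (η * T) + η) * g * c ≤ 1 / 2000 * c := by gcongr
        nlinarith
      rw [h7] at h8
      have h11 : 0 ≤ g * ‖z‖ := by positivity
      nlinarith
    rw [Finset.sum_range_succ, ← ha, ← hc, Nat.add_sub_cancel]
    have h4 : 20 * g ^ k = T * g := by
      rw [hT, mul_assoc, ← pow_succ, Nat.sub_add_cancel hk]
    rw [h4]
    -- The main terms are `0.78 * T * g` and `3.9 * g ≤ 0.195 * T * g`, together `0.975 * T * g`;
    -- the remaining `T * ‖z‖` is negligible because `g ≥ 10000`.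
    have h5 : (2 / 5 * T + 2) * c ≤ (2 / 5 * T + 2) * (1.95 * g * ‖z‖) := by gcongr
    have h6 : 20 * (g * ‖z‖) ≤ T * (g * ‖z‖) := by gcongr
    have h7 : 10000 * (T * ‖z‖) ≤ g * (T * ‖z‖) := by gcongr
    nlinarith

end Simplex

/-! ### Solving the perturbed circumcenter equations. -/

section Equidistant

/-- Perturbed Euclidean distance functions to the vertices of a well-conditioned simplex have a
common value near the circumcenter. -/
theorem exists_equidistant {n : ℕ} (e : Fin (n + 1) → E n) {T ρ r β : ℝ}
    (hT : ∀ t : Fin (n + 1) → ℝ, ∑ m, t m = 0 → ∑ m, |t m| ≤ T * ‖∑ m, t m • e m‖)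
    (hT0 : 0 ≤ T) (hβ : 0 ≤ β) (hρ : T * β ≤ ρ) (D : Fin (n + 1) → E n → ℝ)
    (hDc : ∀ m, ContinuousOn (D m) (Metric.closedBall 0 ρ))
    (hD0 : ∀ m, ∀ a ∈ Metric.closedBall (0 : E n) ρ, 0 ≤ D m a)
    (hD : ∀ m, ∀ a ∈ Metric.closedBall (0 : E n) ρ,
      |‖e m‖ ^ 2 - r ^ 2| + |D m a ^ 2 - ‖a - e m‖ ^ 2| ≤ 2 * β) :
    ∃ a ∈ Metric.closedBall (0 : E n) ρ, ∀ m, D m a = D 0 a := by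
  -- The edge map of the simplex. The conditioning bound makes it injective, hence invertible.
  let B₀ : E n →ₗ[ℝ] E n :=
    { toFun := fun t => ∑ m : Fin n, t m • (e m.succ - e 0)
      map_add' := fun s t => by simp [add_smul, Finset.sum_add_distrib]
      map_smul' := fun c t => by simp [Finset.smul_sum, smul_smul] }
  -- coefficients with sum zero
  let ext : E n → Fin (n + 1) → ℝ := fun t => Fin.cons (-∑ m : Fin n, t m) fun m => t m
  have hext0 : ∀ t, ∑ m, ext t m = 0 := fun t => by
    rw [Fin.sum_univ_succ]; simp [ext]
  have hextB : ∀ t, ∑ m, ext t m • e m = B₀ t := fun t => by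
    rw [Fin.sum_univ_succ]
    simp only [ext, Fin.cons_zero, Fin.cons_succ, B₀, LinearMap.coe_mk, AddHom.coe_mk, smul_sub,
      Finset.sum_sub_distrib, neg_smul, Finset.sum_smul]
    abel
  have hBinj : Function.Injective B₀ := by
    refine (injective_iff_map_eq_zero B₀).mpr fun t ht => ?_
    have h1 := hT (ext t) (hext0 t)
    rw [hextB, ht, norm_zero, mul_zero] at h1
    ext m
    have h2 : |ext t m.succ| ≤ 0 :=
      (Finset.single_le_sum (f := fun m => |ext t m|) (fun _ _ => abs_nonneg _)
        (Finset.mem_univ m.succ)).trans h1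
    simpa [ext] using abs_nonpos_iff.mp h2
  let B : E n ≃ₗ[ℝ] E n := LinearEquiv.ofInjectiveEndo B₀ hBinj
  have hB : ∀ t, B t = B₀ t := fun t => rfl
  -- The adjoint of the inverse edge map sends `ψ` to the vector with prescribed inner products `ψ
  -- m` with the edges `e m.succ - e 0`.
  let sol : E n →ₗ[ℝ] E n := LinearMap.adjoint (B.symm : E n →ₗ[ℝ] E n)
  have hsol : ∀ ψ t, inner ℝ (sol ψ) (B t) = inner ℝ ψ t := fun ψ t => by
    rw [LinearMap.adjoint_inner_left]
    simp
  -- Expanding `‖a - e m‖²` gives `D m a ^ 2 = 2 φ m a + r ^ 2 + ‖a‖ ^ 2 - 2 ⟨a, e m⟩`. So `D m a =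
  -- D 0 a` amounts to `⟨a, e m - e 0⟩ = φ m a - φ 0 a`, which is the fixed point equation for `sol
  -- ∘ ψ`.
  let φ : Fin (n + 1) → E n → ℝ := fun m a =>
    (‖e m‖ ^ 2 - r ^ 2 + (D m a ^ 2 - ‖a - e m‖ ^ 2)) / 2
  have hφ : ∀ m, ∀ a ∈ Metric.closedBall (0 : E n) ρ, |φ m a| ≤ β := fun m a ha => by
    have h1 := abs_add_le (‖e m‖ ^ 2 - r ^ 2) (D m a ^ 2 - ‖a - e m‖ ^ 2)
    have h2 := hD m a ha
    simp only [φ]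
    rw [abs_div, abs_of_pos (by norm_num : (0 : ℝ) < 2)]
    linarith
  let ψ : E n → E n := fun a => WithLp.toLp 2 fun m : Fin n => φ m.succ a - φ 0 a
  have hφc : ∀ m, ContinuousOn (φ m) (Metric.closedBall 0 ρ) := fun m =>
    (continuousOn_const.add (((hDc m).pow 2).sub
      ((continuousOn_id.sub continuousOn_const).norm.pow 2))).div_const 2
  have hψc : ContinuousOn ψ (Metric.closedBall 0 ρ) := by
    refine (PiLp.continuous_toLp 2 _).comp_continuousOn ?_
    exact continuousOn_pi.mpr fun m => (hφc m.succ).sub (hφc 0)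
  have hρ0 : 0 ≤ ρ := (mul_nonneg hT0 hβ).trans hρ
  obtain ⟨a, ha, hfix⟩ := exists_fixedPoint_of_closedBall (fun a => sol (ψ a)) ρ hρ0
    (sol.continuous_of_finiteDimensional.comp_continuousOn hψc) (by
      intro a ha
      -- Pairing `q = sol (ψ a)` with itself expresses `‖q‖²` as `∑ t m * φ m a`, where `∑ t m = 0`
      -- and `∑ t m • e m = q`. The conditioning bound then gives `‖q‖ ≤ T * β ≤ ρ`.
      have h1 : ‖sol (ψ a)‖ ^ 2 ≤ β * (T * ‖sol (ψ a)‖) := by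
        set q := sol (ψ a) with hq
        have h2 : ‖q‖ ^ 2 = inner ℝ (ψ a) (B.symm q) := by
          rw [← hsol, ← hq, LinearEquiv.apply_symm_apply, real_inner_self_eq_norm_sq]
        have h3 : inner ℝ (ψ a) (B.symm q) = ∑ m, ext (B.symm q) m * φ m a := by
          rw [Fin.sum_univ_succ]
          simp only [ext, Fin.cons_zero, Fin.cons_succ, PiLp.inner_apply, ψ]
          simp [mul_sub, Finset.sum_sub_distrib, mul_comm]
          rw [← Finset.sum_mul]
          ring
        rw [h2, h3]
        calc ∑ m, ext (B.symm q) m * φ m a ≤ ∑ m, |ext (B.symm q) m| * β := by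
              refine Finset.sum_le_sum fun m _ => (le_abs_self _).trans ?_
              rw [abs_mul]
              gcongr
              exact hφ m a ha
          _ = β * ∑ m, |ext (B.symm q) m| := by rw [← Finset.sum_mul, mul_comm]
          _ ≤ β * (T * ‖q‖) := by
              gcongr
              have := hT _ (hext0 (B.symm q))
              rwa [hextB, ← hB, LinearEquiv.apply_symm_apply] at this
      rcases (norm_nonneg (sol (ψ a))).eq_or_lt with h0 | h0
      · rw [← h0]; exact hρ0
      · have : ‖sol (ψ a)‖ ≤ T * β := by
          by_contra! hlt
          nlinarith
        linarith)
  refine ⟨a, ha, fun m => ?_⟩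
  refine Fin.cases rfl (fun m => ?_) m
  have h1 : inner ℝ a (e m.succ - e 0) = φ m.succ a - φ 0 a := by
    have h2 := hsol (ψ a) (EuclideanSpace.single m 1)
    have h3 : B (EuclideanSpace.single m 1) = e m.succ - e 0 := by
      rw [hB]
      simp [B₀]
    have hfix' : sol (ψ a) = a := hfix
    rw [h3, hfix'] at h2
    rw [h2, EuclideanSpace.inner_single_right]
    simp [ψ]
  have h2 : ‖a - e m.succ‖ ^ 2 - ‖a - e 0‖ ^ 2
      = -2 * inner ℝ a (e m.succ - e 0) + ‖e m.succ‖ ^ 2 - ‖e 0‖ ^ 2 := by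
    rw [norm_sub_sq_real, norm_sub_sq_real, inner_sub_right]
    ring
  rw [h1] at h2
  have h3 : D m.succ a ^ 2 = D 0 a ^ 2 := by
    simp only [φ] at h2
    linarith
  exact (sq_eq_sq₀ (hD0 _ a ha) (hD0 _ a ha)).mp h3

end Equidistant

/-! ### Transverse translation of sections in the Reeb neighborhood. -/

section Transversal

variable {n : ℕ} {M X ι : Type*} [MetricSpace M] [MetricSpace X]
  {A : FoliatedAtlas n M X ι} {S : Scales A} {R : ReebNbhd A S}

open FoliatedAtlas

lemma FoliatedAtlas.leafDist_le_add {x y z : M} {a b : ℝ} (ha : 0 ≤ a) (hb : 0 ≤ b)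
    (hxy : A.leafDist x y ≤ ENNReal.ofReal a) (hyz : A.leafDist y z ≤ ENNReal.ofReal b) :
    A.leafDist x z ≤ ENNReal.ofReal (a + b) := by
  rw [ENNReal.ofReal_add ha hb]
  exact (leafDist_triangle x y z).trans (add_le_add hxy hyz)

lemma FoliatedAtlas.leafDist_lt_add {x y z : M} {a b : ℝ} (ha : 0 ≤ a) (hb : 0 ≤ b)
    (hxy : A.leafDist x y < ENNReal.ofReal a) (hyz : A.leafDist y z ≤ ENNReal.ofReal b) :
    A.leafDist x z < ENNReal.ofReal (a + b) := by
  rw [ENNReal.ofReal_add ha hb]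
  exact (leafDist_triangle x y z).trans_lt
    (ENNReal.add_lt_add_of_lt_of_le (hyz.trans_lt ENNReal.ofReal_lt_top).ne hxy hyz)

namespace Scales

lemma rF_pos (S : Scales A) : 0 < S.rF :=
  lt_min (lt_min S.delta_pos (div_pos S.lamF_pos (by norm_num)))
    (lt_min S.lamEps_pos one_pos)

lemma rF_le_epsFU (S : Scales A) : S.rF ≤ S.epsFU := S.rF_le

lemma rF_le_lamF (S : Scales A) : S.rF ≤ S.lamF / 5 :=
  (min_le_left _ _).trans (min_le_right _ _)

lemma rF_le_lamEps (S : Scales A) : S.rF ≤ S.lamEps :=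
  (min_le_right _ _).trans (min_le_left _ _)

lemma eps0_pos (S : Scales A) : 0 < S.eps0 := S.eps0_adm.pos

lemma eps0_lt (S : Scales A) : S.eps0 < 1 / 2000 := S.eps0_adm.c1

lemma eps0_mul_rF_pos (S : Scales A) : 0 < S.eps0 * S.rF := mul_pos S.eps0_pos S.rF_pos

/-- Transverse variation of the leafwise distance in one chart. -/
lemma leafDist_pt_le (S : Scales A) {i : ι} {w w' : X} (hw : w ∈ A.T i) (hw' : w' ∈ A.T i)
    (hd : dist w w' ≤ S.rStar) {a b : E n} (ha : a ∈ closedCube n) (hb : b ∈ closedCube n) :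
    A.leafDist (A.pt i a w) (A.pt i b w)
      ≤ A.leafDist (A.pt i a w') (A.pt i b w') + ENNReal.ofReal (S.eps0 * S.rF) := by
  have h1 : A.leafDist (A.pt i a w) (A.pt i b w) - A.leafDist (A.pt i a w') (A.pt i b w')
      ≤ metricVar A i S.rStar := by
    refine le_trans (le_max_left _ (A.leafDist (A.pt i a w') (A.pt i b w')
      - A.leafDist (A.pt i a w) (A.pt i b w))) ?_
    exact le_iSup₂_of_le w hw (le_iSup₂_of_le w' hw' (le_iSup_of_le hd
      (le_iSup₂_of_le a ha (le_iSup₂_of_le (f := fun b _ => _) b hb le_rfl))))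
  exact tsub_le_iff_left.mp (h1.trans (S.var_le i))

/-- Leafwise divergence of the standard sections through one point in two charts. -/
lemma leafDist_section_le (S : Scales A) {i j : ι} {z : M} (hi : z ∈ A.Ubar i)
    (hj : z ∈ A.Ubar j) {w w' : X} (hw : w ∈ A.T i) (hw' : w' ∈ A.T j)
    (hd : dist w (A.pr i z) ≤ S.rStar) (hd' : dist w' (A.pr j z) ≤ S.rStar)
    (hm : (A.plaque i w ∩ A.plaque j w').Nonempty) :
    A.leafDist (A.pt i (A.lam i z) w) (A.pt j (A.lam j z) w')
      ≤ ENNReal.ofReal (S.eps0 * S.rF) := by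
  refine le_trans ?_ (S.div_le z)
  exact le_iSup₂_of_le i j (le_iSup₂_of_le hi hj (le_iSup₂_of_le w hw (le_iSup₂_of_le w' hw'
    (le_iSup₂_of_le hd hd' (le_iSup_of_le hm le_rfl)))))

end Scales

namespace ReebNbhd

lemma mem_U_idx (R : ReebNbhd A S) {z : M} (hz : z ∈ R.Net) {y : M}
    (hy : A.leafDist z y < ENNReal.ofReal S.epsFU) :
    y ∈ A.U (R.idx z) ∧ A.pr (R.idx z) y = A.pr (R.idx z) z := by
  have hsub : ∀ y, A.leafDist z y < ENNReal.ofReal S.epsFU → y ∈ A.U (R.idx z) := fun y hy =>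
    R.idx_ball z hz ((S.leaf_lebesgue z).trans
      (Metric.closedBall_subset_ball (by linarith [S.epsU_pos])) hy.le)
  exact mem_U_of_leafDist_lt (R.idx_ball z hz (Metric.mem_ball_self S.epsU_pos))
    (fun y _ h => hsub y h) hy

lemma self_mem_U (R : ReebNbhd A S) {z : M} (hz : z ∈ R.Net) : z ∈ A.U (R.idx z) :=
  R.idx_ball z hz (Metric.mem_ball_self S.epsU_pos)

/-- Each step of the chain starts in the plaque of `c k`, whose open plaque contains the next net
point. Uniqueness of the holonomy relation then forces the label of `c (k + 1)`. -/
lemma h_label (R : ReebNbhd A S) {z : M} (hz : z ∈ R.near) :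
    R.h z (A.pr (R.idx R.z0) R.z0) = A.pr (R.idx z) z := by
  obtain ⟨m, c, H, hc0, hcm, hcN, hcd, hH0, hH, hHm⟩ := R.h_chain z hz
  have key : ∀ k ≤ m, H k (A.pr (R.idx R.z0) R.z0) = A.pr (R.idx (c k)) (c k) := by
    intro k
    induction k with
    | zero => intro _; rw [hH0 _ R.w0_mem, hc0]
    | succ k ih =>
      intro hk
      have h1 := hH k hk _ R.w0_mem
      rw [ih (by omega)] at h1
      have h2 := R.mem_U_idx (hcN k (by omega)) (hcd k hk)
      exact S.hol_unique _ _ _ _ _ h1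
        ⟨c (k + 1), h2.1, R.self_mem_U (hcN _ hk), h2.2, rfl⟩
  rw [← hHm _ R.w0_mem, key m le_rfl, hcm]

lemma h_mem (R : ReebNbhd A S) {z : M} (hz : z ∈ R.near) {v : X} (hv : v ∈ R.V0) :
    R.h z v ∈ A.T (R.idx z) := by
  obtain ⟨m, c, H, hc0, hcm, hcN, hcd, hH0, hH, hHm⟩ := R.h_chain z hz
  rw [← hHm v hv, ← hcm]
  rcases m with _ | m
  · rw [hH0 v hv, hc0]
    exact R.V0_sub hv
  · obtain ⟨x, -, hx, -, hx'⟩ := hH m (by omega) v hv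
    rw [← hx']
    exact pr_mem hx.1

lemma dist_h_le (R : ReebNbhd A S) {z : M} (hz : z ∈ R.near) {v v' : X} (hv : v ∈ R.V0)
    (hv' : v' ∈ R.V0) : dist (R.h z v) (R.h z v') ≤ S.rStar := by
  have h1 := R.h_small z hz v hv
  have h2 := R.h_small z hz v' hv'
  have := dist_triangle_right (R.h z v) (R.h z v') (A.pr (R.idx z) z)
  linarith

/-- The label of the base plaque. -/
def base (R : ReebNbhd A S) : X := A.pr (R.idx R.z0) R.z0

lemma base_mem (R : ReebNbhd A S) : R.base ∈ R.V0 := R.w0_mem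

end ReebNbhd

namespace NiceTransversal

variable {N : NiceTransversal A S R} {j k : Fin N.p} {v v' : X}

/-- The label, in its chart, of the plaque over `v` of the `j`-th section. -/
def label (N : NiceTransversal A S R) (j : Fin N.p) (v : X) : X := R.h (N.z j) v

/-- The point over `v` of the `j`-th section. -/
def pointAt (N : NiceTransversal A S R) (j : Fin N.p) (v : X) : M :=
  A.pt (N.θ j) (A.lam (N.θ j) (N.ξ j)) (N.label j v)

lemma mem_piece_iff {x : M} : x ∈ N.piece j ↔ ∃ v ∈ R.V0, N.pointAt j v = x := Iff.rfl

lemma label_mem (hv : v ∈ R.V0) : N.label j v ∈ A.T (N.θ j) := R.h_mem (N.z_mem j) hv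

lemma dist_label_le (hv : v ∈ R.V0) (hv' : v' ∈ R.V0) :
    dist (N.label j v) (N.label j v') ≤ S.rStar := R.dist_h_le (N.z_mem j) hv hv'

lemma leafDist_pt_label_le (N : NiceTransversal A S R) (j : Fin N.p) (hv : v ∈ R.V0)
    (hv' : v' ∈ R.V0) {a b : E n} (ha : a ∈ closedCube n) (hb : b ∈ closedCube n) :
    A.leafDist (A.pt (N.θ j) a (N.label j v)) (A.pt (N.θ j) b (N.label j v))
      ≤ A.leafDist (A.pt (N.θ j) a (N.label j v')) (A.pt (N.θ j) b (N.label j v'))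
        + ENNReal.ofReal (S.eps0 * S.rF) :=
  S.leafDist_pt_le (label_mem hv) (label_mem hv') (dist_label_le hv hv') ha hb

lemma label_base : N.label j R.base = A.pr (N.θ j) (N.z j) := R.h_label (N.z_mem j)

lemma mem_U_of_leafDist_ξ {y : M}
    (hy : A.leafDist (N.ξ j) y ≤ ENNReal.ofReal (S.rF / 2)) :
    y ∈ A.U (N.θ j) ∧ A.pr (N.θ j) y = N.label j R.base := by
  rw [label_base]
  refine R.mem_U_idx (R.near_sub _ (N.z_mem j)) ?_
  have h1 := N.ξ_near j
  rw [leafDist_comm] at h1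
  refine (leafDist_lt_add (half_pos S.epsFU_pos).le (half_pos S.rF_pos).le h1 hy).trans_le
    (ENNReal.ofReal_le_ofReal ?_)
  linarith [S.rF_le_epsFU]

lemma ξ_mem_U : N.ξ j ∈ A.U (N.θ j) :=
  (mem_U_of_leafDist_ξ (by rw [leafDist_self]; exact zero_le)).1

lemma pr_ξ : A.pr (N.θ j) (N.ξ j) = N.label j R.base :=
  (mem_U_of_leafDist_ξ (by rw [leafDist_self]; exact zero_le)).2

lemma pointAt_base : N.pointAt j R.base = N.ξ j := by
  rw [pointAt, ← pr_ξ, pt_lam_pr ξ_mem_U.1]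

lemma pointAt_mem_U (hv : v ∈ R.V0) : N.pointAt j v ∈ A.U (N.θ j) :=
  pt_mem_U ξ_mem_U.2 (label_mem hv)

lemma pr_pointAt (hv : v ∈ R.V0) : A.pr (N.θ j) (N.pointAt j v) = N.label j v :=
  pr_pt' ξ_mem_U.2 (label_mem hv)

lemma lam_pointAt (hv : v ∈ R.V0) :
    A.lam (N.θ j) (N.pointAt j v) = A.lam (N.θ j) (N.ξ j) :=
  lam_pt' ξ_mem_U.2 (label_mem hv)

lemma pointAt_mem_plaque (hv : v ∈ R.V0) :
    N.pointAt j v ∈ A.plaque (N.θ j) (N.label j v) :=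
  ⟨U_subset_Ubar (pointAt_mem_U hv), pr_pointAt hv⟩

/-- The leafwise disk of radius `0.49 r_F` around a point of a section lies in the open plaque of
this point. -/
lemma mem_U_of_leafDist_pointAt (hv : v ∈ R.V0) {y : M}
    (hy : A.leafDist (N.pointAt j v) y < ENNReal.ofReal (0.49 * S.rF)) :
    y ∈ A.U (N.θ j) ∧ A.pr (N.θ j) y = N.label j v := by
  have hr := S.rF_pos
  have he := S.eps0_lt
  have he' := S.eps0_pos
  rw [← pr_pointAt hv]
  refine mem_U_of_leafDist_lt (pointAt_mem_U hv) (fun y hy hd => ?_) hy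
  rw [pr_pointAt hv] at hy
  have hyp : A.pt (N.θ j) (A.lam (N.θ j) y) (N.label j v) = y := by
    rw [← hy.2, pt_lam_pr hy.1.1]
  have h1 := N.leafDist_pt_label_le j R.base_mem hv
    (cube_subset_closedCube n (ξ_mem_U (N := N) (j := j)).2) hy.1.2
  rw [hyp] at h1
  -- The point of the base plaque with the same coordinates as `y` is within `0.49 r_F + ε₀ r_F ≤
  -- r_F / 2` of `ξ j`, hence in the open flow box. Lying in the open cube depends on the leafwise
  -- coordinates only.
  have h2 : A.leafDist (N.ξ j) (A.pt (N.θ j) (A.lam (N.θ j) y) (N.label j R.base))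
      ≤ ENNReal.ofReal (S.rF / 2) := by
    rw [← pointAt_base (N := N) (j := j)]
    refine h1.trans ((add_le_add_left hd.le _).trans ?_)
    rw [← ENNReal.ofReal_add (by positivity) (by positivity)]
    refine ENNReal.ofReal_le_ofReal ?_
    nlinarith
  have h3 := mem_cube_of_pt_mem_U (closedCube_subset_bigCube n hy.1.2) (label_mem R.base_mem)
    (mem_U_of_leafDist_ξ h2).1
  exact ⟨hy.1.1, h3⟩

/-- The `k`-th section lies in the chart of the `j`-th section, over the same labels. -/
def Adj (N : NiceTransversal A S R) (j k : Fin N.p) : Prop :=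
  ∀ v ∈ R.V0, N.pointAt k v ∈ A.U (N.θ j) ∧ A.pr (N.θ j) (N.pointAt k v) = N.label j v

lemma eq_of_mem_plaque (hv : v ∈ R.V0) (hv' : v' ∈ R.V0)
    (h : N.pointAt k v' ∈ A.plaque (N.θ j) (N.label j v)) : v = v' :=
  (R.embedded _ (N.z_mem j) _ (N.z_mem k) v hv v' hv' ⟨_, h, pointAt_mem_plaque hv'⟩).1

/-- Plaques meeting over `v` force the closed base plaques to meet, by the embedding. Coherence
needs the open base plaques to meet: the translate of the point of the `k`-th section into base
plaque `j` stays close to `ξ k`, so it lies in both. -/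
lemma hol_label_of_leafDist_lt (hv : v ∈ R.V0)
    (h : A.leafDist (N.pointAt j v) (N.pointAt k v) < ENNReal.ofReal (0.4 * S.rF)) {v' : X}
    (hv' : v' ∈ R.V0) : A.Hol (N.θ j) (N.θ k) (N.label j v') (N.label k v') := by
  have hr := S.rF_pos
  have he := S.eps0_lt
  have hy := mem_U_of_leafDist_pointAt hv (h.trans_le (ENNReal.ofReal_le_ofReal (by linarith)))
  refine R.coherent _ (N.z_mem j) _ (N.z_mem k) ?_ v' hv'
  have hm := (R.embedded _ (N.z_mem j) _ (N.z_mem k) v hv v hv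
    ⟨_, ⟨U_subset_Ubar hy.1, hy.2⟩, pointAt_mem_plaque hv⟩).2
  have h1 := S.leafDist_section_le (U_subset_Ubar hy.1)
    (U_subset_Ubar (pointAt_mem_U (N := N) (j := k) hv))
    (w := N.label j R.base) (w' := N.label k R.base)
    (label_mem R.base_mem) (label_mem R.base_mem)
    (by rw [hy.2]; exact dist_label_le R.base_mem hv)
    (by rw [pr_pointAt hv]; exact dist_label_le R.base_mem hv)
    (by rw [label_base, label_base]; exact hm)
  rw [lam_pointAt hv, leafDist_comm] at h1
  have h2 : A.leafDist (N.ξ k) (A.pt (N.θ j) (A.lam (N.θ j) (N.pointAt k v)) (N.label j R.base))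
      ≤ ENNReal.ofReal (S.rF / 2) := by
    rw [← pointAt_base (N := N) (j := k)]
    exact h1.trans (ENNReal.ofReal_le_ofReal (by nlinarith))
  have h3 := mem_U_of_leafDist_ξ h2
  exact ⟨_, pt_mem_U hy.1.2 (label_mem R.base_mem), h3.1,
    (pr_pt' hy.1.2 (label_mem R.base_mem)).trans label_base, h3.2.trans label_base⟩

/-- Sections which are close over one label are close over all labels. -/
lemma leafDist_pointAt_lt (hv : v ∈ R.V0)
    (h : A.leafDist (N.pointAt j v) (N.pointAt k v) < ENNReal.ofReal (0.4 * S.rF)) {v' : X}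
    (hv' : v' ∈ R.V0) :
    A.leafDist (N.pointAt j v') (N.pointAt k v') < ENNReal.ofReal (0.41 * S.rF) := by
  have hr := S.rF_pos
  have he := S.eps0_lt
  have he' := S.eps0_pos
  have hy := mem_U_of_leafDist_pointAt hv (h.trans_le (ENNReal.ofReal_le_ofReal (by linarith)))
  obtain ⟨x, hxj, hxk, hxj', hxk'⟩ := hol_label_of_leafDist_lt hv h hv'
  have h1 := S.leafDist_section_le (U_subset_Ubar hy.1)
    (U_subset_Ubar (pointAt_mem_U (N := N) (j := k) hv))
    (label_mem hv') (label_mem hv')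
    (by rw [hy.2]; exact dist_label_le hv' hv)
    (by rw [pr_pointAt hv]; exact dist_label_le hv' hv)
    ⟨x, ⟨U_subset_Ubar hxj, hxj'⟩, ⟨U_subset_Ubar hxk, hxk'⟩⟩
  rw [lam_pointAt hv] at h1
  have h2 := N.leafDist_pt_label_le j hv' hv
    (cube_subset_closedCube n (ξ_mem_U (N := N) (j := j)).2) (cube_subset_closedCube n hy.1.2)
  rw [← hy.2, pt_lam_pr hy.1.1, hy.2] at h2
  have h3 := h2.trans_lt (ENNReal.add_lt_add_right ENNReal.ofReal_ne_top h)
  rw [← ENNReal.ofReal_add (by positivity) (by positivity)] at h3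
  refine (leafDist_lt_add (by positivity) (by positivity) h3 h1).trans_le
    (ENNReal.ofReal_le_ofReal (by nlinarith))

lemma adj_of_leafDist_lt (hv : v ∈ R.V0)
    (h : A.leafDist (N.pointAt j v) (N.pointAt k v) < ENNReal.ofReal (0.4 * S.rF)) :
    N.Adj j k := fun v' hv' => by
  have hr := S.rF_pos
  exact mem_U_of_leafDist_pointAt hv' ((leafDist_pointAt_lt hv h hv').trans_le
    (ENNReal.ofReal_le_ofReal (by linarith)))

/-- Transverse translation changes the leafwise distance from a point of a chart to the points
of a section by at most `2 ε₀ r_F`. -/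
lemma Adj.leafDist_le (h : N.Adj j k) (hv : v ∈ R.V0) (hv' : v' ∈ R.V0) {p : E n}
    (hp : p ∈ closedCube n) :
    A.leafDist (A.pt (N.θ j) p (N.label j v)) (N.pointAt k v)
      ≤ A.leafDist (A.pt (N.θ j) p (N.label j v')) (N.pointAt k v')
        + ENNReal.ofReal (2 * S.eps0 * S.rF) := by
  have he := S.eps0_mul_rF_pos
  have hs := h v hv
  have hs' := h v' hv'
  -- Two errors occur: the divergence of the `k`-th section from the section of chart `j` through
  -- the same point, and the variation of the metric within chart `j`.
  have h1 := S.leafDist_section_le (U_subset_Ubar hs'.1)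
    (U_subset_Ubar (pointAt_mem_U (N := N) (j := k) hv'))
    (label_mem hv) (label_mem hv)
    (by rw [hs'.2]; exact dist_label_le hv hv')
    (by rw [pr_pointAt hv']; exact dist_label_le hv hv')
    ⟨_, ⟨U_subset_Ubar hs.1, hs.2⟩, pointAt_mem_plaque hv⟩
  rw [lam_pointAt hv'] at h1
  have h2 := N.leafDist_pt_label_le j hv hv' hp
    (cube_subset_closedCube n hs'.1.2)
  rw [← hs'.2, pt_lam_pr hs'.1.1, hs'.2] at h2
  refine (leafDist_triangle _ _ _).trans ((add_le_add h2 h1).trans ?_)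
  rw [add_assoc, ← ENNReal.ofReal_add he.le he.le]
  gcongr
  linarith

end NiceTransversal

end Transversal

/-! ### Heights of the points of a nice transversal over earlier ones. -/

section Heights

variable {n : ℕ} {M X ι : Type*} [MetricSpace M] [MetricSpace X]
  {A : FoliatedAtlas n M X ι} {S : Scales A} {R : ReebNbhd A S}

open FoliatedAtlas

namespace FoliatedAtlas.IsCoordBall

variable {i : ι} {w : X} {p : E n} {u : E n ≃L[ℝ] E n} {ρ κ K : ℝ} {a b : E n}

lemma mono (h : A.IsCoordBall i w p u ρ κ K) {ρ' : ℝ} (hρ : ρ' ≤ ρ) :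
    A.IsCoordBall i w p u ρ' κ K where
  label := h.label
  mem b hb := h.mem b (hb.trans_le hρ)
  lower b hb := h.lower b (hb.trans_le hρ)
  upper b hb := h.upper b (hb.trans_le hρ)

/-- The condition on `D` excludes that a path of about this length reaches the boundary of the ball.
-/
lemma norm_sub_le (h : A.IsCoordBall i w p u ρ κ K) (hκ : 0 < κ) (hb : ‖b‖ < ρ) {D : ℝ}
    (hD0 : 0 ≤ D) (hD : D < κ * (ρ - ‖a‖))
    (hd : A.leafDist (A.pt i (p + u a) w) (A.pt i (p + u b) w) ≤ ENNReal.ofReal D) :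
    κ * ‖a - b‖ ≤ D := by
  have h1 := (h.le_leafDist hκ hb (min_le_right ‖a - b‖ _) (min_le_left _ (ρ - ‖a‖))).trans hd
  rw [ENNReal.ofReal_le_ofReal_iff hD0] at h1
  rcases min_cases ‖a - b‖ (ρ - ‖a‖) with h2 | h2
  · rwa [h2.1] at h1
  · rw [h2.1] at h1
    linarith

end FoliatedAtlas.IsCoordBall

namespace Scales

/-- Around every point there is a chart containing all leafwise disks of radius `r_F` centered at
points nearby. -/
lemma exists_chart (S : Scales A) (x : M) :
    ∃ i, ∀ y, A.leafDist x y ≤ ENNReal.ofReal S.rF → A.closedDisk y S.rF ⊆ A.U i := by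
  obtain ⟨i, hi⟩ := S.lebesgue x
  refine ⟨i, fun y hy q hq => hi ?_⟩
  have hle := ENNReal.ofReal_le_ofReal S.rF_le_epsFU
  have h1 := S.leaf_lebesgue x (hy.trans hle : y ∈ A.closedDisk x S.epsFU)
  have h2 := S.leaf_lebesgue y (hq.trans hle : q ∈ A.closedDisk y S.epsFU)
  rw [Metric.mem_closedBall] at h1 h2
  rw [Metric.mem_ball]
  linarith [dist_triangle q y x, S.epsU_pos]

lemma exists_isCoordBall (S : Scales A) {i : ι} {x : M} (hx : A.closedDisk x S.rF ⊆ A.U i) :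
    ∃ u : E n ≃L[ℝ] E n, A.IsFrame i x (u : E n →ₗ[ℝ] E n) ∧
      A.IsApproxEuclid i x (u : E n →ₗ[ℝ] E n) S.rF S.eps0 ∧
      A.IsCoordBall i (A.pr i x) (A.lam i x) u (0.999 * S.rF) (1 - S.eps0) (1 + S.eps0) := by
  have hr := S.rF_pos
  have he := S.eps0_pos
  have he' := S.eps0_lt
  have hxU : x ∈ A.U i := hx (by simp [closedDisk])
  obtain ⟨u, hu⟩ := exists_frame hxU
  have happ := S.approx S.rF hr S.rF_le_lamEps
    (by linarith [S.rF_le_lamF, S.lamF_pos]) x i hx _ hu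
  refine ⟨u, hu, happ, (happ.isCoordBall hxU he.le (by linarith) hx).mono ?_⟩
  rw [le_div_iff₀ (by linarith)]
  nlinarith

end Scales

namespace NiceTransversal

variable {N : NiceTransversal A S R}

lemma ξ_mem_piece (N : NiceTransversal A S R) (j : Fin N.p) : N.ξ j ∈ N.piece j :=
  mem_piece_iff.mpr ⟨R.base, R.base_mem, pointAt_base⟩

lemma lt_leafDist_ξ {l j : Fin N.p} (h : l < j) :
    ENNReal.ofReal (0.12 * S.rF) < A.leafDist (N.ξ l) (N.ξ j) := by
  have hj : j ≠ ⟨0, N.p_pos⟩ := by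
    rintro rfl
    exact absurd h (by simp [Fin.lt_def])
  exact (N.position j hj (N.ξ j) (N.ξ'_near j hj)).2.1 l h _ (N.ξ_mem_piece l)

/-- In approximately Euclidean coordinates, a point `ξ j` of a nice transversal is far from the
affine span of a slight perturbation of nearby preceding points. -/
lemma exists_perturbation_height (hn : 1 ≤ n) {i : ι} {w : X} {p : E n} {u : E n ≃L[ℝ] E n}
    (h : A.IsCoordBall i w p u (0.999 * S.rF) (1 - S.eps0) (1 + S.eps0))
    (hU : ∀ b, ‖b‖ ≤ 0.192 * S.rF → A.closedDisk (A.pt i (p + u b) w) S.rF ⊆ A.U i)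
    {k : ℕ} (hk : 1 ≤ k) (hkn : k < n) {l : Fin (k + 1) → Fin N.p} (hl : StrictMono l)
    {j : Fin N.p} (hj : ∀ m, l m < j) {e : Fin (k + 1) → E n} {f : E n}
    (he : ∀ m, ‖e m‖ ≤ 0.192 * S.rF) (hf : ‖f‖ ≤ 0.192 * S.rF)
    (heξ : ∀ m, A.pt i (p + u (e m)) w = N.ξ (l m)) (hfξ : A.pt i (p + u f) w = N.ξ j) :
    ∃ e' : Fin (k + 1) → E n, (∀ m, ‖e' m - e m‖ ≤ 0.5 * S.eps0 * S.rF) ∧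
      ∀ s : Fin (k + 1) → ℝ, ∑ m, s m = 1 →
        1.95 * eps2 n * S.rF ≤ ‖f - ∑ m, s m • e' m‖ := by
  have hr := S.rF_pos
  have he0 := S.eps0_pos
  have he1 := S.eps0_lt
  have he2 := S.eps0_adm.c3
  have hε := eps2_le hn
  have hκ : 0 < 1 - S.eps0 := by linarith
  have hsub : ∀ a b : E n, ‖a‖ ≤ 0.192 * S.rF → ‖b‖ ≤ 0.192 * S.rF → ‖a - b‖ ≤ 0.384 * S.rF :=
    fun a b ha hb => (norm_sub_le a b).trans (by linarith)
  have hdist : ∀ a b : E n, ‖a‖ ≤ 0.192 * S.rF → ‖b‖ ≤ 0.192 * S.rF →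
      A.leafDist (A.pt i (p + u a) w) (A.pt i (p + u b) w) ≤ ENNReal.ofReal (0.39 * S.rF) := by
    intro a b ha hb
    refine (h.leafDist_le (by linarith) (by linarith)).trans (ENNReal.ofReal_le_ofReal ?_)
    nlinarith [hsub a b ha hb, norm_nonneg (a - b)]
  set y := N.ξ (l (Fin.last k)) with hy
  set c := e (Fin.last k) with hc
  have hyc : A.pt i (p + u c) w = y := heξ _
  have hcr : ‖c‖ < 0.999 * S.rF := by linarith [he (Fin.last k)]
  have hyU : A.closedDisk y S.rF ⊆ A.U i := hyc ▸ hU c (he _)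
  have hy1 : y ∈ A.U i := hyU (by simp [closedDisk])
  have hpr : A.pr i y = w := by rw [← hyc]; exact pr_pt' (h.mem c hcr) h.label
  have hlam : A.lam i y = p + u c := by rw [← hyc]; exact lam_pt' (h.mem c hcr) h.label
  obtain ⟨u', hu', happ, hball⟩ := S.exists_isCoordBall hyU
  rw [hpr, hlam] at hball
  have hchart : A.chart i y = (p + u c, w) := by rw [← hlam, ← hpr]; rfl
  have hframe : ∀ b, A.g i (p + u c, w) (u' b) (u' b) = ‖b‖ ^ 2 := fun b => by
    have := hu'.2 b b
    rw [hchart, real_inner_self_eq_norm_sq] at this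
    exact this
  have hcomp : ∀ b, u (u.symm (u' b)) = u' b := fun b => u.apply_symm_apply _
  have hlow : ∀ b, (1 - S.eps0) * ‖u.symm (u' b)‖ ≤ ‖b‖ := fun b => by
    have := h.lower c hcr (u.symm (u' b))
    rwa [hcomp, hframe, Real.sqrt_sq (norm_nonneg _)] at this
  have hupp : ∀ b, ‖b‖ ≤ (1 + S.eps0) * ‖u.symm (u' b)‖ := fun b => by
    have := h.upper c hcr (u.symm (u' b))
    rwa [hcomp, hframe, Real.sqrt_sq (norm_nonneg _)] at this
  have hpt : ∀ b, A.pt i (A.lam i y + u' b) (A.pr i y) = A.pt i (p + u (c + u.symm (u' b))) w := by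
    intro b
    rw [hlam, hpr, map_add, hcomp, add_assoc]
  have hexp : ∀ b q, ‖b‖ ≤ 0.4 * S.rF → A.IsExp i y (u' b) q →
      A.leafDist q (A.pt i (p + u (c + u.symm (u' b))) w)
        ≤ ENNReal.ofReal (0.4 * S.eps0 * S.rF) := by
    intro b q hb hq
    rw [← hpt]
    refine (happ.exp_close b (by linarith) ?_ q hq).trans (ENNReal.ofReal_le_ofReal ?_)
    · rw [hlam]; exact hball.mem b (by linarith)
    · nlinarith
  have hnorm : ∀ b, ‖b‖ ≤ 0.4 * S.rF → ‖c + u.symm (u' b)‖ < 0.999 * S.rF := by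
    intro b hb
    have h1 := hlow b
    have h2 := norm_add_le c (u.symm (u' b))
    have h3 := he (Fin.last k)
    have h4 := norm_nonneg (u.symm (u' b))
    nlinarith
  -- Convexity of the disk supplies a shortest geodesic to each vertex; its initial velocity is the
  -- geodesic coordinate required by the slab condition.
  have hgeo : ∀ m, ∃ a, A.IsExp i y (u' a) (N.ξ (l m)) ∧
      ENNReal.ofReal ‖a‖ = A.leafDist y (N.ξ (l m)) ∧ ‖a‖ ≤ 0.4 * S.rF := by
    intro m
    have h1 : A.leafDist y (N.ξ (l m)) ≤ ENNReal.ofReal (0.39 * S.rF) := by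
      rw [← hyc, ← heξ]; exact hdist _ _ (he _) (he _)
    have h2 := S.disk_convex y (0.39 * S.rF) (by positivity)
      (by linarith [S.rF_le_lamF, S.lamF_pos])
    obtain ⟨γ, hγ, -⟩ := (h2 y (by simp [closedDisk]) _ h1).1
    have h3 : A.leafDist y (N.ξ (l m))
        = ENNReal.ofReal (A.leafDist y (N.ξ (l m))).toReal :=
      (ENNReal.ofReal_toReal (h1.trans_lt ENNReal.ofReal_lt_top).ne).symm
    obtain ⟨a, ha, ha'⟩ := exists_isExp_of_isMinGeodesic hy1 hu' hγ ENNReal.toReal_nonneg h3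
    refine ⟨a, ha, by rw [ha', ← h3], ?_⟩
    rw [ha']
    exact (ENNReal.toReal_le_of_le_ofReal (by positivity) h1).trans (by linarith)
  choose a haexp hanorm hale using hgeo
  -- The displaced vertices are the straight images of the geodesic coordinates. Their affine
  -- combinations are the straight images of vectors in the linear span of the `a m`.
  refine ⟨fun m => c + u.symm (u' (a m)), fun m => ?_, fun s hs => ?_⟩
  · have h1 := hexp (a m) _ (hale m) (haexp m)
    rw [← heξ] at h1
    have h2 := h.norm_sub_le hκ (hnorm _ (hale m)) (by positivity)
      (by nlinarith [he m]) h1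
    rw [norm_sub_rev]
    nlinarith [norm_nonneg (e m - (c + u.symm (u' (a m))))]
  · set b := ∑ m, s m • a m with hb
    have hsum : ∑ m, s m • (c + u.symm (u' (a m))) = c + u.symm (u' b) := by
      simp only [smul_add, Finset.sum_add_distrib, ← Finset.sum_smul, hs, one_smul, hb, map_sum,
        map_smul]
    rw [hsum]
    -- Within this range the slab condition applies to `exp b`, and passing from it to the straight
    -- image costs at most the drop from `2 ε₂` to `1.95 ε₂`.
    by_cases hbr : ‖b‖ ≤ 0.4 * S.rF
    · obtain ⟨q, hq⟩ := hball.exists_isExp hκ (a₀ := 0) (v₀ := u' b) (by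
        rw [map_zero, add_zero, hframe, Real.sqrt_sq (norm_nonneg _), norm_zero, zero_add,
          div_lt_iff₀ hκ]
        nlinarith)
      rw [map_zero, add_zero, hyc] at hq
      have hj0 : j ≠ ⟨0, N.p_pos⟩ := by
        rintro rfl
        exact absurd (hj 0) (by simp [Fin.lt_def])
      have hspan : b ∈ Submodule.span ℝ (Set.range a) :=
        Submodule.sum_mem _ fun m _ => Submodule.smul_mem _ _ (Submodule.subset_span ⟨m, rfl⟩)
      have hinj : Function.Injective fun m => N.ξ (l m) := by
        intro m m' hm
        have hm' : N.ξ (l m) = N.ξ (l m') := hm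
        rcases lt_trichotomy m m' with hlt | heq | hlt
        · have := lt_leafDist_ξ (hl hlt)
          rw [hm', leafDist_self] at this
          exact absurd this (by simp)
        · exact heq
        · have := lt_leafDist_ξ (hl hlt)
          rw [hm', leafDist_self] at this
          exact absurd this (by simp)
      have h1 := N.slabs j hj0 k hk hkn l (fun m => N.ξ (l m)) hl hj hinj
        (fun m => N.ξ_mem_piece (l m))
        (fun m => by
          refine (leafDist_lt_add (by positivity) (by positivity : (0 : ℝ) ≤ 0.39 * S.rF)
            (N.ξ'_near j hj0) ?_).le.trans (ENNReal.ofReal_le_ofReal (by linarith))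
          rw [← hfξ, ← heξ]
          exact hdist _ _ hf (he m))
        i u' a hu' (fun m => ⟨haexp m, hanorm m⟩) b hspan (by linarith) q hq
      have h2 := h.leafDist_le (a := f) (by linarith) (hnorm b hbr)
      rw [hfξ] at h2
      have h3 := hexp b q hbr hq
      rw [leafDist_comm] at h3
      have h4 := h1.trans_le (leafDist_le_add (by positivity) (by positivity) h2 h3)
      rw [ENNReal.ofReal_lt_ofReal_iff_of_nonneg (by have := eps2_pos hn; positivity)] at h4
      nlinarith [norm_nonneg (f - (c + u.symm (u' b)))]
    -- A longer `b` lands far away in any case: all vertices lie within `0.384 r_F` of each other,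
    -- which leaves a gap of about `0.015 r_F`.
    · have h1 := hupp b
      have h2 := hsub f c hf (he _)
      have h3 : ‖u.symm (u' b)‖ - ‖f - c‖ ≤ ‖f - (c + u.symm (u' b))‖ := by
        rw [← sub_sub, norm_sub_rev (f - c)]
        exact norm_sub_norm_le _ _
      nlinarith [norm_nonneg (u.symm (u' b))]

end NiceTransversal

end Heights

/-! ### Conditioning of small simplices and translation of the circumcenter. -/

section Center

variable {n : ℕ} {M X ι : Type*} [MetricSpace M] [MetricSpace X]
  {A : FoliatedAtlas n M X ι} {S : Scales A} {R : ReebNbhd A S}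

open FoliatedAtlas

namespace NiceTransversal

variable {N : NiceTransversal A S R}

/-- In approximately Euclidean coordinates, the coefficients of an affine dependence among the
vertices of a small simplex of a nice transversal are controlled. -/
lemma sum_abs_le (hn : 1 ≤ n) {i : ι} {w : X} {p : E n} {u : E n ≃L[ℝ] E n}
    (h : A.IsCoordBall i w p u (0.999 * S.rF) (1 - S.eps0) (1 + S.eps0))
    (hU : ∀ b, ‖b‖ ≤ 0.192 * S.rF → A.closedDisk (A.pt i (p + u b) w) S.rF ⊆ A.U i)
    {l : Fin (n + 1) → Fin N.p} (hl : StrictMono l) {e : Fin (n + 1) → E n}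
    (he : ∀ m, ‖e m‖ ≤ 0.192 * S.rF) (heξ : ∀ m, A.pt i (p + u (e m)) w = N.ξ (l m))
    (t : Fin (n + 1) → ℝ) (ht : ∑ m, t m = 0) :
    ∑ m, |t m| ≤ 20 * growth n ^ (n - 1) / S.rF * ‖∑ m, t m • e m‖ := by
  have hr := S.rF_pos
  have he0 := S.eps0_pos
  have he1 := S.eps0_lt
  have hadm := S.eps0_adm.mul_growth_lt hn
  have h3 := eps3_le hn
  have hg := le_growth hn
  have hgp : 0 < growth n ^ (n - 1) := pow_pos (by linarith) _
  have hκ : 0 < 1 - S.eps0 := by linarith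
  have hsub : ∀ m m', ‖e m - e m'‖ ≤ 0.384 * S.rF := fun m m' =>
    (norm_sub_le _ _).trans (by linarith [he m, he m'])
  have hsep : ∀ m m', m < m' → 0.1 * S.rF ≤ ‖e m - e m'‖ := fun m m' hm => by
    have h1 := lt_leafDist_ξ (hl hm)
    rw [← heξ, ← heξ] at h1
    have h2 := h1.trans_le (h.leafDist_le (by linarith [he m]) (by linarith [he m']))
    rw [ENNReal.ofReal_lt_ofReal_iff_of_nonneg (by positivity)] at h2
    nlinarith [norm_nonneg (e m - e m')]
  -- The vertices are rescaled to unit size `r_F = 1`. The value `0` beyond index `n` plays no role.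
  let ε : ℕ → E n := fun m => if hm : m < n + 1 then S.rF⁻¹ • e ⟨m, hm⟩ else 0
  have hε : ∀ m : Fin (n + 1), ε m = S.rF⁻¹ • e m := fun m => dif_pos m.is_lt
  have hε' : ∀ m (hm : m < n + 1), ε m = S.rF⁻¹ • e ⟨m, hm⟩ := fun m hm => dif_pos hm
  have hnorm : ∀ q : E n, ‖S.rF⁻¹ • q‖ = ‖q‖ / S.rF := fun q => by
    rw [norm_smul, norm_inv, Real.norm_of_nonneg hr.le, div_eq_inv_mul]
  have key := sum_abs_le_of_heights ε n (ε := eps2 n) (g := growth n) (η := 0.5 * S.eps0) hg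
    (growth_mul_eps2 hn) (by positivity) (by nlinarith)
    (by
      rw [hε' 1 (by omega), hε' 0 (by omega), ← smul_sub, hnorm, le_div_iff₀ hr, norm_sub_rev]
      have := hsep ⟨0, by omega⟩ ⟨1, by omega⟩ (Fin.mk_lt_mk.mpr one_pos)
      linarith)
    (fun k _ hk => by
      rw [hε' _ (by omega), hε' k (by omega), ← smul_sub, hnorm, div_le_iff₀ hr]
      linarith [hsub ⟨k + 1, by omega⟩ ⟨k, by omega⟩])
    (fun k hk hkn => by
      -- Vertex `k' + 1` is compared with the `k' + 1` vertices before it. As `l` is increasing,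
      -- these belong to sections chosen earlier, as the slab condition requires.
      obtain ⟨k, rfl⟩ : ∃ k', k = k' + 1 := ⟨k - 1, by omega⟩
      let ψ : Fin (k + 1) → Fin (n + 1) := Fin.castLE (by omega)
      have hψ : StrictMono ψ := Fin.strictMono_castLE _
      obtain ⟨e', he', hs⟩ := N.exists_perturbation_height hn h hU (by omega : 1 ≤ k)
        (by omega) (hl.comp hψ) (j := l ⟨k + 1, by omega⟩)
        (fun m => hl (Fin.lt_def.mpr m.is_lt)) (e := e ∘ ψ) (f := e ⟨k + 1, by omega⟩)
        (fun m => he _) (he _) (fun m => heξ _) (heξ _)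
      refine ⟨fun m => if hm : m < k + 1 then S.rF⁻¹ • e' ⟨m, hm⟩ else 0, fun m hm => ?_,
        fun s hs1 => ?_⟩
      · simp only [hm, dif_pos]
        rw [hε' m (by omega), ← smul_sub, hnorm, div_le_iff₀ hr]
        exact he' ⟨m, hm⟩
      · have h1 := hs (fun m => s m) (by rw [← hs1, Finset.sum_range])
        have h2 : ∑ m ∈ Finset.range (k + 1),
            s m • (if hm : m < k + 1 then S.rF⁻¹ • e' ⟨m, hm⟩ else (0 : E n))
            = S.rF⁻¹ • ∑ m : Fin (k + 1), s m • e' m := by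
          rw [Finset.sum_range, Finset.smul_sum]
          refine Finset.sum_congr rfl fun m _ => ?_
          rw [dif_pos m.is_lt, smul_comm]
        rw [h2, hε' _ (by omega), ← smul_sub, hnorm, le_div_iff₀ hr]
        exact h1)
    n hn le_rfl (fun m => if hm : m < n + 1 then t ⟨m, hm⟩ else 0)
    (by rw [Finset.sum_range]; simpa only [Fin.is_lt, dif_pos, Fin.eta] using ht)
  rw [Finset.sum_range, Finset.sum_range] at key
  simp only [Fin.is_lt, dif_pos, Fin.eta, hε] at key
  have hsm : ∑ m, t m • S.rF⁻¹ • e m = S.rF⁻¹ • ∑ m, t m • e m := by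
    rw [Finset.smul_sum]
    exact Finset.sum_congr rfl fun m _ => smul_comm _ _ _
  rw [hsm, hnorm] at key
  calc _ ≤ _ := key
    _ = _ := by ring

set_option maxHeartbeats 1000000 in
/-- The circumcenter of a small simplex of a nice transversal can be translated transversely. -/
theorem exists_center (hn : 1 ≤ n) {j : Fin N.p} {l : Fin (n + 1) → Fin N.p} (hl : StrictMono l)
    (hadj : ∀ m, N.Adj j (l m)) (hjl : ∃ m, l m = j) {q : E n} (hq : q ∈ cube n) {v₀ v : X}
    (hv₀ : v₀ ∈ R.V0) (hv : v ∈ R.V0) {r : ℝ} (hr0 : 0 < r) (hr1 : r ≤ 0.19 * S.rF)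
    (hd : ∀ m, A.leafDist (A.pt (N.θ j) q (N.label j v₀)) (N.pointAt (l m) v₀)
      = ENNReal.ofReal r) :
    ∃ c ∈ cube n, ∃ r' > 0,
      (∀ m, A.leafDist (A.pt (N.θ j) c (N.label j v)) (N.pointAt (l m) v) = ENNReal.ofReal r') ∧
      A.leafDist (A.pt (N.θ j) c (N.label j v)) (A.pt (N.θ j) q (N.label j v))
        ≤ ENNReal.ofReal (eps3 n * S.rF / 2) ∧
      |r' - r| < eps3 n * S.rF / 2 + 2 * S.eps0 * S.rF := by
  have hr := S.rF_pos
  have he0 := S.eps0_pos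
  have he1 := S.eps0_lt
  have her := S.eps0_mul_rF_pos
  have hadm := S.eps0_adm.mul_growth_lt hn
  have h3 := eps3_le hn
  have hgp : 0 < growth n ^ (n - 1) := pow_pos (by linarith [le_growth hn]) _
  have hκ : 0 < 1 - S.eps0 := by linarith
  have hqc := cube_subset_closedCube n hq
  -- The center is moved to the base plaque, where the vertices become the points `ξ (l m)` to which
  -- separation and slab conditions refer.
  set ω := A.pt (N.θ j) q (N.label j R.base) with hω
  -- distances from the translated center in the base leaf
  have hωle : ∀ m, A.leafDist ω (N.ξ (l m)) ≤ ENNReal.ofReal (r + 2 * S.eps0 * S.rF) := fun m => by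
    have h1 := (hadj m).leafDist_le R.base_mem hv₀ hqc
    rw [hd, pointAt_base, ← ENNReal.ofReal_add hr0.le (by positivity)] at h1
    exact h1
  have hωge : ∀ m, ENNReal.ofReal r
      ≤ A.leafDist ω (N.ξ (l m)) + ENNReal.ofReal (2 * S.eps0 * S.rF) := fun m => by
    have h1 := (hadj m).leafDist_le hv₀ R.base_mem hqc
    rwa [hd, pointAt_base] at h1
  -- coordinates around the center
  obtain ⟨i, hi⟩ := S.exists_chart ω
  have hωU : A.closedDisk ω S.rF ⊆ A.U i := hi ω (by simp)
  have hω1 : ω ∈ A.U i := hωU (by simp [closedDisk])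
  obtain ⟨u, -, -, h⟩ := S.exists_isCoordBall hωU
  set w := A.pr i ω
  set p := A.lam i ω
  have hp0 : A.pt i (p + u 0) w = ω := by rw [map_zero, add_zero]; exact pt_lam_pr hω1.1
  have hdω : ∀ b, ‖b‖ ≤ 0.192 * S.rF →
      A.leafDist ω (A.pt i (p + u b) w) ≤ ENNReal.ofReal ((1 + S.eps0) * ‖b‖) := fun b hb => by
    have h1 := h.leafDist_le (a := 0) (b := b) (by rw [norm_zero]; positivity) (by linarith)
    rwa [hp0, zero_sub, norm_neg] at h1
  have hU : ∀ b, ‖b‖ ≤ 0.192 * S.rF → A.closedDisk (A.pt i (p + u b) w) S.rF ⊆ A.U i :=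
    fun b hb => hi _ ((hdω b hb).trans (ENNReal.ofReal_le_ofReal (by nlinarith)))
  have hcoord : ∀ m, ∃ b : E n, ‖b‖ ≤ 0.192 * S.rF ∧ A.pt i (p + u b) w = N.ξ (l m) := fun m => by
    obtain ⟨b, hb, hb'⟩ := h.exists_of_leafDist_lt hκ (a := 0) (r := 0.192 * S.rF)
      (y := N.ξ (l m)) (by rw [norm_zero]; linarith) (by
        rw [hp0]
        refine (hωle m).trans_lt ((ENNReal.ofReal_lt_ofReal_iff (by positivity)).mpr ?_)
        nlinarith)
    rw [sub_zero] at hb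
    exact ⟨b, hb.le, hb'.symm⟩
  choose e he heξ using hcoord
  have hT := N.sum_abs_le hn h hU hl he heξ
  have her1 : ∀ m, |‖e m‖ - r| ≤ 2.3 * S.eps0 * S.rF := fun m => by
    have h1 := h.norm_sub_le hκ (a := 0) (b := e m) (D := r + 2 * S.eps0 * S.rF)
      (by linarith [he m]) (by positivity)
      (by rw [norm_zero]; nlinarith) (by rw [hp0, heξ]; exact hωle m)
    rw [zero_sub, norm_neg] at h1
    have h2 := (hωge m).trans (add_le_add_left (heξ m ▸ hdω _ (he m)) _)
    rw [← ENNReal.ofReal_add (by positivity) (by positivity),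
      ENNReal.ofReal_le_ofReal_iff (by positivity)] at h2
    rw [abs_le]
    constructor <;> nlinarith [he m]
  -- the translated coordinates
  set ρ := 20 * growth n ^ (n - 1) * S.eps0 * S.rF with hρ
  have hρ0 : 0 < ρ := by positivity
  have hρ1 : ρ ≤ 0.001 * S.rF := by
    rw [hρ]
    gcongr
    nlinarith
  -- The factor `35` in the condition on `ε₀` exceeds `20 * (1 + ε₀)`.
  have hρ2 : (1 + S.eps0) * ρ + S.eps0 * S.rF < eps3 n * S.rF / 2 := by
    rw [hρ]
    have : (1 + S.eps0) * (20 * growth n ^ (n - 1) * S.eps0) + S.eps0 < eps3 n / 2 := by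
      nlinarith [mul_pos hgp he0]
    nlinarith
  have hball : ∀ b ∈ Metric.closedBall (0 : E n) ρ, ‖b‖ ≤ ρ := fun b hb => by simpa using hb
  have hchart : ∀ b, ‖b‖ ≤ 0.01 * S.rF → A.pt i (p + u b) w ∈ A.U (N.θ j) ∧
      A.pr (N.θ j) (A.pt i (p + u b) w) = N.label j R.base := fun b hb => by
    -- Since section `j` is one of the vertex sections, points near `ω` are within `r_F / 2` of `ξ
    -- j`, and so in the chart `θ j`.
    obtain ⟨m, hm⟩ := hjl
    refine mem_U_of_leafDist_ξ ?_
    have h1 := hωle m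
    rw [hm, leafDist_comm] at h1
    exact (leafDist_le_add (by positivity) (by positivity) h1 (hdω b (by linarith))).trans
      (ENNReal.ofReal_le_ofReal (by nlinarith))
  let c : E n → E n := fun b => A.lam (N.θ j) (A.pt i (p + u b) w)
  have hc : ∀ b, ‖b‖ ≤ 0.01 * S.rF → c b ∈ cube n := fun b hb => (hchart b hb).1.2
  have hcbase : ∀ b, ‖b‖ ≤ 0.01 * S.rF →
      A.pt (N.θ j) (c b) (N.label j R.base) = A.pt i (p + u b) w := fun b hb => by
    rw [← (hchart b hb).2]; exact pt_lam_pr (hchart b hb).1.1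
  have hc0 : c 0 = q := by
    simp only [c]
    rw [hp0, hω, lam_pt' hq (label_mem R.base_mem)]
  -- A candidate center is parametrized by base coordinates `b` and carried into the plaque over `v`
  -- with its coordinates in chart `θ j`. Its distances to the vertices over `v` are the perturbed
  -- Euclidean distances `D m`.
  let Φ : E n → M := fun b => A.pt (N.θ j) (c b) (N.label j v)
  let D : Fin (n + 1) → E n → ℝ := fun m b => (A.leafDist (Φ b) (N.pointAt (l m) v)).toReal
  have hΦle : ∀ m b, ‖b‖ ≤ 0.01 * S.rF → A.leafDist (Φ b) (N.pointAt (l m) v)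
      ≤ ENNReal.ofReal ((1 + S.eps0) * ‖b - e m‖ + 2 * S.eps0 * S.rF) := fun m b hb => by
    have h1 := (hadj m).leafDist_le hv R.base_mem (cube_subset_closedCube n (hc b hb))
    rw [hcbase b hb, pointAt_base, ← heξ] at h1
    rw [ENNReal.ofReal_add (by positivity) (by positivity)]
    exact h1.trans (add_le_add_left
      (h.leafDist_le (by linarith) (by linarith [he m])) _)
  have hΦtop : ∀ m b, ‖b‖ ≤ 0.01 * S.rF → A.leafDist (Φ b) (N.pointAt (l m) v) ≠ ⊤ :=
    fun m b hb => ((hΦle m b hb).trans_lt ENNReal.ofReal_lt_top).ne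
  have hDof : ∀ m b, ‖b‖ ≤ 0.01 * S.rF →
      A.leafDist (Φ b) (N.pointAt (l m) v) = ENNReal.ofReal (D m b) := fun m b hb =>
    (ENNReal.ofReal_toReal (hΦtop m b hb)).symm
  have hD0 : ∀ m b, 0 ≤ D m b := fun m b => ENNReal.toReal_nonneg
  have hbe : ∀ m b, ‖b‖ ≤ 0.01 * S.rF → ‖b - e m‖ ≤ 0.202 * S.rF := fun m b hb =>
    (norm_sub_le _ _).trans (by linarith [he m])
  have hDle : ∀ m b, ‖b‖ ≤ 0.01 * S.rF → |D m b - ‖b - e m‖| ≤ 2.3 * S.eps0 * S.rF := by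
    intro m b hb
    have h1 := hΦle m b hb
    rw [hDof m b hb, ENNReal.ofReal_le_ofReal_iff (by positivity)] at h1
    have h2 := (hadj m).leafDist_le R.base_mem hv (cube_subset_closedCube n (hc b hb))
    rw [hcbase b hb, pointAt_base, ← heξ] at h2
    change _ ≤ A.leafDist (Φ b) (N.pointAt (l m) v) + _ at h2
    rw [hDof m b hb, ← ENNReal.ofReal_add (hD0 m b) (by positivity)] at h2
    have h4 := (h.le_leafDist hκ (a := b) (b := e m) (by linarith [he m])
      (r := ‖b - e m‖) (by linarith [hbe m b hb]) le_rfl).trans h2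
    rw [ENNReal.ofReal_le_ofReal_iff (by have := hD0 m b; positivity)] at h4
    have h5 := hbe m b hb
    rw [abs_le]
    constructor <;> nlinarith
  have hDc : ∀ m, ContinuousOn (D m) (Metric.closedBall 0 ρ) := by
    intro m b hb
    have hb1 : ‖b‖ < 0.01 * S.rF := by linarith [hball b hb]
    have hcc : ContinuousAt c b := by
      have h1 : ContinuousAt (fun b => A.pt i (p + u b) w) b :=
        ContinuousAt.comp (f := fun b => p + u b) (g := fun y => A.pt i y w)
          (continuousAt_pt (cube_subset_bigCube n (h.mem b (by linarith))) h.label) (by fun_prop)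
      exact ContinuousAt.comp (f := fun b => A.pt i (p + u b) w)
        (continuousAt_lam (hchart b hb1.le).1.1) h1
    have h1 : Tendsto (fun b' => A.leafDist (Φ b) (Φ b')) (𝓝 b) (𝓝 0) :=
      (tendsto_leafDist_pt (cube_subset_bigCube n (hc b hb1.le)) (label_mem hv)).comp hcc
    have h2 : Tendsto (fun b' => (A.leafDist (Φ b) (Φ b')).toReal) (𝓝 b) (𝓝 0) := by
      rw [← ENNReal.toReal_zero]
      exact (ENNReal.tendsto_toReal ENNReal.zero_ne_top).comp h1
    refine ContinuousAt.continuousWithinAt ?_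
    refine tendsto_iff_dist_tendsto_zero.mpr (squeeze_zero' (Eventually.of_forall
      fun _ => dist_nonneg) ?_ h2)
    have hev : ∀ᶠ b' in 𝓝 b, ‖b'‖ < 0.01 * S.rF :=
      continuous_norm.continuousAt.eventually_lt continuousAt_const hb1
    filter_upwards [hev] with b' hb'
    have hfin : A.leafDist (Φ b) (Φ b') ≠ ⊤ := by
      refine ne_top_of_le_ne_top ?_ (leafDist_triangle _ (N.pointAt (l m) v) _)
      rw [leafDist_comm _ (Φ b')]
      exact ENNReal.add_ne_top.mpr ⟨hΦtop m b hb1.le, hΦtop m b' hb'.le⟩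
    have h3 := ENNReal.toReal_mono (ENNReal.add_ne_top.mpr ⟨hfin, hΦtop m b' hb'.le⟩)
      (leafDist_triangle (Φ b) (Φ b') (N.pointAt (l m) v))
    have h4 := ENNReal.toReal_mono (ENNReal.add_ne_top.mpr
      ⟨by rwa [leafDist_comm], hΦtop m b hb1.le⟩)
      (leafDist_triangle (Φ b') (Φ b) (N.pointAt (l m) v))
    rw [ENNReal.toReal_add hfin (hΦtop m b' hb'.le)] at h3
    rw [ENNReal.toReal_add (by rwa [leafDist_comm]) (hΦtop m b hb1.le),
      leafDist_comm (Φ b') (Φ b)] at h4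
    rw [Real.dist_eq, abs_le]
    constructor <;> simp only [D] <;> linarith
  have hsq : ∀ x y z : ℝ, 0 ≤ x → 0 ≤ y → |x - y| ≤ 2.3 * S.eps0 * S.rF → x + y ≤ z * S.rF →
      |x ^ 2 - y ^ 2| ≤ 2.3 * z * (S.eps0 * S.rF ^ 2) := by
    intro x y z hx hy hxy hz
    rw [show x ^ 2 - y ^ 2 = (x - y) * (x + y) by ring, abs_mul, abs_of_nonneg (add_nonneg hx hy)]
    calc _ ≤ (2.3 * S.eps0 * S.rF) * (z * S.rF) := by gcongr
      _ = _ := by ring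
  -- An error `2.3 ε₀ r_F` in length becomes, with sums of lengths at most `0.4 r_F` and `0.41 r_F`,
  -- a total error `2.3 * 0.81 < 2` in squares, in units of `ε₀ r_F ^ 2`; this explains `β`. The
  -- radius `ρ` is then exactly `T * β`.
  obtain ⟨b, hb, hbD⟩ := exists_equidistant e hT (by positivity)
    (β := S.eps0 * S.rF ^ 2) (r := r) (ρ := ρ) (by positivity)
    (le_of_eq (by rw [hρ]; field_simp)) D hDc (fun m b _ => hD0 m b) (by
      intro m b hb
      have hb1 : ‖b‖ ≤ 0.01 * S.rF := by linarith [hball b hb]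
      have h1 := hsq _ _ 0.4 (norm_nonneg _) hr0.le (her1 m) (by linarith [he m])
      have h2 := hDle m b hb1
      have h4 := hbe m b hb1
      have h5 := hsq _ _ 0.41 (hD0 m b) (norm_nonneg _) h2 (by
        rw [abs_le] at h2
        nlinarith)
      nlinarith [mul_pos he0 (pow_pos hr 2)])
  have hbρ := hball b hb
  have hb1 : ‖b‖ ≤ 0.01 * S.rF := by linarith
  have hshift : A.leafDist (Φ b) (A.pt (N.θ j) q (N.label j v))
      ≤ ENNReal.ofReal ((1 + S.eps0) * ρ + S.eps0 * S.rF) := by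
    have h1 := N.leafDist_pt_label_le j hv R.base_mem (cube_subset_closedCube n (hc b hb1)) hqc
    rw [hcbase b hb1] at h1
    refine h1.trans ?_
    rw [ENNReal.ofReal_add (by positivity) (by positivity), leafDist_comm]
    gcongr
    refine (hdω b (by linarith)).trans (ENNReal.ofReal_le_ofReal ?_)
    gcongr
  refine ⟨c b, hc b hb1, D 0 b, ?_, fun m => by rw [← hbD m]; exact hDof m b hb1,
    hshift.trans (ENNReal.ofReal_le_ofReal hρ2.le), ?_⟩
  · -- the radius is positive as the vertices are separated
    have h01 : (⟨0, by omega⟩ : Fin (n + 1)) < ⟨1, by omega⟩ := Fin.mk_lt_mk.mpr one_pos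
    have h1 := lt_leafDist_ξ (hl h01)
    rw [← heξ, ← heξ] at h1
    have h2 := h1.trans_le (h.leafDist_le (by linarith [he ⟨0, by omega⟩])
      (by linarith [he ⟨1, by omega⟩]))
    rw [ENNReal.ofReal_lt_ofReal_iff_of_nonneg (by positivity)] at h2
    have h4 := abs_le.mp (hDle ⟨0, by omega⟩ b hb1)
    have h5 := abs_le.mp (hDle ⟨1, by omega⟩ b hb1)
    rw [hbD] at h4 h5
    have h6 := norm_sub_le_norm_sub_add_norm_sub (e ⟨0, by omega⟩) b (e ⟨1, by omega⟩)
    rw [norm_sub_rev _ b] at h6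
    nlinarith [norm_nonneg (e ⟨0, by omega⟩ - e ⟨1, by omega⟩)]
  · have h1 := (hadj 0).leafDist_le hv hv₀ hqc
    have h2 := (hadj 0).leafDist_le hv₀ hv hqc
    rw [hd, ← ENNReal.ofReal_add hr0.le (by positivity)] at h1
    rw [hd] at h2
    have h4 := leafDist_le_add (by positivity) (by positivity) hshift h1
    rw [hDof 0 b hb1, ENNReal.ofReal_le_ofReal_iff (by positivity)] at h4
    rw [leafDist_comm] at hshift
    have h5 := h2.trans (add_le_add_left (leafDist_le_add (by positivity) (hD0 0 b) hshift
      (hDof 0 b hb1).le) _)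
    rw [← ENNReal.ofReal_add (by have := hD0 0 b; positivity) (by positivity),
      ENNReal.ofReal_le_ofReal_iff (by have := hD0 0 b; positivity)] at h5
    rw [abs_lt]
    constructor <;> linarith

end NiceTransversal

end Center

end Matchbox

end

/-! ### Transverse translation of a Delaunay simplex. -/

theorem proposition17p2 {n : ℕ} (hn : 1 ≤ n) {M X ι : Type*}
    [MetricSpace M] [CompactSpace M] [ConnectedSpace M]
    [MetricSpace X] [CompactSpace X] [TotallyDisconnectedSpace X] [Finite ι]
    (A : Matchbox.FoliatedAtlas n M X ι) (S : Matchbox.Scales A)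
    (R : Matchbox.ReebNbhd A S) (N : Matchbox.NiceTransversal A S R)
    -- a Delaunay simplex of the transversal, of radius at most `0.19 r_F`
    (y : Fin (n + 1) → M) (ωy : M) (ry : ℝ)
    (hy : Matchbox.IsDelaunaySimplex A N.carrier (0.19 * S.rF) y ωy ry)
    -- the sections containing its vertices; the last vertex has the largest index
    (i : Fin (n + 1) → Fin N.p) (hyi : ∀ k, y k ∈ N.piece (i k))
    (hi : ∀ k, i k ≤ i (Fin.last n)) :
    -- the simplex lies in one plaque, and its transverse translates are well defined
    (∀ k, y k ∈ N.plaqueAt (i (Fin.last n)) (y (Fin.last n))) ∧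
    ωy ∈ N.plaqueAt (i (Fin.last n)) (y (Fin.last n)) ∧
    (∀ q ∈ N.piece (i (Fin.last n)), ∀ k,
      ∃! x, x ∈ N.piece (i k) ∧ x ∈ N.plaqueAt (i (Fin.last n)) q) ∧
    -- every transverse translate has a circumscribed sphere, close to the translated one
    ∀ x : Fin (n + 1) → M, (∀ k, x k ∈ N.piece (i k)) →
      (∀ k, x k ∈ N.plaqueAt (i (Fin.last n)) (x (Fin.last n))) →
      ∃ (ωx : M) (rx : ℝ), 0 < rx ∧
        ωx ∈ N.plaqueAt (i (Fin.last n)) (x (Fin.last n)) ∧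
        (∀ k, A.leafDist ωx (x k) = ENNReal.ofReal rx ∧
          x k ∈ N.carrier ∧ x k ∈ A.leaf (x (Fin.last n))) ∧
        A.leafDist ωx
            (A.pt (N.θ (i (Fin.last n))) (A.lam (N.θ (i (Fin.last n))) ωy)
              (A.pr (N.θ (i (Fin.last n))) (x (Fin.last n))))
          ≤ ENNReal.ofReal (Matchbox.eps3 n * S.rF / 2) ∧
        |rx - ry| < Matchbox.eps3 n * S.rF / 2 + 2 * S.eps0 * S.rF ∧
        Matchbox.eps3 n * S.rF / 2 + 2 * S.eps0 * S.rF < Matchbox.eps3 n * S.rF := by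
  have hr := S.rF_pos
  set j := i (Fin.last n) with hj
  simp only [Matchbox.NiceTransversal.mem_piece_iff] at hyi
  choose v hv hvy using hyi
  have hydist : ∀ k, A.leafDist (y (Fin.last n)) (y k) < ENNReal.ofReal (0.4 * S.rF) := by
    intro k
    have h1 := (hy.sphere (Fin.last n)).le
    rw [Matchbox.FoliatedAtlas.leafDist_comm] at h1
    refine (Matchbox.FoliatedAtlas.leafDist_le_add hy.pos.le hy.pos.le h1
      (hy.sphere k).le).trans_lt ((ENNReal.ofReal_lt_ofReal_iff (by positivity)).mpr ?_)
    linarith [hy.le]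
  have hylast : N.pointAt j (v (Fin.last n)) = y (Fin.last n) := hvy _
  set v₀ := v (Fin.last n) with hv₀def
  have hv₀ : v₀ ∈ R.V0 := hv _
  have hyU : ∀ k, y k ∈ A.U (N.θ j) ∧ A.pr (N.θ j) (y k) = N.label j v₀ := fun k =>
    Matchbox.NiceTransversal.mem_U_of_leafDist_pointAt hv₀ (by
      rw [hylast]
      exact (hydist k).trans_le (ENNReal.ofReal_le_ofReal (by linarith)))
  have hωU : ωy ∈ A.U (N.θ j) ∧ A.pr (N.θ j) ωy = N.label j v₀ :=
    Matchbox.NiceTransversal.mem_U_of_leafDist_pointAt hv₀ (by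
      rw [hylast, Matchbox.FoliatedAtlas.leafDist_comm, hy.sphere]
      exact (ENNReal.ofReal_lt_ofReal_iff (by positivity)).mpr (by linarith [hy.le]))
  -- A plaque of the embedded Reeb neighborhood meets only sections over its own label.
  have hveq : ∀ k, v k = v₀ := fun k =>
    (Matchbox.NiceTransversal.eq_of_mem_plaque (j := j) hv₀ (hv k) (by
      rw [hvy]
      exact ⟨Matchbox.FoliatedAtlas.U_subset_Ubar (hyU k).1, (hyU k).2⟩)).symm
  have hy₀ : ∀ k, N.pointAt (i k) v₀ = y k := fun k => by rw [← hveq k, hvy]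
  have hprlast : A.pr (N.θ j) (y (Fin.last n)) = N.label j v₀ := (hyU _).2
  have hadj : ∀ k, N.Adj j (i k) := fun k =>
    Matchbox.NiceTransversal.adj_of_leafDist_lt hv₀ (by rw [hylast, hy₀]; exact hydist k)
  have hplaque : ∀ q ∈ N.piece j, ∃ v' ∈ R.V0, A.pr (N.θ j) q = N.label j v' := fun q hq => by
    obtain ⟨v', hv', rfl⟩ := Matchbox.NiceTransversal.mem_piece_iff.mp hq
    exact ⟨v', hv', Matchbox.NiceTransversal.pr_pointAt hv'⟩
  -- Over one label each section has a single point, so distinct vertices belong to distinct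
  -- sections.
  have hinj : Function.Injective i := fun k k' hk => hy.inj (by rw [← hy₀, ← hy₀, hk])
  refine ⟨fun k => ⟨Matchbox.FoliatedAtlas.U_subset_Ubar (hyU k).1,
      by rw [hprlast]; exact (hyU k).2⟩,
    ⟨Matchbox.FoliatedAtlas.U_subset_Ubar hωU.1, by rw [hprlast]; exact hωU.2⟩, fun q hq k => ?_,
    fun x hx hxp => ?_⟩
  · obtain ⟨v', hv', hpr⟩ := hplaque q hq
    have h1 := hadj k v' hv'
    refine ⟨N.pointAt (i k) v', ⟨Matchbox.NiceTransversal.mem_piece_iff.mpr ⟨v', hv', rfl⟩,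
      Matchbox.FoliatedAtlas.U_subset_Ubar h1.1, by rw [hpr]; exact h1.2⟩, ?_⟩
    rintro x ⟨hx, hxp⟩
    obtain ⟨v'', hv'', rfl⟩ := Matchbox.NiceTransversal.mem_piece_iff.mp hx
    rw [Matchbox.NiceTransversal.plaqueAt, hpr] at hxp
    rw [Matchbox.NiceTransversal.eq_of_mem_plaque hv' hv'' hxp]
  · obtain ⟨v', hv', hpr⟩ := hplaque _ (hx (Fin.last n))
    have hxv : ∀ k, N.pointAt (i k) v' = x k := fun k => by
      obtain ⟨v'', hv'', h2⟩ := Matchbox.NiceTransversal.mem_piece_iff.mp (hx k)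
      have h3 := hxp k
      rw [Matchbox.NiceTransversal.plaqueAt, hpr, ← h2] at h3
      rw [Matchbox.NiceTransversal.eq_of_mem_plaque hv' hv'' h3, h2]
    -- sort the sections by their indices
    set σ := Tuple.sort i with hσ
    -- The height estimates need the vertices in the order in which their sections were chosen,
    -- while equidistance does not depend on the order.
    have hmono : StrictMono (i ∘ σ) :=
      (Tuple.monotone_sort i).strictMono_of_injective (hinj.comp σ.injective)
    have hωpt : A.pt (N.θ j) (A.lam (N.θ j) ωy) (N.label j v₀) = ωy := by
      rw [← hωU.2, Matchbox.FoliatedAtlas.pt_lam_pr hωU.1.1]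
    obtain ⟨c, hc, r', hr', heq, hcω, hrr⟩ := Matchbox.NiceTransversal.exists_center hn hmono
      (fun m => hadj (σ m)) ⟨σ.symm (Fin.last n), by simp [hj]⟩ hωU.1.2 hv₀ hv' hy.pos hy.le
      (fun m => by rw [hωpt, Function.comp_apply, hy₀]; exact hy.sphere _)
    have heq' : ∀ k, A.leafDist (A.pt (N.θ j) c (N.label j v')) (x k) = ENNReal.ofReal r' :=
      fun k => by
        have := heq (σ.symm k)
        rwa [Function.comp_apply, Equiv.apply_symm_apply, hxv] at this
    have hlab := Matchbox.NiceTransversal.label_mem (N := N) (j := j) hv'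
    refine ⟨A.pt (N.θ j) c (N.label j v'), r', hr', ?_, fun k => ⟨heq' k, ?_, ?_⟩, ?_, hrr, ?_⟩
    · refine ⟨Matchbox.FoliatedAtlas.U_subset_Ubar (Matchbox.FoliatedAtlas.pt_mem_U hc hlab), ?_⟩
      rw [Matchbox.FoliatedAtlas.pr_pt' hc hlab, hpr]
    · exact Set.mem_iUnion.mpr ⟨i k, hx k⟩
    · have h1 := (heq' (Fin.last n)).le
      rw [Matchbox.FoliatedAtlas.leafDist_comm] at h1
      exact (Matchbox.FoliatedAtlas.leafDist_le_add hr'.le hr'.le h1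
        (heq' k).le).trans_lt ENNReal.ofReal_lt_top
    · rw [hpr]
      exact hcω
    · nlinarith [S.eps0_adm.c4]
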